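/- **Setting.** Let $R$ be a commutative integral domain of characteristic $\ne 2$ and let $q\in R^\times$ be a primitive $l$-th root of unity with $l$ odd. Let $m,n,r\ge 0$, let $W=\mathfrak S_r$ with basic transpositions $s_k=(k,k+1)$ and length function $\ell$, and write $G^x=x^{-1}Gx$. The Hecke algebra $\mathcal H_R$ of $W$ has $R$-basis $\{\mathcal T_w\}_{w\in W}$ and satisfies $\mathcal T_w\mathcal T_s=\mathcal T_{ws}$ if $\ell(ws)>\ell(w)$ and $\mathcal T_w\mathcal T_s=(q-q^{-1})\mathcal T_w+\mathcal T_{ws}$ otherwise, for $s=s_k$. Let $V$ be the free $R$-module on $v_1,\dots,v_{m+n}$, with parity $\hat a=0$ for $a\le m$ and $\hat a=1$ for $a>m$. For $\mathbf i=(i_1,\dots,i_r)$ with entries in $\{1,\dots,m+n\}$ put $v_{\mathbf i}=v_{i_1}\otimes\cdots\otimes v_{i_r}$ and $\mathbf i w=(i_{w(1)},\dots,i_{w(r)})$. Then $V^{\otimes r}$ is a right $\mathcal H_R$-module by $$v_{\mathbf i}\mathcal T_{s_k}=\begin{cases}(-1)^{\hat i_k\hat i_{k+1}}v_{\mathbf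 i s_k}, & i_k<i_{k+1},\\ q\,v_{\mathbf i}, & i_k=i_{k+1}\le m,\\ -q^{-1}v_{\mathbf i}, & i_k=i_{k+1}>m,\\ (-1)^{\hat i_k\hat i_{k+1}}v_{\mathbf i s_k}+(q-q^{-1})v_{\mathbf i}, & i_k>i_{k+1},\end{cases}$$ and $\mathcal S_R(m|n,r)=\operatorname{End}_{\mathcal H_R}(V^{\otimes r})$ is the $q$-Schur superalgebra. Endomorphisms are written on the right, so in a product the left factor acts first. Parts of compositions may be $0$. For a composition $\alpha$ of $r$, $W_\alpha$ is the standard Young (parabolic) subgroup. Writing $a=sl+t$ with $0\le t<l$, let $P_\alpha\le W_\alpha$ be the parabolic subgroup of the composition obtained from $\alpha$ by replacing every part $a$ by $(l^s,1^t)$. A parabolic subgroup is *$l$-parabolic* if all parts of its composition are $0$, $1$ or $l$. For subgroups $G,H$ of $W$, $G\le_W H$ means that some conjugate $G^x$ is parabolic and contained in $H$. Let $\Lambda$ be the set of compositions $\lambda$ of $r$ into $m+n$ parts. Write $W_\lambda=W_{\lambda^{(0)}}\times W_{\lambda^{(1)}}$ for the decomposition according to the first $m$ and the last $n$ parts, and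 $\mathbf i_\lambda=(1^{\lambda_1},2^{\lambda_2},\dots)$. For a subgroup $G$, $\mathcal D_G$ is the set of shortest representatives of the right cosets $Gw$. For $\lambda,\mu\in\Lambda$ let $$\mathcal D^\circ_{\lambda\mu}=\{d\in\mathcal D_{W_\lambda}\cap\mathcal D_{W_\mu}^{-1} : W_{\lambda^{(0)}}^d\cap W_{\mu^{(1)}}=1=W_{\lambda^{(1)}}^d\cap W_{\mu^{(0)}}\}.$$ For $d\in\mathcal D^\circ_{\lambda\mu}$ the group $W_{\lambda}^d\cap W_\mu$ is parabolic with composition denoted $\lambda d\cap\mu$; let $e_{\mu,\lambda d}\in\operatorname{End}_R(V^{\otimes r})$ send $v_{\mathbf i_\mu}$ to $v_{\mathbf i_\lambda d}$ and all other basis vectors to $0$, and put $$N^d_{\mu\lambda}=\sum_{w\in\mathcal D_{W_\lambda^d\cap W_\mu}}\mathcal T_{w^{-1}}\,e_{\mu,\lambda d}\,\mathcal T_w .$$ The *defect group* of $N^d_{\mu\lambda}$ is $P_{\lambda d\cap\mu}$. For an $l$-parabolic subgroup $P$ let $I_R(P,r)$ be the $R$-span of all $N^d_{\mu\lambda}$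 ($\lambda,\mu\in\Lambda$, $d\in\mathcal D^\circ_{\lambda\mu}$) with $P_{\lambda d\cap\mu}\le_W P$. **Theorem.** 1. Let $\lambda,\mu,\rho\in\Lambda$, $d\in\mathcal D^\circ_{\lambda\mu}$, $d'\in\mathcal D^\circ_{\rho\lambda}$. There are $a_y\in R$ with $N^d_{\mu\lambda}N^{d'}_{\lambda\rho}=\sum_{y\in\mathcal D^\circ_{\rho\mu}}a_yN^y_{\mu\rho}$, and for any such $a_y$: if $a_y\ne0$, then $P_{\rho y\cap\mu}\le_W P_{\lambda d\cap\mu}$ and $P_{\rho y\cap\mu}\le_W P_{\rho d'\cap\lambda}$. 2. For every $l$-parabolic subgroup $P$ of $W$, $I_R(P,r)$ is a two-sided ideal of $\mathcal S_R(m|n,r)$. 3. Write $r=sl+t$ with $0\le t<l$ and, for $0\le k\le s$, let $P_k$ be the $l$-parabolic subgroup of the composition $(1^{t+(s-k)l},l^k)$. Then $$0\subseteq I_R(P_0,r)\subseteq I_R(P_1,r)\subseteq\cdots\subseteq I_R(P_s,r)=\mathcal S_R(m|n,r).$$ -/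

import Mathlib

open scoped TensorProduct

namespace QSchurSuper

/-! ### The symmetric group, its length function and its parabolic subgroups -/

/-- The symmetric group `W = 𝔖_r`, acting on the `r` places `0, 1, …, r - 1`. -/
abbrev W (r : ℕ) : Type := Equiv.Perm (Fin r)

/-- The index set `{k | k + 1 < r}` of the basic transpositions. -/
abbrev Simple (r : ℕ) : Type := {k : ℕ // k + 1 < r}

/-- The place `k`. -/
def Simple.fst {r : ℕ} (k : Simple r) : Fin r := ⟨k.1, Nat.lt_of_succ_lt k.2⟩

/-- The place `k + 1`. -/
def Simple.snd {r : ℕ} (k : Simple r) : Fin r := ⟨k.1 + 1, k.2⟩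

/-- The basic transposition `s_k = (k, k + 1)`. -/
def simpleRefl {r : ℕ} (k : Simple r) : W r := Equiv.swap k.fst k.snd

/-- The product `s_{k₁} s_{k₂} ⋯` of a word in the basic transpositions. -/
def wordProd {r : ℕ} (L : List (Simple r)) : W r := (L.map simpleRefl).prod

theorem wordProd_surjective (r : ℕ) (w : W r) : ∃ L : List (Simple r), wordProd L = w := by
  rcases r with _ | n
  · exact ⟨[], Subsingleton.elim _ _⟩
  · have hw : w ∈ Submonoid.closure
        (Set.range fun i : Fin n ↦ Equiv.swap i.castSucc i.succ) := by
      rw [Equiv.Perm.mclosure_swap_castSucc_succ]; trivial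
    induction hw using Submonoid.closure_induction with
    | mem x hx =>
      obtain ⟨i, rfl⟩ := hx
      refine ⟨[⟨i.1, by omega⟩], ?_⟩
      simp only [wordProd, List.map_cons, List.map_nil, List.prod_cons, List.prod_nil, mul_one]
      rfl
    | one => exact ⟨[], rfl⟩
    | mul x y _ _ hx hy =>
      obtain ⟨L, hL⟩ := hx
      obtain ⟨M, hM⟩ := hy
      exact ⟨L ++ M, by simp [wordProd, ← hL, ← hM]⟩

/-- The length of `w` with respect to the basic transpositions. -/
noncomputable def length {r : ℕ} (w : W r) : ℕ :=
  sInf {n | ∃ L : List (Simple r), wordProd L = w ∧ L.length = n}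

theorem exists_reducedWord {r : ℕ} (w : W r) :
    ∃ L : List (Simple r), wordProd L = w ∧ L.length = length w := by
  obtain ⟨L, hL⟩ := wordProd_surjective r w
  exact Nat.sInf_mem (s := {n | ∃ L : List (Simple r), wordProd L = w ∧ L.length = n})
    ⟨L.length, L, hL, rfl⟩

/-- Some reduced expression of `w`. -/
noncomputable def reducedWord {r : ℕ} (w : W r) : List (Simple r) :=
  (exists_reducedWord w).choose

/-- For a composition `α = (α₁, α₂, …)` (parts may be `0`), the index, counted from `0`, of the
block of `α` that contains the place `k`; the blocks are
`{0, …, α₁ - 1}`, `{α₁, …, α₁ + α₂ - 1}`, …. -/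
def blockIdx : List ℕ → ℕ → ℕ
  | [], _ => 0
  | a :: α, k => if k < a then 0 else blockIdx α (k - a) + 1

theorem blockIdx_lt (α : List ℕ) (k : ℕ) (h : k < α.sum) : blockIdx α k < α.length := by
  induction α generalizing k with
  | nil => simp at h
  | cons a α ih =>
    rw [List.sum_cons] at h
    rw [blockIdx, List.length_cons]
    split_ifs with hk
    · omega
    · have := ih (k - a) (by omega)
      omega

/-- The parabolic (standard Young) subgroup of `𝔖_r` associated with a composition `α` of `r`:
the permutations which leave every block of `α` invariant. -/
def young (r : ℕ) (α : List ℕ) : Subgroup (W r) where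
  carrier := {w | ∀ k, blockIdx α (w k) = blockIdx α k}
  mul_mem' := by
    intro a b ha hb k
    rw [Equiv.Perm.mul_apply, ha, hb]
  one_mem' := fun _ => rfl
  inv_mem' := by
    intro a ha k
    have := ha (a⁻¹ k)
    rw [← Equiv.Perm.mul_apply, mul_inv_cancel, Equiv.Perm.one_apply] at this
    exact this.symm

/-- A subgroup of `𝔖_r` is parabolic if it is the standard Young subgroup of a composition. -/
def IsParabolic {r : ℕ} (G : Subgroup (W r)) : Prop :=
  ∃ α : List ℕ, α.sum = r ∧ G = young r α

/-- A parabolic subgroup is `l`-parabolic if all parts of its composition are `0`, `1` or `l`. -/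
def IsLParabolic (l : ℕ) {r : ℕ} (G : Subgroup (W r)) : Prop :=
  ∃ α : List ℕ, α.sum = r ∧ (∀ a ∈ α, a = 0 ∨ a = 1 ∨ a = l) ∧ G = young r α

/-- The conjugate `G^x = x⁻¹ G x`. -/
def conjBy {r : ℕ} (G : Subgroup (W r)) (x : W r) : Subgroup (W r) :=
  G.map (MulAut.conj x⁻¹).toMonoidHom

/-- `G ≤_W H`: some parabolic conjugate of `G` is contained in `H`. -/
def LeW {r : ℕ} (G H : Subgroup (W r)) : Prop :=
  ∃ x : W r, conjBy G x ≤ H ∧ IsParabolic (conjBy G x)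

/-- The composition `(l^s, 1^t)` of `a`, where `a = s l + t` and `0 ≤ t < l`. -/
def maxLPart (l a : ℕ) : List ℕ := List.replicate (a / l) l ++ List.replicate (a % l) 1

/-- The maximal `l`-parabolic subgroup `P_α = P_(α₁) × P_(α₂) × ⋯` of `W_α`. -/
def maxLParabolic (l r : ℕ) (α : List ℕ) : Subgroup (W r) := young r (α.flatMap (maxLPart l))

/-- The set `𝒟_G` of the shortest representatives of the right cosets `G w`. -/
def cosetReps {r : ℕ} (G : Subgroup (W r)) : Set (W r) :=
  {d | ∀ g ∈ G, length d ≤ length (g * d)}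

/-! ### Compositions with an even and an odd part -/

/-- The set `Λ(m|n, r)`: compositions of `r` into `m + n` parts, the first `m` of which are the
even ones and the last `n` of which are the odd ones. -/
abbrev Comp (m n r : ℕ) : Type := {lam : Fin (m + n) → ℕ // ∑ i, lam i = r}

/-- The list of the parts of a composition. -/
def Comp.parts {m n r : ℕ} (lam : Comp m n r) : List ℕ := List.ofFn lam.1

/-- The multi-index `i_λ = (1, …, 1, 2, …, 2, …)`, in which `i` occurs `λ_i` times. -/
def Comp.word {m n r : ℕ} (lam : Comp m n r) (k : Fin r) : Fin (m + n) :=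
  ⟨blockIdx lam.parts k, by
    have h := blockIdx_lt lam.parts k
      (by rw [Comp.parts, List.sum_ofFn, lam.2]; exact k.2)
    rwa [Comp.parts, List.length_ofFn] at h⟩

/-- The parabolic subgroup `W_λ`. -/
def Comp.group {m n r : ℕ} (lam : Comp m n r) : Subgroup (W r) := young r lam.parts

/-- The even part `W_{λ^(0)}` of `W_λ`: its elements that fix every place in an odd block. -/
def Comp.evenGroup {m n r : ℕ} (lam : Comp m n r) : Subgroup (W r) :=
  lam.group ⊓ fixingSubgroup (W r) {k : Fin r | m ≤ (lam.word k).1}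

/-- The odd part `W_{λ^(1)}` of `W_λ`: its elements that fix every place in an even block. -/
def Comp.oddGroup {m n r : ℕ} (lam : Comp m n r) : Subgroup (W r) :=
  lam.group ⊓ fixingSubgroup (W r) {k : Fin r | (lam.word k).1 < m}

/-- The set `𝒟_{λμ} = 𝒟_λ ∩ 𝒟_μ⁻¹` of distinguished double coset representatives. -/
def doubleReps {m n r : ℕ} (lam mu : Comp m n r) : Set (W r) :=
  {d | d ∈ cosetReps lam.group ∧ d⁻¹ ∈ cosetReps mu.group}

/-- The set `𝒟°_{λμ}` of those `d ∈ 𝒟_{λμ}` that satisfy the even-odd trivial intersection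
property. -/
def superReps {m n r : ℕ} (lam mu : Comp m n r) : Set (W r) :=
  {d | d ∈ doubleReps lam mu ∧
    conjBy lam.evenGroup d ⊓ mu.oddGroup = ⊥ ∧ conjBy lam.oddGroup d ⊓ mu.evenGroup = ⊥}

/-- The subgroup `W_{λd∩μ} = W_λ^d ∩ W_μ`. -/
def interGroup {m n r : ℕ} (lam : Comp m n r) (d : W r) (mu : Comp m n r) : Subgroup (W r) :=
  conjBy lam.group d ⊓ mu.group

/-- The composition `λd ∩ μ = (ν¹, …, ν^{m+n})`, where `νⁱ` is the composition of `μ_i` whose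
`j`-th part is the number of places in the `i`-th block of `μ` at which `i_λ d` has the entry `j`.
For `d ∈ 𝒟_{λμ}` its parabolic subgroup is `W_λ^d ∩ W_μ`. -/
def interComp {m n r : ℕ} (lam : Comp m n r) (d : W r) (mu : Comp m n r) : List ℕ :=
  (List.finRange (m + n)).flatMap fun i => (List.finRange (m + n)).map fun j =>
    (Finset.univ.filter fun k : Fin r => mu.word k = i ∧ lam.word (d k) = j).card

/-- The maximal `l`-parabolic subgroup `P_{λd∩μ}`. -/
def defectGroup {m n r : ℕ} (l : ℕ) (lam : Comp m n r) (d : W r) (mu : Comp m n r) :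
    Subgroup (W r) :=
  maxLParabolic l r (interComp lam d mu)

/-! ### The Hecke algebra -/

/-- The quadratic and braid relations between the generators `𝒯_s`. -/
inductive HeckeRel {R : Type*} [CommRing R] (q : Rˣ) (r : ℕ) :
    FreeAlgebra R (Simple r) → FreeAlgebra R (Simple r) → Prop
  | quad (k : Simple r) :
      HeckeRel q r (FreeAlgebra.ι R k * FreeAlgebra.ι R k)
        (((q : R) - (↑q⁻¹ : R)) • FreeAlgebra.ι R k + 1)
  | comm (j k : Simple r) (h : j.1 + 1 < k.1) :
      HeckeRel q r (FreeAlgebra.ι R j * FreeAlgebra.ι R k)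
        (FreeAlgebra.ι R k * FreeAlgebra.ι R j)
  | braid (j k : Simple r) (h : j.1 + 1 = k.1) :
      HeckeRel q r (FreeAlgebra.ι R j * FreeAlgebra.ι R k * FreeAlgebra.ι R j)
        (FreeAlgebra.ι R k * FreeAlgebra.ι R j * FreeAlgebra.ι R k)

/-- The Hecke algebra `ℋ_R` of `𝔖_r`, with the normalised generators, for which
`𝒯_s² = (q - q⁻¹) 𝒯_s + 1`. -/
abbrev Hecke {R : Type*} [CommRing R] (q : Rˣ) (r : ℕ) : Type _ := RingQuot (HeckeRel q r)

/-- The generator `𝒯_s` for `s = s_k`. -/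
noncomputable def heckeGen {R : Type*} [CommRing R] (q : Rˣ) (r : ℕ) (k : Simple r) :
    Hecke q r :=
  RingQuot.mkAlgHom R (HeckeRel q r) (FreeAlgebra.ι R k)

/-- The standard basis element `𝒯_w`: the product of the generators along a reduced expression of
`w` (by the braid relations it does not depend on the reduced expression). -/
noncomputable def heckeT {R : Type*} [CommRing R] (q : Rˣ) {r : ℕ} (w : W r) : Hecke q r :=
  ((reducedWord w).map (heckeGen q r)).prod

/-! ### The tensor superspace -/

/-- The tensor superspace `V_R(m|n)^{⊗ r}`, where `V_R(m|n)` is free with basis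
`v_1, …, v_{m+n}`. -/
abbrev TensorSpace (R : Type*) [CommRing R] (m n r : ℕ) : Type _ :=
  ⨂[R] _ : Fin r, (Fin (m + n) → R)

/-- The basis `v_i = v_{i_1} ⊗ ⋯ ⊗ v_{i_r}` of the tensor superspace. -/
noncomputable def tensorBasis (R : Type*) [CommRing R] (m n r : ℕ) :
    Module.Basis (Fin r → Fin (m + n)) R (TensorSpace R m n r) :=
  Basis.piTensorProduct fun _ => Pi.basisFun R (Fin (m + n))

/-- The sign `(-1)^{â b̂}`, where `v_a` is even for the first `m` indices `a` and odd for the last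
`n`. -/
def paritySign (R : Type*) [CommRing R] {m n : ℕ} (a b : Fin (m + n)) : R :=
  if m ≤ a.1 ∧ m ≤ b.1 then -1 else 1

/-- The factor by which `𝒯_s` acts on `v_a ⊗ v_a`: `q` for even `v_a`, `-q⁻¹` for odd `v_a`. -/
def diagFactor {R : Type*} [CommRing R] (q : Rˣ) {m n : ℕ} (a : Fin (m + n)) : R :=
  if a.1 < m then (q : R) else -(↑q⁻¹ : R)

/-- The vector `v_i 𝒯_{s_k}`. -/
noncomputable def genVec {R : Type*} [CommRing R] (q : Rˣ) {m n r : ℕ} (k : Simple r)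
    (i : Fin r → Fin (m + n)) : TensorSpace R m n r :=
  if i k.fst < i k.snd then
    paritySign R (i k.fst) (i k.snd) • tensorBasis R m n r (i ∘ simpleRefl k)
  else if i k.fst = i k.snd then
    diagFactor q (i k.fst) • tensorBasis R m n r i
  else
    paritySign R (i k.fst) (i k.snd) • tensorBasis R m n r (i ∘ simpleRefl k) +
      ((q : R) - (↑q⁻¹ : R)) • tensorBasis R m n r i

/-- The operator `v ↦ v 𝒯_{s_k}` on the tensor superspace. -/
noncomputable def genOp {R : Type*} [CommRing R] (q : Rˣ) (m n : ℕ) {r : ℕ} (k : Simple r) :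
    Module.End R (TensorSpace R m n r) :=
  (tensorBasis R m n r).constr R (genVec q k)

theorem genOp_basis {R : Type*} [CommRing R] (q : Rˣ) {m n r : ℕ} (k : Simple r)
    (i : Fin r → Fin (m + n)) : genOp q m n k (tensorBasis R m n r i) = genVec q k i :=
  (tensorBasis R m n r).constr_basis R (genVec q k) i

theorem simpleRefl_fst {r : ℕ} (k : Simple r) : simpleRefl k k.fst = k.snd :=
  Equiv.swap_apply_left _ _

theorem simpleRefl_snd {r : ℕ} (k : Simple r) : simpleRefl k k.snd = k.fst :=
  Equiv.swap_apply_right _ _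

theorem simpleRefl_of_ne {r : ℕ} (k : Simple r) (a : Fin r) (h1 : a ≠ k.fst) (h2 : a ≠ k.snd) :
    simpleRefl k a = a :=
  Equiv.swap_apply_of_ne_of_ne h1 h2

theorem comp_simpleRefl_twice {r : ℕ} {X : Type*} (k : Simple r) (i : Fin r → X) :
    (i ∘ simpleRefl k) ∘ simpleRefl k = i := by
  funext a
  simp [simpleRefl]

theorem paritySign_comm (R : Type*) [CommRing R] {m n : ℕ} (a b : Fin (m + n)) :
    paritySign R a b = paritySign R b a := by
  simp only [paritySign, and_comm]

theorem paritySign_sq (R : Type*) [CommRing R] {m n : ℕ} (a b : Fin (m + n)) :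
    paritySign R a b * paritySign R a b = 1 := by
  unfold paritySign; split_ifs <;> ring

theorem diagFactor_sq {R : Type*} [CommRing R] (q : Rˣ) {m n : ℕ} (a : Fin (m + n)) :
    diagFactor q a * diagFactor q a = ((q : R) - (↑q⁻¹ : R)) * diagFactor q a + 1 := by
  have := q.mul_inv
  unfold diagFactor
  split_ifs <;> linear_combination this

theorem genOp_quad {R : Type*} [CommRing R] (q : Rˣ) (m n : ℕ) {r : ℕ} (k : Simple r) :
    genOp q m n k * genOp q m n k = ((q : R) - (↑q⁻¹ : R)) • genOp q m n k + 1 := by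
  refine (tensorBasis R m n r).ext fun i => ?_
  have hs := paritySign_sq R (i k.fst) (i k.snd)
  have hc := paritySign_comm R (i k.snd) (i k.fst)
  have hd := diagFactor_sq q (i k.fst)
  rcases lt_trichotomy (i k.fst) (i k.snd) with h | h | h
  · simp only [Module.End.mul_apply, LinearMap.add_apply, LinearMap.smul_apply,
      Module.End.one_apply, genOp_basis, genVec, h, if_true, map_smul, Function.comp_apply,
      simpleRefl_fst, simpleRefl_snd, not_lt_of_gt h, h.ne', if_false, comp_simpleRefl_twice, hc]
    match_scalars
    · linear_combination hs
    · ring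
  · simp only [Module.End.mul_apply, LinearMap.add_apply, LinearMap.smul_apply,
      Module.End.one_apply, genOp_basis, genVec, h, lt_irrefl, if_true, if_false, map_smul]
    rw [h] at hd
    match_scalars
    linear_combination hd
  · simp only [Module.End.mul_apply, LinearMap.add_apply, LinearMap.smul_apply, map_add,
      Module.End.one_apply, genOp_basis, genVec, h, if_true, map_smul, Function.comp_apply,
      simpleRefl_fst, simpleRefl_snd, not_lt_of_gt h, h.ne', if_false, comp_simpleRefl_twice, hc]
    match_scalars
    · linear_combination hs
    · ring

theorem genOp_comm {R : Type*} [CommRing R] (q : Rˣ) (m n : ℕ) {r : ℕ} (j k : Simple r)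
    (h : j.1 + 1 < k.1) : genOp q m n j * genOp q m n k = genOp q m n k * genOp q m n j := by
  refine (tensorBasis R m n r).ext fun i => ?_
  have e1 : simpleRefl j k.fst = k.fst := simpleRefl_of_ne _ _
    (by simp only [Simple.fst, ne_eq, Fin.mk.injEq]; omega)
    (by simp only [Simple.fst, Simple.snd, ne_eq, Fin.mk.injEq]; omega)
  have e2 : simpleRefl j k.snd = k.snd := simpleRefl_of_ne _ _
    (by simp only [Simple.fst, Simple.snd, ne_eq, Fin.mk.injEq]; omega)
    (by simp only [Simple.snd, ne_eq, Fin.mk.injEq]; omega)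
  have e3 : simpleRefl k j.fst = j.fst := simpleRefl_of_ne _ _
    (by simp only [Simple.fst, ne_eq, Fin.mk.injEq]; omega)
    (by simp only [Simple.fst, Simple.snd, ne_eq, Fin.mk.injEq]; omega)
  have e4 : simpleRefl k j.snd = j.snd := simpleRefl_of_ne _ _
    (by simp only [Simple.fst, Simple.snd, ne_eq, Fin.mk.injEq]; omega)
    (by simp only [Simple.snd, ne_eq, Fin.mk.injEq]; omega)
  have e5 : (i ∘ simpleRefl k) ∘ simpleRefl j = (i ∘ simpleRefl j) ∘ simpleRefl k := by
    funext a
    simp only [Function.comp_apply]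
    congr 1
    by_cases h1 : a = j.fst
    · rw [h1, simpleRefl_fst, e3, simpleRefl_fst, e4]
    by_cases h2 : a = j.snd
    · rw [h2, simpleRefl_snd, e4, simpleRefl_snd, e3]
    by_cases h3 : a = k.fst
    · rw [h3, simpleRefl_fst, e1, simpleRefl_fst, e2]
    by_cases h4 : a = k.snd
    · rw [h4, simpleRefl_snd, e2, simpleRefl_snd, e1]
    rw [simpleRefl_of_ne j a h1 h2, simpleRefl_of_ne k a h3 h4, simpleRefl_of_ne j a h1 h2]
  simp only [Module.End.mul_apply, genOp_basis, genVec]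
  split_ifs <;>
  simp_all only [map_smul, map_add, genOp_basis, genVec, Function.comp_apply, if_true, if_false,
    lt_irrefl] <;>
  module

/-- The braid relation, checked on three neighbouring letters. -/
theorem braid_aux {R V : Type*} [CommRing R] [AddCommGroup V] [Module R V] (q : Rˣ) {m n : ℕ}
    (F : Fin (m + n) → Fin (m + n) → Fin (m + n) → V) (S T : Module.End R V)
    (hS : ∀ a b c, S (F a b c) =
      if a < b then paritySign R a b • F b a c else if a = b then diagFactor q a • F a b c
      else paritySign R a b • F b a c + ((q : R) - (↑q⁻¹ : R)) • F a b c)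
    (hT : ∀ a b c, T (F a b c) =
      if b < c then paritySign R b c • F a c b else if b = c then diagFactor q b • F a b c
      else paritySign R b c • F a c b + ((q : R) - (↑q⁻¹ : R)) • F a b c)
    (a b c : Fin (m + n)) : S (T (S (F a b c))) = T (S (T (F a b c))) := by
  have hab := paritySign_comm R b a
  have hac := paritySign_comm R c a
  have hbc := paritySign_comm R c b
  have sab := paritySign_sq R a b
  have sac := paritySign_sq R a c
  have sbc := paritySign_sq R b c
  have da := diagFactor_sq q a
  have db := diagFactor_sq q b
  have dc := diagFactor_sq q c
  generalize hp : (q : R) - (↑q⁻¹ : R) = p at *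
  rcases lt_trichotomy a b with h1 | h1 | h1 <;>
  rcases lt_trichotomy b c with h2 | h2 | h2 <;>
  rcases lt_trichotomy a c with h3 | h3 | h3 <;>
  first
  | (exfalso; omega)
  | (subst_vars
     simp_all only [if_true, if_false, map_smul, map_add, lt_irrefl, not_lt_of_gt, ne_of_gt] <;>
     (clear hS hT; match_scalars <;> grind))

theorem genOp_braid {R : Type*} [CommRing R] (q : Rˣ) (m n : ℕ) {r : ℕ} (j k : Simple r)
    (h : j.1 + 1 = k.1) :
    genOp q m n j * genOp q m n k * genOp q m n j =
      genOp q m n k * genOp q m n j * genOp q m n k := by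
  refine (tensorBasis R m n r).ext fun i => ?_
  have hjk : k.fst = j.snd := by simp only [Simple.fst, Simple.snd, Fin.mk.injEq]; omega
  have h1 : j.snd ≠ j.fst := by
    simp only [Simple.fst, Simple.snd, ne_eq, Fin.mk.injEq]; omega
  have h2 : k.snd ≠ j.fst := by
    simp only [Simple.fst, Simple.snd, ne_eq, Fin.mk.injEq]; omega
  have h3 : k.snd ≠ j.snd := by simp only [Simple.snd, ne_eq, Fin.mk.injEq]; omega
  let f : Fin (m + n) → Fin (m + n) → Fin (m + n) → Fin r → Fin (m + n) :=
    fun a b c x => if x = j.fst then a else if x = j.snd then b else if x = k.snd then c else i x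
  have hf1 : ∀ a b c, f a b c j.fst = a := fun a b c => by simp [f]
  have hf2 : ∀ a b c, f a b c j.snd = b := fun a b c => by simp [f, h1]
  have hf3 : ∀ a b c, f a b c k.snd = c := fun a b c => by simp [f, h2, h3]
  have hf4 : ∀ a b c, f a b c ∘ simpleRefl j = f b a c := fun a b c => by
    funext x
    simp only [Function.comp_apply]
    by_cases e1 : x = j.fst
    · rw [e1, simpleRefl_fst, hf2, hf1]
    by_cases e2 : x = j.snd
    · rw [e2, simpleRefl_snd, hf2, hf1]
    rw [simpleRefl_of_ne j x e1 e2]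
    simp only [f, e1, e2, if_false]
  have hf5 : ∀ a b c, f a b c ∘ simpleRefl k = f a c b := fun a b c => by
    funext x
    simp only [Function.comp_apply]
    by_cases e1 : x = j.snd
    · rw [e1, ← hjk, simpleRefl_fst, hf3, hjk, hf2]
    by_cases e2 : x = k.snd
    · rw [e2, simpleRefl_snd, hf3, hjk, hf2]
    rw [simpleRefl_of_ne k x (hjk ▸ e1) e2]
    simp only [f, e1, e2, if_false]
  have hi : i = f (i j.fst) (i j.snd) (i k.snd) := by
    funext x
    simp only [f]
    split_ifs with e1 e2 e3
    · rw [e1]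
    · rw [e2]
    · rw [e3]
    · rfl
  rw [hi]
  refine braid_aux q (fun a b c => tensorBasis R m n r (f a b c)) (genOp q m n j) (genOp q m n k)
    (fun a b c => ?_) (fun a b c => ?_) _ _ _
  · simp only [genOp_basis, genVec, hf1, hf2, hf4]
  · simp only [genOp_basis, genVec, hjk, hf2, hf3, hf5]

/-- The right action of the Hecke algebra on the tensor superspace, as a representation by
operators that multiply in the opposite order. -/
noncomputable def heckeRep {R : Type*} [CommRing R] (q : Rˣ) (m n r : ℕ) :
    Hecke q r →ₐ[R] (Module.End R (TensorSpace R m n r))ᵐᵒᵖ :=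
  RingQuot.liftAlgHom R ⟨FreeAlgebra.lift R fun k => MulOpposite.op (genOp q m n k), by
    intro x y hxy
    induction hxy with
    | quad k =>
      simp only [map_mul, map_add, map_smul, map_one, FreeAlgebra.lift_ι_apply]
      exact congrArg MulOpposite.op (genOp_quad q m n k)
    | comm j k h =>
      simp only [map_mul, FreeAlgebra.lift_ι_apply]
      exact congrArg MulOpposite.op (genOp_comm q m n j k h).symm
    | braid j k h =>
      simp only [map_mul, FreeAlgebra.lift_ι_apply]
      have hb := genOp_braid q m n j k h
      rw [mul_assoc, mul_assoc] at hb
      exact congrArg MulOpposite.op hb⟩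

/-- The operator `v ↦ v h` on the tensor superspace, for `h` in the Hecke algebra. -/
noncomputable def rightMul {R : Type*} [CommRing R] (q : Rˣ) (m n : ℕ) {r : ℕ} (h : Hecke q r) :
    Module.End R (TensorSpace R m n r) :=
  (heckeRep q m n r h).unop

/-! ### The `q`-Schur superalgebra and the relative norms -/

/-- The `q`-Schur superalgebra `𝒮_R(m|n, r) = End_{ℋ_R}(V_R(m|n)^{⊗ r})`, as an algebra: the
`R`-linear endomorphisms `f` with `(v h) f = ((v) f) h`. -/
noncomputable def schurAlgebra {R : Type*} [CommRing R] (q : Rˣ) (m n r : ℕ) :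
    Subalgebra R (Module.End R (TensorSpace R m n r)) :=
  Subalgebra.centralizer R (Set.range fun h : Hecke q r => rightMul q m n h)

/-- The matrix unit `e_{i,j}`, which sends `v_i` to `v_j` and every other basis vector to `0`. -/
noncomputable def matUnit (R : Type*) [CommRing R] {m n r : ℕ} (i j : Fin r → Fin (m + n)) :
    Module.End R (TensorSpace R m n r) :=
  (tensorBasis R m n r).constr R fun i' => if i' = i then tensorBasis R m n r j else 0

/-- The relative norm `N_{W,G}(b) = ∑_{w ∈ 𝒟_G} 𝒯_{w⁻¹} b 𝒯_w` of an `R`-linear endomorphism `b`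
of the tensor superspace, where `(v)(x b y) = ((v x) b) y` for `x, y` in the Hecke algebra. -/
noncomputable def relNorm {R : Type*} [CommRing R] (q : Rˣ) {m n r : ℕ} (G : Subgroup (W r))
    (b : Module.End R (TensorSpace R m n r)) : Module.End R (TensorSpace R m n r) :=
  ∑ w ∈ (cosetReps G).toFinite.toFinset,
    rightMul q m n (heckeT q w) ∘ₗ b ∘ₗ rightMul q m n (heckeT q w⁻¹)

/-- The element `N^d_{μλ} = N_{W, W_λ^d ∩ W_μ}(e_{μ,λd})`, where `e_{μ,λd}` sends `v_μ` to
`v_{i_λ d}`. -/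
noncomputable def normElt {R : Type*} [CommRing R] (q : Rˣ) {m n r : ℕ} (mu lam : Comp m n r)
    (d : W r) : Module.End R (TensorSpace R m n r) :=
  relNorm q (interGroup lam d mu) (matUnit R mu.word (lam.word ∘ d))

/-- The span `I_R(P, r)` of the basis elements `N^d_{μλ}` with `P_{λd∩μ} ≤_W P`. -/
noncomputable def idealSpan {R : Type*} [CommRing R] (q : Rˣ) (l m n : ℕ) {r : ℕ}
    (P : Subgroup (W r)) : Submodule R (Module.End R (TensorSpace R m n r)) :=
  Submodule.span R {f | ∃ (lam mu : Comp m n r) (d : W r), d ∈ superReps lam mu ∧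
    LeW (defectGroup l lam d mu) P ∧ f = normElt q mu lam d}

/-- `I` is a two-sided ideal of the `q`-Schur superalgebra `𝒮_R(m|n, r)`. -/
def IsSchurIdeal {R : Type*} [CommRing R] (q : Rˣ) {m n r : ℕ}
    (I : Submodule R (Module.End R (TensorSpace R m n r))) : Prop :=
  I ≤ Subalgebra.toSubmodule (schurAlgebra q m n r) ∧
    ∀ f ∈ schurAlgebra q m n r, ∀ g ∈ I, f ∘ₗ g ∈ I ∧ g ∘ₗ f ∈ I

/-- The `l`-parabolic subgroup `P_k` associated with the composition `(1^{t+(s-k)l}, l^k)`, where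
`r = s l + t` with `0 ≤ t < l` and `0 ≤ k ≤ s`. -/
def chainGroup (l r k : ℕ) : Subgroup (W r) :=
  young r (List.replicate (r % l + (r / l - k) * l) 1 ++ List.replicate k l)

end QSchurSuper

namespace QSchurSuper

/-! ### Inversions and the length function -/

/-! The relative norms are normalised full traces. For every linear `b` the sum of `𝒯_{w⁻¹} b 𝒯_w`
over all of `W` commutes with the Hecke algebra, and multiplying it by an element of the Schur
algebra gives again a full trace (`fullTrace_mem_schurAlgebra`, `mul_fullTrace`, `fullTrace_mul`).
On `b = e_{μ,λd}` the group `W_λ^d ∩ W_μ` contributes only scalars, so the full trace is `π_d N^d`,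
where `π_d` is a Poincaré polynomial (`fullTrace_matUnit`). Conversely, `π_y` divides the
coefficient of every full trace at `(i_μ, i_ρ y)` (`poincare_dvd_coef_fullTrace`). For an element of
the span of the norms this coefficient is the coefficient `a_y` of `N^y_{μρ}`
(`coef_normElt_doubleReps`). Hence `π_y` divides both `π_d a_y` and `π_{d'} a_y`.

At a root of unity the `π`'s may vanish, so products are computed over `ℤ[T, T⁻¹]` and specialised
afterwards. Let `z` be a complex primitive `l`-th root of unity. For `d` in `𝒟°`, `π_d` is a product
of factorials in `T²` and `T⁻²`, and `z²` is again primitive because `l` is odd. So `π_d = [l]^e u`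
with `u(z) ≠ 0`, where `[l]` is formed in `T²` and `e` is `defectRank` (`exists_poincare_eq`). For
`l ≠ 1` also `[l](z) = 0`, so `a_y(z) ≠ 0` forces the exponent of `y` to be at most those of `d` and
`d'` (`defectRank_le`). A Laurent polynomial vanishing at `z` is, up to a power of `T`, a multiple
of the `l`-th cyclotomic polynomial and so vanishes at `q`; thus `a_y(q) ≠ 0` implies `a_y(z) ≠ 0`
(`eval₂_eq_zero_of_isPrimitiveRoot`). Finally, for compositions with parts `1` and `l` it suffices
for `≤_W` to compare the numbers of parts `l` (`leW_of_count_le`); for `l = 1` all defect groups are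
trivial.

That the norms span the Schur algebra follows from `eq_zero_of_coef_eq_zero`: an endomorphism is
determined by its coefficients at the pairs `(i_μ, i_λ d)` with `d` in `𝒟°`. For the other
distinguished `d` commutation with a generator gives `(q + q⁻¹) c = 0` for the coefficient `c`, and
`q + q⁻¹ ≠ 0` because `l` is odd and the characteristic is not `2`. The ideal property and the
filtration are then formal. -/

theorem inv_apply_self {r : ℕ} (w : W r) (a : Fin r) : w⁻¹ (w a) = a := w.symm_apply_apply a

theorem apply_inv_self {r : ℕ} (w : W r) (a : Fin r) : w (w⁻¹ a) = a := w.apply_symm_apply a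

theorem simpleRefl_val {r : ℕ} (k : Simple r) (a : Fin r) :
    (simpleRefl k a : ℕ) = if a.1 = k.1 then k.1 + 1 else if a.1 = k.1 + 1 then k.1 else a.1 := by
  split_ifs with h1 h2
  · rw [show a = k.fst from Fin.ext h1, simpleRefl_fst]; rfl
  · rw [show a = k.snd from Fin.ext h2, simpleRefl_snd]; rfl
  · rw [simpleRefl_of_ne k a (fun h => h1 (congrArg Fin.val h)) fun h => h2 (congrArg Fin.val h)]

theorem simpleRefl_mul_comm {r : ℕ} (j k : Simple r) (h : j.1 + 1 < k.1) :
    simpleRefl j * simpleRefl k = simpleRefl k * simpleRefl j := by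
  ext x
  simp only [Equiv.Perm.mul_apply, simpleRefl_val]
  split_ifs <;> omega

theorem simpleRefl_mul_self {r : ℕ} (k : Simple r) : simpleRefl k * simpleRefl k = 1 :=
  Equiv.swap_mul_self _ _

theorem simpleRefl_inv {r : ℕ} (k : Simple r) : (simpleRefl k)⁻¹ = simpleRefl k :=
  Equiv.swap_inv _ _

theorem simpleRefl_braid {r : ℕ} (j k : Simple r) (h : j.1 + 1 = k.1) :
    simpleRefl j * simpleRefl k * simpleRefl j =
      simpleRefl k * simpleRefl j * simpleRefl k := by
  have hkj : k.fst = j.snd := by simp only [Simple.fst, Simple.snd, Fin.mk.injEq]; omega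
  have e1 : simpleRefl j k.snd = k.snd := simpleRefl_of_ne _ _
    (by simp only [Simple.fst, Simple.snd, ne_eq, Fin.mk.injEq]; omega)
    (by simp only [Simple.snd, ne_eq, Fin.mk.injEq]; omega)
  have e2 : simpleRefl k j.fst = j.fst := simpleRefl_of_ne _ _
    (by simp only [Simple.fst, ne_eq, Fin.mk.injEq]; omega)
    (by simp only [Simple.fst, Simple.snd, ne_eq, Fin.mk.injEq]; omega)
  have h1 := Equiv.swap_apply_apply (simpleRefl j) k.fst k.snd
  have h2 := Equiv.swap_apply_apply (simpleRefl k) j.fst j.snd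
  rw [e1, hkj, simpleRefl_snd, ← hkj, simpleRefl_inv] at h1
  rw [e2, ← hkj, simpleRefl_fst, simpleRefl_inv, hkj] at h2
  exact h1.symm.trans h2

theorem Simple.fst_lt_snd {r : ℕ} (k : Simple r) : k.fst < k.snd := Nat.lt_succ_self k.1

theorem simpleRefl_lt_iff {r : ℕ} (k : Simple r) (a b : Fin r)
    (h : ¬(a = k.fst ∧ b = k.snd)) (h' : ¬(a = k.snd ∧ b = k.fst)) :
    simpleRefl k a < simpleRefl k b ↔ a < b := by
  simp only [Fin.ext_iff, Simple.fst, Simple.snd, Fin.lt_def, simpleRefl_val] at *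
  split_ifs <;> omega

theorem apply_fst_lt_or {r : ℕ} (w : W r) (k : Simple r) :
    w k.fst < w k.snd ∨ w k.snd < w k.fst :=
  lt_or_gt_of_ne fun h => k.fst_lt_snd.ne (w.injective h)

/-- The pairs of letters `a < b` which occur in the wrong order in the word
`w(0), w(1), …, w(r - 1)`. -/
def invSet {r : ℕ} (w : W r) : Finset (Fin r × Fin r) :=
  Finset.univ.filter fun p => p.1 < p.2 ∧ w⁻¹ p.2 < w⁻¹ p.1

theorem mem_invSet {r : ℕ} {w : W r} {p : Fin r × Fin r} :
    p ∈ invSet w ↔ p.1 < p.2 ∧ w⁻¹ p.2 < w⁻¹ p.1 := by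
  simp [invSet]

theorem apply_notMem_invSet {r : ℕ} {w : W r} {k : Simple r} :
    (w k.fst, w k.snd) ∉ invSet w := by
  simp only [mem_invSet, inv_apply_self, not_and, not_lt]
  exact fun _ => k.fst_lt_snd.le

/-- Right multiplication by `s_k` exchanges two neighbouring entries of the word `w(0), w(1), …`, so
only the relative order of these two letters changes. -/
theorem invSet_mul_simpleRefl {r : ℕ} {w : W r} {k : Simple r} (h : w k.fst < w k.snd) :
    invSet (w * simpleRefl k) = insert (w k.fst, w k.snd) (invSet w) := by
  ext ⟨a, b⟩
  obtain ⟨x, rfl⟩ := w.surjective a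
  obtain ⟨y, rfl⟩ := w.surjective b
  simp only [mem_invSet, Finset.mem_insert, mul_inv_rev, simpleRefl_inv, Equiv.Perm.mul_apply,
    inv_apply_self, Prod.mk.injEq, EmbeddingLike.apply_eq_iff_eq]
  by_cases h1 : y = k.fst ∧ x = k.snd
  · obtain ⟨rfl, rfl⟩ := h1
    simp only [h.not_gt, false_and, or_false, false_iff]
    exact fun hh => k.fst_lt_snd.ne' hh.1
  by_cases h2 : y = k.snd ∧ x = k.fst
  · obtain ⟨rfl, rfl⟩ := h2
    simp [simpleRefl_fst, simpleRefl_snd, k.fst_lt_snd, h]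
  · rw [simpleRefl_lt_iff k y x h1 h2]
    have : ¬(x = k.fst ∧ y = k.snd) := fun hh => h2 ⟨hh.2, hh.1⟩
    simp [this]

theorem mul_simpleRefl_simpleRefl {r : ℕ} (w : W r) (k : Simple r) :
    w * simpleRefl k * simpleRefl k = w := by
  rw [mul_assoc, simpleRefl_mul_self, mul_one]

theorem mul_simpleRefl_fst {r : ℕ} (w : W r) (k : Simple r) :
    (w * simpleRefl k) k.fst = w k.snd := by
  rw [Equiv.Perm.mul_apply, simpleRefl_fst]

theorem mul_simpleRefl_snd {r : ℕ} (w : W r) (k : Simple r) :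
    (w * simpleRefl k) k.snd = w k.fst := by
  rw [Equiv.Perm.mul_apply, simpleRefl_snd]

theorem card_invSet_mul_of_lt {r : ℕ} {w : W r} {k : Simple r} (h : w k.fst < w k.snd) :
    (invSet (w * simpleRefl k)).card = (invSet w).card + 1 := by
  rw [invSet_mul_simpleRefl h, Finset.card_insert_of_notMem apply_notMem_invSet]

theorem card_invSet_mul_of_gt {r : ℕ} {w : W r} {k : Simple r} (h : w k.snd < w k.fst) :
    (invSet (w * simpleRefl k)).card + 1 = (invSet w).card := by
  have := card_invSet_mul_of_lt (w := w * simpleRefl k) (k := k)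
    (by rwa [mul_simpleRefl_fst, mul_simpleRefl_snd])
  rw [mul_simpleRefl_simpleRefl] at this
  exact this.symm

theorem wordProd_append {r : ℕ} (L M : List (Simple r)) :
    wordProd (L ++ M) = wordProd L * wordProd M := by
  simp [wordProd]

theorem wordProd_singleton {r : ℕ} (k : Simple r) : wordProd [k] = simpleRefl k := by
  simp [wordProd]

/-- A function that increases between neighbouring places in a fibre of a monotone function
increases on the whole fibre. -/
theorem lt_of_adjacent {r : ℕ} {ι β : Type*} [PartialOrder ι] [Preorder β] {c : Fin r → ι}
    (hc : Monotone c) {p : Fin r → β}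
    (h : ∀ k : Simple r, c k.fst = c k.snd → p k.fst < p k.snd) {a b : Fin r} (hab : a < b)
    (he : c a = c b) : p a < p b := by
  obtain ⟨a, ha⟩ := a
  obtain ⟨b, hb⟩ := b
  rw [Fin.mk_lt_mk] at hab
  induction b, hab using Nat.le_induction with
  | base => exact h ⟨a, hb⟩ he
  | succ b hab ih =>
    have hb' : b < r := by omega
    -- Monotonicity squeezes the value of `c` at the intermediate place, which therefore lies in the
    -- same fibre.
    have h1 : c ⟨a, ha⟩ ≤ c ⟨b, hb'⟩ := hc (by rw [Fin.mk_le_mk]; omega)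
    have h2 : c ⟨b, hb'⟩ ≤ c ⟨b + 1, hb⟩ := hc (by rw [Fin.mk_le_mk]; omega)
    have h3 : c ⟨a, ha⟩ = c ⟨b, hb'⟩ := le_antisymm h1 (he ▸ h2)
    exact (ih hb' h3).trans (h ⟨b, hb⟩ (h3 ▸ he))

theorem eq_one_of_forall_lt {r : ℕ} {w : W r} (h : ∀ k : Simple r, w k.fst < w k.snd) : w = 1 := by
  have : StrictMono w := fun a b hab =>
    lt_of_adjacent (c := fun _ : Fin r => ()) (fun _ _ _ => le_rfl) (fun k _ => h k) hab rfl
  exact (Equiv.Perm.monotone_iff w).1 this.monotone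

theorem invSet_one {r : ℕ} : invSet (1 : W r) = ∅ := by
  ext p
  simp only [mem_invSet, inv_one, Equiv.Perm.one_apply, Finset.notMem_empty, iff_false, not_and,
    not_lt]
  exact fun h => h.le

theorem card_invSet_wordProd_le {r : ℕ} (L : List (Simple r)) :
    (invSet (wordProd L)).card ≤ L.length := by
  induction L using List.reverseRecOn with
  | nil => simp [wordProd, invSet_one]
  | append_singleton L k ih =>
    rw [wordProd_append, wordProd_singleton, List.length_append, List.length_singleton]
    rcases apply_fst_lt_or (wordProd L) k with h | h
    · rw [card_invSet_mul_of_lt h]; omega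
    · have := card_invSet_mul_of_gt h; omega

/-- Bubble sort: a permutation other than `1` has a descent, and undoing it removes exactly one
inversion. -/
theorem exists_word_length_eq {r : ℕ} (n : ℕ) (w : W r) (h : (invSet w).card = n) :
    ∃ L : List (Simple r), wordProd L = w ∧ L.length = n := by
  induction n generalizing w with
  | zero =>
    refine ⟨[], ?_, rfl⟩
    rw [eq_one_of_forall_lt (w := w)]
    · rfl
    · intro k
      refine (apply_fst_lt_or w k).resolve_right fun hk => ?_
      have := card_invSet_mul_of_gt hk
      omega
  | succ n ih =>
    by_cases hw : ∀ k : Simple r, w k.fst < w k.snd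
    · rw [eq_one_of_forall_lt hw, invSet_one] at h
      simp at h
    · push Not at hw
      obtain ⟨k, hk⟩ := hw
      have hk := (apply_fst_lt_or w k).resolve_left hk.not_gt
      have h1 := card_invSet_mul_of_gt hk
      obtain ⟨L, hL, hn⟩ := ih (w * simpleRefl k) (by omega)
      refine ⟨L ++ [k], ?_, by simp [hn]⟩
      rw [wordProd_append, hL, wordProd_singleton, mul_simpleRefl_simpleRefl]

theorem length_eq_card_invSet {r : ℕ} (w : W r) : length w = (invSet w).card := by
  refine le_antisymm (Nat.sInf_le (exists_word_length_eq _ w rfl)) ?_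
  obtain ⟨L, hL, hn⟩ := exists_reducedWord w
  rw [← hn]
  subst hL
  exact card_invSet_wordProd_le L

theorem length_mul_of_lt {r : ℕ} {w : W r} {k : Simple r} (h : w k.fst < w k.snd) :
    length (w * simpleRefl k) = length w + 1 := by
  simp only [length_eq_card_invSet, card_invSet_mul_of_lt h]

theorem length_mul_of_gt {r : ℕ} {w : W r} {k : Simple r} (h : w k.snd < w k.fst) :
    length (w * simpleRefl k) + 1 = length w := by
  simp only [length_eq_card_invSet, card_invSet_mul_of_gt h]

theorem length_wordProd_le {r : ℕ} (L : List (Simple r)) : length (wordProd L) ≤ L.length :=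
  Nat.sInf_le ⟨L, rfl, rfl⟩

theorem length_inv {r : ℕ} (w : W r) : length w⁻¹ = length w := by
  rw [length_eq_card_invSet, length_eq_card_invSet]
  refine Finset.card_bij' (fun p _ => (w p.2, w p.1)) (fun p _ => (w⁻¹ p.2, w⁻¹ p.1)) ?_ ?_ ?_ ?_
  all_goals
    simp only [mem_invSet, inv_inv, inv_apply_self, apply_inv_self]
    tauto

theorem length_one {r : ℕ} : length (1 : W r) = 0 := by
  rw [length_eq_card_invSet, invSet_one, Finset.card_empty]

theorem eq_one_of_length_eq_zero {r : ℕ} {w : W r} (h : length w = 0) : w = 1 := by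
  refine eq_one_of_forall_lt fun k => (apply_fst_lt_or w k).resolve_right fun hk => ?_
  have := length_mul_of_gt hk
  omega

/-! ### Products along reduced words -/

theorem lt_of_reduced_append {r : ℕ} {L : List (Simple r)} {k : Simple r} {w : W r}
    (hw : wordProd (L ++ [k]) = w) (hl : (L ++ [k]).length = length w) :
    w k.snd < w k.fst ∧ wordProd L = w * simpleRefl k ∧ L.length = length (wordProd L) := by
  have h1 : wordProd L = w * simpleRefl k := by
    rw [← hw, wordProd_append, wordProd_singleton, mul_simpleRefl_simpleRefl]
  have h2 := length_wordProd_le L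
  rw [List.length_append, List.length_singleton] at hl
  rw [h1] at h2 ⊢
  rcases apply_fst_lt_or w k with h | h
  · rw [length_mul_of_lt h] at h2; omega
  · have := length_mul_of_gt h
    exact ⟨h, rfl, by omega⟩

section Matsumoto

variable {r : ℕ} {M : Type*} [Monoid M] {g : Simple r → M}

/-- If `s_j` and `s_k` can both end a reduced word of `w`, then so can the longest element of the
group they generate. By induction the two given words may be replaced by words with a common
beginning `N` and the two reduced words of that longest element as endings; these endings are linked
by one braid relation. -/
theorem prod_eq_of_reduced_aux
    (hcomm : ∀ j k : Simple r, j.1 + 1 < k.1 → g j * g k = g k * g j)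
    (hbraid : ∀ j k : Simple r, j.1 + 1 = k.1 → g j * g k * g j = g k * g j * g k)
    {n : ℕ}
    (ih : ∀ (w : W r) (L L' : List (Simple r)), length w = n → wordProd L = w → wordProd L' = w →
      L.length = length w → L'.length = length w → (L.map g).prod = (L'.map g).prod)
    {w : W r} (hw : length w = n + 1) {L L' : List (Simple r)} {j k : Simple r}
    (hL : wordProd L = w * simpleRefl j) (hL' : wordProd L' = w * simpleRefl k)
    (hl : L.length = n) (hl' : L'.length = n)
    (hj : w j.snd < w j.fst) (hk : w k.snd < w k.fst) (hjk : j.1 < k.1) :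
    (L.map g).prod * g j = (L'.map g).prod * g k := by
  have l1 := length_mul_of_gt hj
  have l2 := length_mul_of_gt hk
  rcases Nat.lt_or_ge (j.1 + 1) k.1 with h | h
  · have e1 : simpleRefl j k.fst = k.fst := simpleRefl_of_ne _ _
      (by simp only [Simple.fst, ne_eq, Fin.mk.injEq]; omega)
      (by simp only [Simple.fst, Simple.snd, ne_eq, Fin.mk.injEq]; omega)
    have e2 : simpleRefl j k.snd = k.snd := simpleRefl_of_ne _ _
      (by simp only [Simple.fst, Simple.snd, ne_eq, Fin.mk.injEq]; omega)
      (by simp only [Simple.snd, ne_eq, Fin.mk.injEq]; omega)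
    have l3 := length_mul_of_gt (w := w * simpleRefl j) (k := k)
      (by rwa [Equiv.Perm.mul_apply, Equiv.Perm.mul_apply, e1, e2])
    obtain ⟨N, hN, hNl⟩ := exists_reducedWord (w * simpleRefl j * simpleRefl k)
    have e3 := simpleRefl_mul_comm j k h
    have i1 := ih (w * simpleRefl j) L (N ++ [k]) (by omega) hL
      (by rw [wordProd_append, hN, wordProd_singleton, mul_simpleRefl_simpleRefl])
      (by omega) (by simp only [List.length_append, List.length_singleton]; omega)
    have i2 := ih (w * simpleRefl k) L' (N ++ [j]) (by omega) hL'
      (by rw [wordProd_append, hN, wordProd_singleton, mul_assoc w, e3, ← mul_assoc,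
        mul_simpleRefl_simpleRefl])
      (by omega) (by simp only [List.length_append, List.length_singleton]; omega)
    rw [i1, i2]
    simp only [List.map_append, List.map_cons, List.map_nil, List.prod_append, List.prod_cons,
      List.prod_nil, mul_one, mul_assoc, hcomm j k h]
  · have h : j.1 + 1 = k.1 := by omega
    have hkj : k.fst = j.snd := by simp only [Simple.fst, Simple.snd, Fin.mk.injEq]; omega
    have e1 : simpleRefl j k.snd = k.snd := simpleRefl_of_ne _ _
      (by simp only [Simple.fst, Simple.snd, ne_eq, Fin.mk.injEq]; omega)
      (by simp only [Simple.snd, ne_eq, Fin.mk.injEq]; omega)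
    have e2 : simpleRefl k j.fst = j.fst := simpleRefl_of_ne _ _
      (by simp only [Simple.fst, ne_eq, Fin.mk.injEq]; omega)
      (by simp only [Simple.fst, Simple.snd, ne_eq, Fin.mk.injEq]; omega)
    have e3 : simpleRefl k j.snd = k.snd := by rw [← hkj, simpleRefl_fst]
    have l3 := length_mul_of_gt (w := w * simpleRefl j) (k := k) (by
      rw [Equiv.Perm.mul_apply, Equiv.Perm.mul_apply, e1, hkj, simpleRefl_snd]
      exact (hkj ▸ hk).trans hj)
    have l4 := length_mul_of_gt (w := w * simpleRefl j * simpleRefl k) (k := j) (by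
      simp only [Equiv.Perm.mul_apply]
      rw [e2, e3, simpleRefl_fst, e1]
      exact hkj ▸ hk)
    obtain ⟨N, hN, hNl⟩ := exists_reducedWord (w * simpleRefl j * simpleRefl k * simpleRefl j)
    have e4 := simpleRefl_braid j k h
    have i1 := ih (w * simpleRefl j) L (N ++ [j] ++ [k]) (by omega) hL
      (by simp only [wordProd_append, hN, wordProd_singleton, mul_simpleRefl_simpleRefl])
      (by omega) (by simp only [List.length_append, List.length_singleton]; omega)
    have i2 := ih (w * simpleRefl k) L' (N ++ [k] ++ [j]) (by omega) hL'
      (by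
        rw [mul_assoc w, mul_assoc w, e4] at hN
        simp only [wordProd_append, hN, wordProd_singleton, ← mul_assoc,
          mul_simpleRefl_simpleRefl])
      (by omega) (by simp only [List.length_append, List.length_singleton]; omega)
    rw [i1, i2]
    simp only [List.map_append, List.map_cons, List.map_nil, List.prod_append, List.prod_cons,
      List.prod_nil, mul_one]
    rw [mul_assoc, mul_assoc, ← mul_assoc (g j), hbraid j k h]
    simp only [mul_assoc]

/-- Matsumoto's theorem for the symmetric group: if the `g k` satisfy the braid relations, then
the product of the `g k` along a reduced word depends only on the permutation. -/
theorem prod_eq_of_reduced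
    (hcomm : ∀ j k : Simple r, j.1 + 1 < k.1 → g j * g k = g k * g j)
    (hbraid : ∀ j k : Simple r, j.1 + 1 = k.1 → g j * g k * g j = g k * g j * g k) (n : ℕ) :
    ∀ (w : W r) (L L' : List (Simple r)), length w = n → wordProd L = w → wordProd L' = w →
      L.length = length w → L'.length = length w → (L.map g).prod = (L'.map g).prod := by
  induction n with
  | zero =>
    intro w L L' hw _ _ hl hl'
    rw [hw, List.length_eq_zero_iff] at hl hl'
    rw [hl, hl']
  | succ n ih =>
    intro w L L' hw hL hL' hl hl'
    rcases L.eq_nil_or_concat with rfl | ⟨L, j, rfl⟩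
    · simp [hw] at hl
    rcases L'.eq_nil_or_concat with rfl | ⟨L', k, rfl⟩
    · simp [hw] at hl'
    simp only [List.concat_eq_append] at *
    obtain ⟨h1, h2, h3⟩ := lt_of_reduced_append hL hl
    obtain ⟨h1', h2', h3'⟩ := lt_of_reduced_append hL' hl'
    simp only [List.length_append, List.length_singleton] at hl hl'
    simp only [List.map_append, List.map_cons, List.map_nil, List.prod_append, List.prod_cons,
      List.prod_nil, mul_one]
    rcases lt_trichotomy j.1 k.1 with h | h | h
    · exact prod_eq_of_reduced_aux hcomm hbraid ih hw h2 h2' (by omega) (by omega) h1 h1' h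
    · have h := Subtype.ext h
      subst h
      rw [ih _ L L' (by omega) rfl (by rw [h2', h2]) h3 (by rw [h2, ← h2', h3'])]
    · exact (prod_eq_of_reduced_aux hcomm hbraid ih hw h2' h2 (by omega) (by omega) h1' h1 h).symm

end Matsumoto

section Hecke

variable {R : Type*} [CommRing R] (q : Rˣ) {r : ℕ}

theorem heckeGen_mul_comm (j k : Simple r) (h : j.1 + 1 < k.1) :
    heckeGen q r j * heckeGen q r k = heckeGen q r k * heckeGen q r j := by
  simpa only [heckeGen, map_mul] using RingQuot.mkAlgHom_rel R (HeckeRel.comm (q := q) j k h)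

theorem heckeGen_braid (j k : Simple r) (h : j.1 + 1 = k.1) :
    heckeGen q r j * heckeGen q r k * heckeGen q r j =
      heckeGen q r k * heckeGen q r j * heckeGen q r k := by
  simpa only [heckeGen, map_mul] using RingQuot.mkAlgHom_rel R (HeckeRel.braid (q := q) j k h)

theorem heckeT_eq_of_reduced {L : List (Simple r)} (h : L.length = length (wordProd L)) :
    heckeT q (wordProd L) = (L.map (heckeGen q r)).prod :=
  prod_eq_of_reduced (heckeGen_mul_comm q) (heckeGen_braid q) _ (wordProd L) _ _ rfl
    (exists_reducedWord (wordProd L)).choose_spec.1 rfl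
    (exists_reducedWord (wordProd L)).choose_spec.2 h

/-- When lengths add, the concatenation of reduced words is reduced. -/
theorem heckeT_mul {u v : W r} (h : length (u * v) = length u + length v) :
    heckeT q (u * v) = heckeT q u * heckeT q v := by
  obtain ⟨L, rfl, hL⟩ := exists_reducedWord u
  obtain ⟨L', rfl, hL'⟩ := exists_reducedWord v
  rw [heckeT_eq_of_reduced q hL, heckeT_eq_of_reduced q hL', ← wordProd_append,
    heckeT_eq_of_reduced q, List.map_append, List.prod_append]
  rw [wordProd_append, h, List.length_append, hL, hL']

theorem heckeT_simpleRefl (k : Simple r) : heckeT q (simpleRefl k) = heckeGen q r k := by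
  have hl : length (simpleRefl k) = 1 := by
    have := length_mul_of_lt (w := (1 : W r)) (k := k) k.fst_lt_snd
    rwa [one_mul, length_one] at this
  have := heckeT_eq_of_reduced q (L := [k]) (by rw [wordProd_singleton, hl]; rfl)
  rw [wordProd_singleton] at this
  simpa using this

theorem heckeT_one : heckeT q (1 : W r) = 1 := by
  have := heckeT_eq_of_reduced q (r := r) (L := []) (by simp [wordProd, length_one])
  simpa [wordProd] using this

theorem heckeT_mul_simpleRefl {w : W r} {k : Simple r} (h : w k.fst < w k.snd) :
    heckeT q (w * simpleRefl k) = heckeT q w * heckeGen q r k := by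
  have hl := length_mul_of_lt (w := (1 : W r)) (k := k) k.fst_lt_snd
  rw [one_mul, length_one] at hl
  rw [heckeT_mul, heckeT_simpleRefl]
  rw [length_mul_of_lt h, hl]

end Hecke

/-! ### Stabilisers of words -/

/-- The permutations of the places which preserve the word `c`. -/
def wordStab {r : ℕ} {ι : Type*} (c : Fin r → ι) : Subgroup (W r) where
  carrier := {w | ∀ k, c (w k) = c k}
  mul_mem' := by
    intro a b ha hb k
    rw [Equiv.Perm.mul_apply, ha, hb]
  one_mem' := fun _ => rfl
  inv_mem' := by
    intro a ha k
    rw [← ha, apply_inv_self]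

theorem mem_wordStab {r : ℕ} {ι : Type*} {c : Fin r → ι} {w : W r} :
    w ∈ wordStab c ↔ ∀ k, c (w k) = c k := Iff.rfl

theorem young_eq_wordStab (r : ℕ) (α : List ℕ) :
    young r α = wordStab fun k : Fin r => blockIdx α k := rfl

theorem mem_conjBy {r : ℕ} {G : Subgroup (W r)} {x w : W r} :
    w ∈ conjBy G x ↔ x * w * x⁻¹ ∈ G := by
  rw [conjBy, Subgroup.mem_map_equiv, MulAut.conj_symm_apply, inv_inv]

theorem conjBy_wordStab {r : ℕ} {ι : Type*} (c : Fin r → ι) (x : W r) :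
    conjBy (wordStab c) x = wordStab (c ∘ x) := by
  ext w
  simp only [mem_conjBy, mem_wordStab, Equiv.Perm.mul_apply, Function.comp_apply]
  exact ⟨fun h k => by simpa only [inv_apply_self] using h (x k),
    fun h k => by simpa only [apply_inv_self] using h (x⁻¹ k)⟩

theorem conjBy_mul {r : ℕ} (G : Subgroup (W r)) (x y : W r) :
    conjBy (conjBy G x) y = conjBy G (x * y) := by
  ext w
  simp [mem_conjBy, mul_assoc]

theorem conjBy_mono {r : ℕ} {G H : Subgroup (W r)} (h : G ≤ H) (x : W r) :
    conjBy G x ≤ conjBy H x := Subgroup.map_mono h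

section Monotone

variable {r : ℕ} {ι : Type*} [LinearOrder ι] {c : Fin r → ι}

theorem eq_of_mem_invSet (hc : Monotone c) {g : W r} (hg : g ∈ wordStab c) {p : Fin r × Fin r}
    (hp : p ∈ invSet g) : c p.1 = c p.2 := by
  rw [mem_invSet] at hp
  refine le_antisymm (hc hp.1.le) ?_
  have := hc hp.2.le
  rwa [inv_mem hg, inv_mem hg] at this

/-- Inversions of `g * x` are split by whether their two letters lie in one fibre of `c`. Inside a
fibre `x⁻¹` preserves the order, which leaves the inversions of `g`. Between different fibres `g`
preserves the order, and `g⁻¹` carries these inversions to the inversions of `x`. -/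
theorem length_mul_of_increasing (hc : Monotone c) {g x : W r} (hg : g ∈ wordStab c)
    (hx : ∀ a b, a < b → c a = c b → x⁻¹ a < x⁻¹ b) :
    length (g * x) = length g + length x := by
  have hgi : ∀ k, c (g⁻¹ k) = c k := inv_mem hg
  have hlt : ∀ a b, c a < c b → a < b := fun a b h => lt_of_not_ge fun h' => (hc h').not_gt h
  have hne : ∀ p ∈ invSet x, c p.1 ≠ c p.2 := by
    intro p hp he
    rw [mem_invSet] at hp
    exact (hx _ _ hp.1 he).not_gt hp.2
  have h1 : (invSet (g * x)).filter (fun p => c p.1 = c p.2) = invSet g := by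
    ext ⟨a, b⟩
    simp only [Finset.mem_filter, mem_invSet, mul_inv_rev, Equiv.Perm.mul_apply]
    constructor
    · rintro ⟨⟨h1, h2⟩, h3⟩
      refine ⟨h1, lt_of_not_ge fun h => ?_⟩
      rcases h.lt_or_eq with h | h
      · exact (hx _ _ h (by rw [hgi, hgi, h3])).not_gt h2
      · exact h1.ne (g⁻¹.injective h)
    · intro h
      have h3 : c a = c b := eq_of_mem_invSet hc hg (p := (a, b)) (mem_invSet.2 h)
      exact ⟨⟨h.1, hx _ _ h.2 (by rw [hgi, hgi, h3])⟩, h3⟩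
  have h2 : ((invSet (g * x)).filter (fun p => ¬c p.1 = c p.2)).card = (invSet x).card := by
    refine Finset.card_bij' (fun p _ => (g⁻¹ p.1, g⁻¹ p.2)) (fun p _ => (g p.1, g p.2)) ?_ ?_ ?_ ?_
    · rintro ⟨a, b⟩ hp
      simp only [Finset.mem_filter, mem_invSet, mul_inv_rev, Equiv.Perm.mul_apply] at hp ⊢
      refine ⟨hlt _ _ ?_, hp.1.2⟩
      rw [hgi, hgi]
      exact (hc hp.1.1.le).lt_of_ne hp.2
    · rintro ⟨a, b⟩ hp
      have h3 := hne _ hp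
      simp only [Finset.mem_filter, mem_invSet, mul_inv_rev, Equiv.Perm.mul_apply,
        inv_apply_self] at hp ⊢
      rw [hg, hg]
      refine ⟨⟨hlt _ _ ?_, hp.2⟩, h3⟩
      rw [hg, hg]
      exact (hc hp.1.le).lt_of_ne h3
    · intro p _
      simp only [apply_inv_self]
    · intro p _
      simp only [inv_apply_self]
  rw [length_eq_card_invSet, length_eq_card_invSet, length_eq_card_invSet, ← h2, ← h1]
  exact (Finset.card_filter_add_card_filter_not _).symm

/-- A descent of `x⁻¹` between neighbouring places of one fibre would give a transposition in the
stabiliser that shortens `x`. The converse is the additivity of lengths. -/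
theorem mem_cosetReps_wordStab (hc : Monotone c) {x : W r} :
    x ∈ cosetReps (wordStab c) ↔ ∀ a b, a < b → c a = c b → x⁻¹ a < x⁻¹ b := by
  refine ⟨fun h a b => lt_of_adjacent hc (p := ⇑x⁻¹) fun k hk => ?_, fun h g hg => ?_⟩
  · refine (apply_fst_lt_or x⁻¹ k).resolve_right fun h1 => ?_
    have h2 := length_mul_of_gt h1
    have hs : simpleRefl k ∈ wordStab c := by
      intro a
      by_cases h3 : a = k.fst
      · rw [h3, simpleRefl_fst, hk]
      by_cases h4 : a = k.snd
      · rw [h4, simpleRefl_snd, hk]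
      rw [simpleRefl_of_ne k a h3 h4]
    have h5 := h _ hs
    rw [← length_inv (simpleRefl k * x), mul_inv_rev, simpleRefl_inv] at h5
    rw [length_inv] at h2
    omega
  · rw [length_mul_of_increasing hc hg h]
    omega

theorem length_mul_of_mem_cosetReps (hc : Monotone c) {g x : W r} (hg : g ∈ wordStab c)
    (hx : x ∈ cosetReps (wordStab c)) : length (g * x) = length g + length x :=
  length_mul_of_increasing hc hg ((mem_cosetReps_wordStab hc).1 hx)

theorem cosetReps_unique (hc : Monotone c) {g x y : W r} (hg : g ∈ wordStab c)
    (hx : x ∈ cosetReps (wordStab c)) (hy : y ∈ cosetReps (wordStab c)) (h : g * x = y) :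
    g = 1 ∧ x = y := by
  have h1 := length_mul_of_mem_cosetReps hc hg hx
  have h2 := hy _ (inv_mem hg)
  rw [← h, inv_mul_cancel_left] at h2
  have h3 : g = 1 := eq_one_of_length_eq_zero (by omega)
  exact ⟨h3, by rw [← h, h3, one_mul]⟩

theorem one_mem_cosetReps (hc : Monotone c) : (1 : W r) ∈ cosetReps (wordStab c) :=
  (mem_cosetReps_wordStab hc).2 fun _ _ h _ => h

theorem exists_cosetRep (G : Subgroup (W r)) (w : W r) :
    ∃ g ∈ G, ∃ x ∈ cosetReps G, g * x = w := by
  classical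
  obtain ⟨g, hg, hmin⟩ := Set.exists_min_image (G : Set (W r)) (fun g => length (g * w))
    (Set.toFinite _) ⟨1, one_mem G⟩
  refine ⟨g⁻¹, inv_mem hg, g * w, fun h hh => ?_, inv_mul_cancel_left _ _⟩
  rw [← mul_assoc]
  exact hmin _ (mul_mem hh hg)

/-- The elements of the stabiliser of a word, as a finset. -/
noncomputable def stabFinset {r : ℕ} {ι : Type*} (c : Fin r → ι) : Finset (W r) :=
  (wordStab c : Set (W r)).toFinite.toFinset

theorem mem_stabFinset {r : ℕ} {ι : Type*} {c : Fin r → ι} {w : W r} :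
    w ∈ stabFinset c ↔ w ∈ wordStab c := by
  simp [stabFinset]

/-- Each `w` is uniquely `g * x` with `g` in the stabiliser and `x` a shortest representative. -/
theorem sum_eq_sum_cosetReps {A : Type*} [AddCommMonoid A] (hc : Monotone c) (F : W r → A) :
    ∑ w, F w = ∑ x ∈ (cosetReps (wordStab c)).toFinite.toFinset, ∑ g ∈ stabFinset c,
      F (g * x) := by
  rw [← Finset.sum_product' (f := fun x g => F (g * x))]
  symm
  refine Finset.sum_bij (fun p _ => p.2 * p.1) (fun _ _ => Finset.mem_univ _) ?_ ?_
    fun _ _ => rfl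
  · rintro ⟨x, g⟩ h1 ⟨y, h⟩ h2 he
    simp only [Finset.mem_product, Set.Finite.mem_toFinset, mem_stabFinset] at h1 h2 he
    have := cosetReps_unique hc (mul_mem (inv_mem h2.2) h1.2) h1.1 h2.1
      (by rw [mul_assoc, he, inv_mul_cancel_left])
    rw [inv_mul_eq_one] at this
    rw [this.1, this.2]
  · intro w _
    obtain ⟨g, hg, x, hx, rfl⟩ := exists_cosetRep (wordStab c) w
    exact ⟨(x, g), by simpa [mem_stabFinset] using ⟨hx, hg⟩, rfl⟩

end Monotone

/-! ### Blocks of a composition -/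

theorem blockIdx_eq_iff {α : List ℕ} {k i : ℕ} (hi : i < α.length) :
    blockIdx α k = i ↔ (α.take i).sum ≤ k ∧ k < (α.take (i + 1)).sum := by
  induction α generalizing k i with
  | nil => simp at hi
  | cons a α ih =>
    rw [blockIdx]
    cases i with
    | zero =>
      simp
    | succ i =>
      rw [List.length_cons] at hi
      have := ih (k := k - a) (i := i) (by omega)
      simp only [List.take_succ_cons, List.sum_cons]
      split_ifs with h
      · exact ⟨False.elim, by omega⟩
      · rw [Nat.add_right_cancel_iff, this]
        omega

theorem blockIdx_mono (α : List ℕ) : Monotone (blockIdx α) := by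
  induction α with
  | nil => exact fun _ _ _ => le_rfl
  | cons a α ih =>
    intro k k' h
    rw [blockIdx, blockIdx]
    split_ifs
    · exact le_rfl
    · exact Nat.zero_le _
    · omega
    · exact Nat.succ_le_succ (ih (by omega))

theorem card_blockIdx_eq {r : ℕ} {α : List ℕ} (hr : α.sum = r) {i : ℕ} (hi : i < α.length) :
    (Finset.univ.filter fun k : Fin r => blockIdx α k = i).card = α[i] := by
  have h1 : (α.take (i + 1)).sum = (α.take i).sum + α[i] := List.sum_take_succ α i hi
  have h2 : (α.take (i + 1)).sum ≤ r := by
    rw [← hr, ← List.sum_take_add_sum_drop α (i + 1)]; omega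
  have h3 : α[i] = (Finset.Ico (α.take i).sum (α.take (i + 1)).sum).card := by
    rw [Nat.card_Ico]; omega
  rw [h3]
  refine Finset.card_bij (fun k _ => k.1) ?_ (fun _ _ _ _ h => Fin.ext h) ?_
  · intro k hk
    rw [Finset.mem_filter, blockIdx_eq_iff hi] at hk
    exact Finset.mem_Ico.2 hk.2
  · intro k hk
    rw [Finset.mem_Ico] at hk
    refine ⟨⟨k, by omega⟩, ?_, rfl⟩
    rw [Finset.mem_filter, blockIdx_eq_iff hi]
    exact ⟨Finset.mem_univ _, hk⟩

theorem sum_take_card_fiber {r N : ℕ} (c : Fin r → Fin N) (i : ℕ) (hi : i ≤ N) :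
    ((List.ofFn fun j : Fin N => (Finset.univ.filter fun a => c a = j).card).take i).sum =
      (Finset.univ.filter fun a => (c a : ℕ) < i).card := by
  induction i with
  | zero => simp
  | succ i ih =>
    have hi' : i < (List.ofFn fun j : Fin N =>
        (Finset.univ.filter fun a => c a = j).card).length := by
      rw [List.length_ofFn]; omega
    rw [List.sum_take_succ _ _ hi', ih (by omega), List.getElem_ofFn,
      ← Finset.card_union_of_disjoint]
    · congr 1
      ext a
      simp only [Finset.mem_union, Finset.mem_filter, Finset.mem_univ, true_and, Fin.ext_iff]
      omega
    · rw [Finset.disjoint_filter]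
      intro a _ h1 h2
      simp only [Fin.ext_iff] at h2
      omega

theorem sum_card_fiber {r N : ℕ} (c : Fin r → Fin N) :
    ∑ j, (Finset.univ.filter fun a => c a = j).card = r := by
  rw [← Finset.card_eq_sum_card_fiberwise (fun _ _ => Finset.mem_univ _), Finset.card_univ,
    Fintype.card_fin]

/-- A monotone word is determined by the multiplicities of its letters. -/
theorem blockIdx_ofFn_card {r N : ℕ} {c : Fin r → Fin N} (hc : Monotone c) (k : Fin r) :
    blockIdx (List.ofFn fun j : Fin N => (Finset.univ.filter fun a => c a = j).card) k = c k := by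
  have hmono : Monotone fun a => (c a : ℕ) := fun a b h => hc h
  rw [blockIdx_eq_iff (by rw [List.length_ofFn]; exact (c k).2),
    -- The partial sums of the multiplicities count the places with a letter below a given bound; in
    -- a monotone word these places form an initial segment.
    sum_take_card_fiber c _ (c k).2.le, sum_take_card_fiber c (c k + 1) (c k).2]
  have h1 := Tuple.lt_card_lt_iff_apply_lt_of_monotone (j := k) (a := (c k : ℕ)) hmono
  have h2 := Tuple.lt_card_lt_iff_apply_lt_of_monotone (j := k) (a := (c k : ℕ) + 1) hmono
  omega

/-! ### Multi-indices and distinguished double coset representatives -/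

section Comp

variable {m n r : ℕ}

theorem Comp.word_mono (lam : Comp m n r) : Monotone lam.word :=
  fun _ _ h => blockIdx_mono lam.parts h

theorem Comp.group_eq (lam : Comp m n r) : lam.group = wordStab lam.word := by
  ext w
  exact forall_congr' fun k => (Fin.ext_iff (a := lam.word (w k)) (b := lam.word k)).symm

theorem Comp.card_word_eq (lam : Comp m n r) (i : Fin (m + n)) :
    (Finset.univ.filter fun k => lam.word k = i).card = lam.1 i := by
  have hr : lam.parts.sum = r := by rw [Comp.parts, List.sum_ofFn, lam.2]
  have hi : i.1 < lam.parts.length := by rw [Comp.parts, List.length_ofFn]; exact i.2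
  have h := card_blockIdx_eq hr hi
  have h' : lam.parts[i.1] = lam.1 i := by simp only [Comp.parts, List.getElem_ofFn]
  rw [← h', ← h]
  congr 1
  ext k
  rw [Finset.mem_filter, Finset.mem_filter]
  exact and_congr_right fun _ => Fin.ext_iff

theorem exists_word_eq {c : Fin r → Fin (m + n)} (hc : Monotone c) :
    ∃ lam : Comp m n r, lam.word = c :=
  ⟨⟨_, sum_card_fiber c⟩, funext fun k => Fin.ext (blockIdx_ofFn_card hc k)⟩

theorem card_comp_perm {ι : Type*} [DecidableEq ι] (c : Fin r → ι) (w : W r) (i : ι) :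
    (Finset.univ.filter fun k => c (w k) = i).card =
      (Finset.univ.filter fun k => c k = i).card :=
  Finset.card_equiv w (by simp)

theorem Comp.eq_of_word_comp_eq {lam mu : Comp m n r} {x y : W r}
    (h : lam.word ∘ x = mu.word ∘ y) : lam = mu := by
  refine Subtype.ext (funext fun i => ?_)
  rw [← lam.card_word_eq, ← mu.card_word_eq, ← card_comp_perm _ x, ← card_comp_perm mu.word y]
  have h : ∀ k, lam.word (x k) = mu.word (y k) := congrFun h
  simp only [h]

/-! ### Distinguished double coset representatives in terms of words -/

theorem mem_doubleReps {lam mu : Comp m n r} {d : W r} :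
    d ∈ doubleReps lam mu ↔ (∀ a b, a < b → lam.word a = lam.word b → d⁻¹ a < d⁻¹ b) ∧
      ∀ a b, a < b → mu.word a = mu.word b → d a < d b := by
  change d ∈ cosetReps lam.group ∧ d⁻¹ ∈ cosetReps mu.group ↔ _
  rw [lam.group_eq, mu.group_eq,
    mem_cosetReps_wordStab lam.word_mono, mem_cosetReps_wordStab mu.word_mono, inv_inv]

theorem le_of_mem_doubleReps {lam mu : Comp m n r} {d : W r} (hd : d ∈ doubleReps lam mu)
    {a b : Fin r} (hab : a ≤ b) (h : mu.word a = mu.word b) : lam.word (d a) ≤ lam.word (d b) := by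
  rcases hab.lt_or_eq with hab | rfl
  · exact lam.word_mono ((mem_doubleReps.1 hd).2 a b hab h).le
  · exact le_rfl

/-- `d` is the inverse of the stable sorting permutation of `c`, and `λ` records the multiplicities
of the letters. Stability makes `d` shortest in `W_λ d`; that `c` does not decrease on the blocks of
`μ` makes `d` increase there. -/
theorem exists_doubleRep {mu : Comp m n r} {c : Fin r → Fin (m + n)}
    (hc : ∀ a b, a < b → mu.word a = mu.word b → c a ≤ c b) :
    ∃ (lam : Comp m n r) (d : W r), d ∈ doubleReps lam mu ∧ lam.word ∘ d = c := by
  obtain ⟨lam, hlam⟩ := exists_word_eq (Tuple.monotone_sort c)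
  have hs := (Tuple.eq_sort_iff (f := c) (σ := Tuple.sort c)).1 rfl
  generalize (Tuple.sort c : W r) = s at hlam hs
  have hw : lam.word ∘ ⇑s⁻¹ = c := by
    rw [hlam]
    funext k
    exact congrArg c (apply_inv_self _ k)
  have h1 : ∀ a b, a < b → lam.word a = lam.word b → s a < s b := by
    intro a b hab he
    rw [hlam] at he
    exact hs.2 a b hab he
  refine ⟨lam, s⁻¹, mem_doubleReps.2 ⟨h1, fun a b hab he => ?_⟩, hw⟩
  have h2 := hc a b hab he
  rw [← hw, Function.comp_apply, Function.comp_apply] at h2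
  rcases h2.lt_or_eq with h | h
  · exact lt_of_not_ge fun h' => (lam.word_mono h').not_gt h
  · rcases lt_trichotomy (s⁻¹ a) (s⁻¹ b) with h3 | h3 | h3
    · exact h3
    · exact absurd (Equiv.injective _ h3) hab.ne
    · have := h1 _ _ h3 h.symm
      rw [apply_inv_self, apply_inv_self] at this
      exact absurd this hab.not_gt

/-- The word `i_λ d` determines `λ` by its letters and then the coset `W_λ d`, which has only one
shortest element. -/
theorem doubleReps_unique {lam lam' mu mu' : Comp m n r} {d d' : W r} (hd : d ∈ doubleReps lam mu)
    (hd' : d' ∈ doubleReps lam' mu') (h : lam.word ∘ d = lam'.word ∘ d') : lam = lam' ∧ d = d' := by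
  have he := Comp.eq_of_word_comp_eq h
  subst he
  refine ⟨rfl, ?_⟩
  have h1 := hd.1
  have h2 := hd'.1
  rw [lam.group_eq] at h1 h2
  refine (cosetReps_unique lam.word_mono (g := d' * d⁻¹) (fun k => ?_) h1 h2 (by simp)).2
  have := congrFun h (d⁻¹ k)
  simp only [Function.comp_apply, apply_inv_self] at this
  rw [this, Equiv.Perm.mul_apply]

/-- The word in the pairs of letters of `i_μ` and `i_λ d`. -/
def pairWord (mu lam : Comp m n r) (d : W r) (k : Fin r) : Fin (m + n) ×ₗ Fin (m + n) :=
  toLex (mu.word k, lam.word (d k))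

theorem pairWord_eq_iff {mu lam : Comp m n r} {d : W r} {a b : Fin r} :
    pairWord mu lam d a = pairWord mu lam d b ↔
      mu.word a = mu.word b ∧ lam.word (d a) = lam.word (d b) := by
  simp [pairWord]

/-- With the lexicographic order, the results on stabilisers of monotone words apply to `W_λ^d ∩
W_μ`. -/
theorem pairWord_mono {mu lam : Comp m n r} {d : W r} (hd : d ∈ doubleReps lam mu) :
    Monotone (pairWord mu lam d) := by
  intro a b hab
  rw [pairWord, pairWord, Prod.Lex.toLex_le_toLex]
  rcases (mu.word_mono hab).lt_or_eq with h | h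
  · exact Or.inl h
  · exact Or.inr ⟨h, le_of_mem_doubleReps hd hab h⟩

theorem interGroup_eq (mu lam : Comp m n r) (d : W r) :
    interGroup lam d mu = wordStab (pairWord mu lam d) := by
  rw [interGroup, lam.group_eq, mu.group_eq, conjBy_wordStab]
  ext w
  simp only [Subgroup.mem_inf, mem_wordStab, pairWord_eq_iff, Function.comp_apply, forall_and]
  exact and_comm

theorem swap_mem_wordStab {ι : Type*} {c : Fin r → ι} {a b : Fin r} (h : c a = c b) :
    Equiv.swap a b ∈ wordStab c := by
  intro k
  rw [Equiv.swap_apply_def]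
  split_ifs with h1 h2
  · rw [h1, h]
  · rw [h2, h]
  · rfl

theorem mem_evenGroup {lam : Comp m n r} {w : W r} :
    w ∈ lam.evenGroup ↔ w ∈ wordStab lam.word ∧ ∀ k, m ≤ (lam.word k).1 → w k = k := by
  rw [Comp.evenGroup, Subgroup.mem_inf, lam.group_eq, mem_fixingSubgroup_iff]
  rfl

theorem mem_oddGroup {lam : Comp m n r} {w : W r} :
    w ∈ lam.oddGroup ↔ w ∈ wordStab lam.word ∧ ∀ k, (lam.word k).1 < m → w k = k := by
  rw [Comp.oddGroup, Subgroup.mem_inf, lam.group_eq, mem_fixingSubgroup_iff]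
  rfl

/-- The trivial intersection property is tested on transpositions. Two places with the same pair of
letters can be swapped inside `W_λ^d ∩ W_μ`; if the two letters of the pair differ in parity, the
swap lies in one of the forbidden intersections. Conversely, an element of such an intersection that
moves `a` shows that `a` and its image carry the same pair, of mixed parity. -/
theorem mem_superReps {lam mu : Comp m n r} {d : W r} :
    d ∈ superReps lam mu ↔ d ∈ doubleReps lam mu ∧ ∀ a b, a ≠ b →
      pairWord mu lam d a = pairWord mu lam d b →
        ((mu.word a).1 < m ↔ (lam.word (d a)).1 < m) := by
  have key : ∀ a b, pairWord mu lam d a = pairWord mu lam d b →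
      d * Equiv.swap a b * d⁻¹ ∈ wordStab lam.word ∧ Equiv.swap a b ∈ wordStab mu.word := by
    intro a b h
    have h1 : Equiv.swap a b ∈ interGroup lam d mu := by
      rw [interGroup_eq]; exact swap_mem_wordStab h
    rwa [interGroup, Subgroup.mem_inf, mem_conjBy, lam.group_eq, mu.group_eq] at h1
  have fix : ∀ a b x : Fin r, x ≠ a → x ≠ b → Equiv.swap a b x = x :=
    fun a b x h1 h2 => Equiv.swap_apply_of_ne_of_ne h1 h2
  refine and_congr_right fun hd => ⟨fun h a b hab hp => ?_, fun h => ⟨?_, ?_⟩⟩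
  · obtain ⟨h1, h2⟩ := key a b hp
    rw [pairWord_eq_iff] at hp
    by_contra hne
    refine hab (Equiv.swap_eq_one_iff.1 ?_)
    rw [← Subgroup.mem_bot]
    by_cases hm : (mu.word a).1 < m
    · have hl : ¬(lam.word (d a)).1 < m := fun hl => hne ⟨fun _ => hl, fun _ => hm⟩
      rw [← h.2, Subgroup.mem_inf, mem_conjBy, mem_oddGroup, mem_evenGroup]
      refine ⟨⟨h1, fun k hk => ?_⟩, h2, fun k hk => fix _ _ _ ?_ ?_⟩
      · rw [Equiv.Perm.mul_apply, Equiv.Perm.mul_apply, fix, apply_inv_self]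
        · rintro rfl; rw [apply_inv_self] at hl; exact hl hk
        · rintro rfl; rw [hp.2, apply_inv_self] at hl; exact hl hk
      · rintro rfl; omega
      · rintro rfl; rw [hp.1] at hm; omega
    · have hl : (lam.word (d a)).1 < m := by
        by_contra hl; exact hne ⟨fun h => absurd h hm, fun h => absurd h hl⟩
      rw [← h.1, Subgroup.mem_inf, mem_conjBy, mem_oddGroup, mem_evenGroup]
      refine ⟨⟨h1, fun k hk => ?_⟩, h2, fun k hk => fix _ _ _ ?_ ?_⟩
      · rw [Equiv.Perm.mul_apply, Equiv.Perm.mul_apply, fix, apply_inv_self]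
        · rintro rfl; rw [apply_inv_self] at hl; omega
        · rintro rfl; rw [hp.2, apply_inv_self] at hl; omega
      · rintro rfl; omega
      · rintro rfl; rw [hp.1] at hm; omega
  · rw [eq_bot_iff]
    intro w hw
    rw [Subgroup.mem_inf, mem_conjBy, mem_evenGroup, mem_oddGroup] at hw
    obtain ⟨⟨h1, h2⟩, h3, h4⟩ := hw
    rw [Subgroup.mem_bot]
    ext1 a
    by_contra hne
    have e1 := h1 (d a)
    have e2 := h2 (d a)
    simp only [Equiv.Perm.mul_apply, inv_apply_self, EmbeddingLike.apply_eq_iff_eq] at e1 e2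
    have e3 := h a (w a) (Ne.symm hne) (pairWord_eq_iff.2 ⟨(h3 a).symm, e1.symm⟩)
    have e4 : ¬(mu.word a).1 < m := fun h => hne (h4 a h)
    exact hne (e2 (by omega))
  · rw [eq_bot_iff]
    intro w hw
    rw [Subgroup.mem_inf, mem_conjBy, mem_evenGroup, mem_oddGroup] at hw
    obtain ⟨⟨h1, h2⟩, h3, h4⟩ := hw
    rw [Subgroup.mem_bot]
    ext1 a
    by_contra hne
    have e1 := h1 (d a)
    have e2 := h2 (d a)
    simp only [Equiv.Perm.mul_apply, inv_apply_self, EmbeddingLike.apply_eq_iff_eq] at e1 e2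
    have e3 := h a (w a) (Ne.symm hne) (pairWord_eq_iff.2 ⟨(h3 a).symm, e1.symm⟩)
    have e4 : ¬m ≤ (mu.word a).1 := fun h => hne (h4 a h)
    exact hne (e2 (by omega))

end Comp

variable {R : Type*} [CommRing R] {m n r : ℕ}

/-! ### Matrix coefficients -/

/-- The coefficient of `v_j` in the image of `v_i`. -/
noncomputable def coef (f : Module.End R (TensorSpace R m n r)) (i j : Fin r → Fin (m + n)) : R :=
  (tensorBasis R m n r).repr (f (tensorBasis R m n r i)) j

theorem coef_ext {f g : Module.End R (TensorSpace R m n r)} (h : ∀ i j, coef f i j = coef g i j) :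
    f = g :=
  (tensorBasis R m n r).ext fun i => (tensorBasis R m n r).repr.injective (Finsupp.ext (h i))

theorem coef_zero (i j : Fin r → Fin (m + n)) :
    coef (0 : Module.End R (TensorSpace R m n r)) i j = 0 := by
  simp [coef]

theorem coef_add (f g : Module.End R (TensorSpace R m n r)) (i j : Fin r → Fin (m + n)) :
    coef (f + g) i j = coef f i j + coef g i j := by
  simp [coef]

theorem coef_smul (c : R) (f : Module.End R (TensorSpace R m n r)) (i j : Fin r → Fin (m + n)) :
    coef (c • f) i j = c * coef f i j := by
  simp [coef]

theorem coef_sum {ι : Type*} (s : Finset ι) (f : ι → Module.End R (TensorSpace R m n r))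
    (i j : Fin r → Fin (m + n)) : coef (∑ x ∈ s, f x) i j = ∑ x ∈ s, coef (f x) i j := by
  simp [coef, LinearMap.sum_apply]

theorem apply_tensorBasis (f : Module.End R (TensorSpace R m n r)) (i : Fin r → Fin (m + n)) :
    f (tensorBasis R m n r i) = ∑ j, coef f i j • tensorBasis R m n r j :=
  ((tensorBasis R m n r).sum_repr _).symm

theorem coef_mul (g f : Module.End R (TensorSpace R m n r)) (i j : Fin r → Fin (m + n)) :
    coef (g * f) i j = ∑ k, coef f i k * coef g k j := by
  rw [coef, Module.End.mul_apply, apply_tensorBasis f, map_sum, map_sum, Finset.sum_apply']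
  simp [coef]

theorem coef_of_apply_eq_smul {f : Module.End R (TensorSpace R m n r)}
    {i k : Fin r → Fin (m + n)} {c : R}
    (h : f (tensorBasis R m n r i) = c • tensorBasis R m n r k) (j : Fin r → Fin (m + n)) :
    coef f i j = if j = k then c else 0 := by
  rw [coef, h, map_smul, Module.Basis.repr_self, Finsupp.smul_single, smul_eq_mul, mul_one,
    Finsupp.single_apply]
  simp only [eq_comm]

theorem coef_one (i j : Fin r → Fin (m + n)) :
    coef (1 : Module.End R (TensorSpace R m n r)) i j = if j = i then 1 else 0 :=
  coef_of_apply_eq_smul (by rw [Module.End.one_apply, one_smul]) j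

theorem coef_mul_of_apply_eq_smul {f : Module.End R (TensorSpace R m n r)}
    {i k : Fin r → Fin (m + n)} {c : R}
    (h : f (tensorBasis R m n r i) = c • tensorBasis R m n r k)
    (g : Module.End R (TensorSpace R m n r)) (j : Fin r → Fin (m + n)) :
    coef (g * f) i j = c * coef g k j := by
  rw [coef, Module.End.mul_apply, h]
  simp [coef]

theorem matUnit_basis (a b i : Fin r → Fin (m + n)) :
    matUnit R a b (tensorBasis R m n r i) = if i = a then tensorBasis R m n r b else 0 :=
  (tensorBasis R m n r).constr_basis R _ i

theorem coef_matUnit (a b i j : Fin r → Fin (m + n)) :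
    coef (matUnit R a b) i j = (if i = a then 1 else 0) * if j = b then 1 else 0 := by
  rw [coef, matUnit_basis]
  split_ifs <;> simp_all [eq_comm]

theorem coef_mul_matUnit_mul (f g : Module.End R (TensorSpace R m n r))
    (a b i j : Fin r → Fin (m + n)) :
    coef (f * matUnit R a b * g) i j = coef g i a * coef f b j := by
  rw [coef_mul]
  have : ∀ k, coef (f * matUnit R a b) k j = if k = a then coef f b j else 0 := by
    intro k
    rw [coef_mul]
    simp only [coef_matUnit]
    split_ifs <;> simp
  simp [this]

/-! ### The operators of the Hecke algebra -/

section Operators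

variable (q : Rˣ)

theorem genOp_apply_of_lt {k : Simple r} {i : Fin r → Fin (m + n)} (h : i k.fst < i k.snd) :
    genOp q m n k (tensorBasis R m n r i) =
      paritySign R (i k.fst) (i k.snd) • tensorBasis R m n r (i ∘ simpleRefl k) := by
  rw [genOp_basis, genVec, if_pos h]

theorem genOp_apply_of_eq {k : Simple r} {i : Fin r → Fin (m + n)} (h : i k.fst = i k.snd) :
    genOp q m n k (tensorBasis R m n r i) = diagFactor q (i k.fst) • tensorBasis R m n r i := by
  rw [genOp_basis, genVec, if_neg h.not_lt, if_pos h]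

theorem coef_genOp (k : Simple r) (i j : Fin r → Fin (m + n)) :
    coef (genOp q m n k) i j =
      if i k.fst = i k.snd then (if j = i then diagFactor q (i k.fst) else 0)
      else (if j = i ∘ simpleRefl k then paritySign R (i k.fst) (i k.snd) else 0) +
        if i k.snd < i k.fst ∧ j = i then (q : R) - (↑q⁻¹ : R) else 0 := by
  rcases lt_trichotomy (i k.fst) (i k.snd) with h | h | h
  · rw [coef_of_apply_eq_smul (genOp_apply_of_lt q h), if_neg h.ne,
      if_neg (c := i k.snd < i k.fst ∧ j = i) fun h' => h.not_gt h'.1, add_zero]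
  · rw [coef_of_apply_eq_smul (genOp_apply_of_eq q h), if_pos h]
  · rw [coef, genOp_basis, genVec, if_neg h.not_gt, if_neg h.ne', if_neg h.ne']
    simp only [map_add, map_smul, Module.Basis.repr_self, Finsupp.add_apply, Finsupp.smul_apply,
      Finsupp.single_apply, smul_eq_mul, mul_ite, mul_one, mul_zero, h, true_and, eq_comm]

theorem eq_comp_simpleRefl_comm {k : Simple r} {i j : Fin r → Fin (m + n)} :
    j = i ∘ simpleRefl k ↔ i = j ∘ simpleRefl k :=
  ⟨fun h => by rw [h, comp_simpleRefl_twice], fun h => by rw [h, comp_simpleRefl_twice]⟩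

theorem coef_genOp_symm (k : Simple r) (i j : Fin r → Fin (m + n)) :
    coef (genOp q m n k) i j = coef (genOp q m n k) j i := by
  rw [coef_genOp, coef_genOp]
  by_cases hij : j = i
  · rw [hij]
  have hij' : ¬i = j := fun h => hij h.symm
  by_cases h : j = i ∘ simpleRefl k
  · have h1 : j k.fst = i k.snd := by rw [h, Function.comp_apply, simpleRefl_fst]
    have h2 : j k.snd = i k.fst := by rw [h, Function.comp_apply, simpleRefl_snd]
    rw [if_pos h, if_pos (eq_comp_simpleRefl_comm.1 h), h1, h2,
      paritySign_comm R (i k.snd) (i k.fst)]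
    simp [hij, hij', eq_comm]
  · have h' : ¬i = j ∘ simpleRefl k := fun h1 => h (eq_comp_simpleRefl_comm.2 h1)
    simp [hij, hij', h, h']

/-- By the symmetry of the matrix of a generator, applying it last can be read off from its action
on the target word `j`. -/
theorem coef_genOp_mul (k : Simple r) (f : Module.End R (TensorSpace R m n r))
    (i j : Fin r → Fin (m + n)) :
    coef (genOp q m n k * f) i j =
      if j k.fst = j k.snd then diagFactor q (j k.fst) * coef f i j
      else paritySign R (j k.fst) (j k.snd) * coef f i (j ∘ simpleRefl k) +
        if j k.snd < j k.fst then ((q : R) - (↑q⁻¹ : R)) * coef f i j else 0 := by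
  rw [coef_mul]
  simp only [coef_genOp_symm q k _ j, coef_genOp]
  split_ifs with h1 h2
  · simp [mul_comm]
  · simp [h2, mul_add, Finset.sum_add_distrib, mul_comm]
  · simp [h2, mul_comm]

/-- The operator `v ↦ v 𝒯_w`. -/
noncomputable def opT (m n : ℕ) (w : W r) : Module.End R (TensorSpace R m n r) :=
  rightMul q m n (heckeT q w)

theorem rightMul_mul (g h : Hecke q r) :
    rightMul q m n (g * h) = rightMul q m n h * rightMul q m n g := by
  simp [rightMul]

theorem rightMul_heckeGen (k : Simple r) : rightMul q m n (heckeGen q r k) = genOp q m n k := by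
  simp [rightMul, heckeGen, heckeRep]

theorem opT_one : opT q m n (1 : W r) = 1 := by
  simp [opT, heckeT_one, rightMul]

theorem opT_mul {u v : W r} (h : length (u * v) = length u + length v) :
    opT q m n (u * v) = opT q m n v * opT q m n u := by
  rw [opT, heckeT_mul q h, rightMul_mul]; rfl

theorem opT_mul_simpleRefl {w : W r} {k : Simple r} (h : w k.fst < w k.snd) :
    opT q m n (w * simpleRefl k) = genOp q m n k * opT q m n w := by
  rw [opT, heckeT_mul_simpleRefl q h, rightMul_mul, rightMul_heckeGen]; rfl

theorem opT_inv_mul_simpleRefl {w : W r} {k : Simple r} (h : w k.fst < w k.snd) :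
    opT q m n (w * simpleRefl k)⁻¹ = opT q m n w⁻¹ * genOp q m n k := by
  have h1 := length_mul_of_lt (w := (1 : W r)) (k := k) k.fst_lt_snd
  rw [one_mul, length_one] at h1
  rw [mul_inv_rev, simpleRefl_inv, opT_mul, opT, opT, heckeT_simpleRefl, rightMul_heckeGen]
  rw [← length_inv, mul_inv_rev, inv_inv, simpleRefl_inv, length_mul_of_lt h, h1, length_inv,
    zero_add, add_comm]

/-- Induction along a reduced word, one letter at a time on the right. -/
theorem perm_induction {p : W r → Prop} (one : p 1)
    (step : ∀ (w : W r) (k : Simple r), w k.fst < w k.snd → p w → p (w * simpleRefl k)) (w : W r) :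
    p w := by
  induction hn : length w generalizing w with
  | zero => rwa [eq_one_of_length_eq_zero hn]
  | succ N ih =>
    by_cases hw : ∀ k : Simple r, w k.fst < w k.snd
    · rwa [eq_one_of_forall_lt hw]
    · push Not at hw
      obtain ⟨k, hk⟩ := hw
      have hk := (apply_fst_lt_or w k).resolve_left hk.not_gt
      have h1 := length_mul_of_gt hk
      have := step (w * simpleRefl k) k (by rwa [mul_simpleRefl_fst, mul_simpleRefl_snd])
        (ih _ (by omega))
      rwa [mul_simpleRefl_simpleRefl] at this

/-- The matrices of `𝒯_w` and `𝒯_{w⁻¹}` are transposed to each other. -/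
theorem coef_opT_inv (w : W r) (i j : Fin r → Fin (m + n)) :
    coef (opT q m n w⁻¹) i j = coef (opT q m n w) j i := by
  induction w using perm_induction generalizing i j with
  | one => rw [inv_one, opT_one, coef_one, coef_one]; simp only [eq_comm]
  | step w k h ih =>
    rw [opT_inv_mul_simpleRefl q h, opT_mul_simpleRefl q h, coef_mul, coef_mul]
    refine Finset.sum_congr rfl fun l _ => ?_
    rw [ih, coef_genOp_symm, mul_comm]

theorem exists_perm_of_coef_opT_ne_zero {w : W r} {i j : Fin r → Fin (m + n)}
    (h : coef (opT q m n w) i j ≠ 0) : ∃ u : W r, j = i ∘ u := by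
  induction w using perm_induction generalizing j with
  | one =>
    rw [opT_one, coef_one] at h
    exact ⟨1, by by_contra h1; exact h (if_neg h1)⟩
  | step w k hk ih =>
    rw [opT_mul_simpleRefl q hk, coef_genOp_mul] at h
    by_cases h1 : coef (opT q m n w) i j = 0
    · have h2 : coef (opT q m n w) i (j ∘ simpleRefl k) ≠ 0 := by
        intro h2
        simp [h1, h2] at h
      obtain ⟨u, hu⟩ := ih h2
      refine ⟨u * simpleRefl k, ?_⟩
      rw [Equiv.Perm.coe_mul, ← Function.comp_assoc, ← hu, comp_simpleRefl_twice]
    · exact ih h1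

/-- The factor that arises when a letter `a` moves past a letter `b ≥ a`. -/
def pairScalar (a b : Fin (m + n)) : R :=
  if a = b then diagFactor q a else paritySign R a b

/-- The scalar by which `v_i 𝒯_w` differs from `v_{iw}` if `w` inverts only pairs of letters which
are in the right order in `i`. -/
def wordScalar (i : Fin r → Fin (m + n)) (w : W r) : R :=
  ∏ p ∈ invSet w, pairScalar q (i p.1) (i p.2)

/-- Along a reduced word every step meets a new inversion, whose two letters are by hypothesis equal
or in increasing order. So the summand with `q - q⁻¹` never occurs, and each step contributes one
scalar. -/
theorem opT_apply {i : Fin r → Fin (m + n)} {w : W r} (h : ∀ p ∈ invSet w, i p.1 ≤ i p.2) :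
    opT q m n w (tensorBasis R m n r i) = wordScalar q i w • tensorBasis R m n r (i ∘ w) := by
  induction w using perm_induction with
  | one => simp [opT_one, wordScalar, invSet_one]
  | step w k hk ih =>
    rw [invSet_mul_simpleRefl hk] at h
    have h1 : i (w k.fst) ≤ i (w k.snd) := h _ (Finset.mem_insert_self _ _)
    rw [opT_mul_simpleRefl q hk, Module.End.mul_apply,
      ih fun p hp => h p (Finset.mem_insert_of_mem hp), map_smul, wordScalar, wordScalar,
      invSet_mul_simpleRefl hk, Finset.prod_insert apply_notMem_invSet, mul_comm, mul_smul]
    congr 1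
    rw [pairScalar, Equiv.Perm.coe_mul, ← Function.comp_assoc]
    rcases h1.lt_or_eq with h1 | h1
    · rw [if_neg h1.ne]
      exact genOp_apply_of_lt q (i := i ∘ w) h1
    · rw [if_pos h1, genOp_apply_of_eq q (i := i ∘ w) h1]
      congr 2
      funext x
      simp only [Function.comp_apply]
      by_cases h2 : x = k.fst
      · rw [h2, simpleRefl_fst, h1]
      by_cases h3 : x = k.snd
      · rw [h3, simpleRefl_snd, h1]
      rw [simpleRefl_of_ne k x h2 h3]

theorem coef_opT_eq {i : Fin r → Fin (m + n)} {w : W r} (h : ∀ p ∈ invSet w, i p.1 ≤ i p.2)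
    (j : Fin r → Fin (m + n)) :
    coef (opT q m n w) i j = if j = i ∘ w then wordScalar q i w else 0 :=
  coef_of_apply_eq_smul (opT_apply q h) j

theorem Comp.le_of_mem_invSet (mu : Comp m n r) (w : W r) :
    ∀ p ∈ invSet w, mu.word p.1 ≤ mu.word p.2 :=
  fun _ hp => mu.word_mono (mem_invSet.1 hp).1.le

theorem le_of_mem_invSet_of_mem_stab {lam mu : Comp m n r} {d w : W r}
    (hd : d ∈ doubleReps lam mu) (hw : w ∈ wordStab mu.word) :
    ∀ p ∈ invSet w, (lam.word ∘ d) p.1 ≤ (lam.word ∘ d) p.2 :=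
  fun _ hp => le_of_mem_doubleReps hd (mem_invSet.1 hp).1.le
    (eq_of_mem_invSet mu.word_mono hw hp)

end Operators

/-! ### The coefficients of the relative norms -/

section Norm

variable (q : Rˣ)

theorem normElt_eq (mu lam : Comp m n r) (d : W r) :
    normElt q mu lam d = ∑ w ∈ (cosetReps (wordStab (pairWord mu lam d))).toFinite.toFinset,
      opT q m n w * matUnit R mu.word (lam.word ∘ d) * opT q m n w⁻¹ := by
  rw [normElt, relNorm, interGroup_eq]
  rfl

theorem coef_normElt (mu lam : Comp m n r) (d : W r) (i j : Fin r → Fin (m + n)) :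
    coef (normElt q mu lam d) i j =
      ∑ w ∈ (cosetReps (wordStab (pairWord mu lam d))).toFinite.toFinset,
        coef (opT q m n w) mu.word i * coef (opT q m n w) (lam.word ∘ d) j := by
  rw [normElt_eq, coef_sum]
  refine Finset.sum_congr rfl fun w _ => ?_
  rw [coef_mul_matUnit_mul, coef_opT_inv]

theorem coef_normElt_of_ne {mu mu' lam : Comp m n r} {d : W r} (h : mu' ≠ mu)
    (j : Fin r → Fin (m + n)) : coef (normElt q mu lam d) mu'.word j = 0 := by
  rw [coef_normElt]
  refine Finset.sum_eq_zero fun w _ => ?_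
  rw [coef_opT_eq q (mu.le_of_mem_invSet w), if_neg, zero_mul]
  intro h1
  exact h (Comp.eq_of_word_comp_eq (x := 1) (y := w) h1)

theorem exists_perm_of_coef_normElt_ne_zero {mu lam : Comp m n r} {d : W r}
    {i j : Fin r → Fin (m + n)} (h : coef (normElt q mu lam d) i j ≠ 0) :
    ∃ u : W r, j = lam.word ∘ u := by
  rw [coef_normElt] at h
  obtain ⟨w, _, hw⟩ := Finset.exists_ne_zero_of_sum_ne_zero h
  obtain ⟨u, hu⟩ := exists_perm_of_coef_opT_ne_zero q (right_ne_zero_of_mul hw)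
  exact ⟨d * u, hu⟩

/-- `w` only rearranges letters inside the blocks of `μ`, and both words are nondecreasing on each
block, so both are the sorted version of the same word. -/
theorem comp_eq_of_doubleReps {lam lam' mu : Comp m n r} {d d' w : W r}
    (hd : d ∈ doubleReps lam mu) (hd' : d' ∈ doubleReps lam' mu) (hw : w ∈ wordStab mu.word)
    (h : lam'.word ∘ d' = lam.word ∘ d ∘ w) : lam'.word ∘ d' = lam.word ∘ d := by
  have h1 : pairWord mu lam d ∘ w = pairWord mu lam' d' := by
    funext k
    simp only [Function.comp_apply, pairWord, hw k]
    exact congrArg (fun x => toLex (mu.word k, x)) (congrFun h k).symm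
  have h2 := Tuple.unique_monotone (f := pairWord mu lam d) (σ := w) (τ := 1)
    (h1 ▸ pairWord_mono hd') (pairWord_mono hd)
  rw [h1] at h2
  funext k
  exact congrArg (fun x => (ofLex x).2) (congrFun h2 k)

/-- Only `w = 1` contributes. A nonzero term forces `i_μ w = i_μ`, so `w` is in `W_μ` and sends
`v_{i_λ d}` to a multiple of `v_{i_λ d w}`. If that is the target word, then `w` lies in `W_λ^d ∩
W_μ`, whose only shortest coset representative is `1`. -/
theorem coef_normElt_doubleReps {mu lam lam' : Comp m n r} {d d' : W r}
    (hd : d ∈ doubleReps lam mu) (hd' : d' ∈ doubleReps lam' mu) :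
    coef (normElt q mu lam d) mu.word (lam'.word ∘ d') = if lam' = lam ∧ d' = d then 1 else 0 := by
  classical
  rw [coef_normElt]
  have hc := pairWord_mono hd
  rw [Finset.sum_eq_single_of_mem 1 (by simpa using one_mem_cosetReps hc)]
  · rw [opT_one, coef_one, coef_one, if_pos rfl, one_mul]
    refine if_congr ⟨fun h => doubleReps_unique hd' hd h, ?_⟩ rfl rfl
    rintro ⟨rfl, rfl⟩
    rfl
  · intro w hw hw1
    rw [coef_opT_eq q (mu.le_of_mem_invSet w)]
    split_ifs with h1
    · have hws : w ∈ wordStab mu.word := fun k => (congrFun h1 k).symm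
      rw [coef_opT_eq q (le_of_mem_invSet_of_mem_stab hd hws), if_neg, mul_zero]
      intro h2
      have h3 := comp_eq_of_doubleReps hd hd' hws h2
      refine hw1 (cosetReps_unique hc (g := w) (fun k => pairWord_eq_iff.2 ⟨hws k, ?_⟩)
        (one_mem_cosetReps hc) (by simpa using hw) (mul_one w)).1
      exact (congrFun (h2.symm.trans h3) k)
    · rw [zero_mul]

end Norm

/-! ### The `q`-Schur superalgebra -/

section Schur

variable (q : Rˣ)

theorem mem_schurAlgebra_iff {f : Module.End R (TensorSpace R m n r)} :
    f ∈ schurAlgebra q m n r ↔ ∀ k : Simple r, genOp q m n k * f = f * genOp q m n k := by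
  rw [schurAlgebra, Subalgebra.mem_centralizer_iff]
  constructor
  · intro h k
    rw [← rightMul_heckeGen]
    exact h _ ⟨_, rfl⟩
  · rintro h _ ⟨x, rfl⟩
    obtain ⟨x, rfl⟩ := RingQuot.mkAlgHom_surjective R (HeckeRel q r) x
    induction x using FreeAlgebra.induction with
    | grade0 c =>
      simp only [rightMul, AlgHom.commutes, MulOpposite.algebraMap_apply, MulOpposite.unop_op]
      exact Algebra.commutes c f
    | grade1 k =>
      have := h k
      rwa [← rightMul_heckeGen] at this
    | mul a b ha hb =>
      simp only at *
      rw [map_mul, rightMul_mul, mul_assoc, ha, ← mul_assoc, hb, mul_assoc]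
    | add a b ha hb =>
      simp only [rightMul, map_add, MulOpposite.unop_add, add_mul, mul_add] at *
      rw [ha, hb]

theorem opT_mul_comm {f : Module.End R (TensorSpace R m n r)} (hf : f ∈ schurAlgebra q m n r)
    (w : W r) : opT q m n w * f = f * opT q m n w := by
  rw [schurAlgebra, Subalgebra.mem_centralizer_iff] at hf
  exact hf _ ⟨_, rfl⟩

/-! ### Which coefficients determine an endomorphism -/

theorem exists_descent_of_not_increasing {ι : Type*} [PartialOrder ι] {c : Fin r → ι}
    (hc : Monotone c) {i : Fin r → Fin (m + n)}
    (h : ¬∀ a b, a < b → c a = c b → i a ≤ i b) :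
    ∃ k : Simple r, c k.fst = c k.snd ∧ i k.snd < i k.fst := by
  by_contra! hk
  refine h fun a b hab he => ?_
  -- Recording the place as a second component turns weak inequalities between letters into strict
  -- ones.
  have := lt_of_adjacent hc (p := fun a => toLex (i a, a)) (fun k hk' => ?_) hab he
  · rcases Prod.Lex.toLex_lt_toLex.1 this with h | h
    · exact h.le
    · exact h.1.le
  · rw [Prod.Lex.toLex_lt_toLex]
    exact (hk k hk').lt_or_eq.imp_right fun h => ⟨h, k.fst_lt_snd⟩

theorem comp_simpleRefl_lt {k : Simple r} {i : Fin r → Fin (m + n)} (h : i k.snd < i k.fst) :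
    toLex (i ∘ simpleRefl k) < toLex i := by
  refine ⟨k.fst, fun a ha => ?_, ?_⟩
  · change i (simpleRefl k a) = i a
    rw [simpleRefl_of_ne k a ha.ne (ha.trans k.fst_lt_snd).ne]
  · change i (simpleRefl k k.fst) < i k.fst
    rwa [simpleRefl_fst]

variable {q}

/-- If `d` is not in `𝒟°`, some neighbouring places `k`, `k + 1` carry the same letter in `i_μ` and
the same letter in `i_λ d`, but of opposite parities. Commuting with `𝒯_{s_k}` equates `q` times the
coefficient with `-q⁻¹` times it. -/
theorem coef_eq_zero_of_increasing [IsDomain R] (hq : (q : R) + (↑q⁻¹ : R) ≠ 0)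
    {f : Module.End R (TensorSpace R m n r)} (hf : f ∈ schurAlgebra q m n r) {mu : Comp m n r}
    (h0 : ∀ (lam : Comp m n r) (d : W r), d ∈ superReps lam mu →
      coef f mu.word (lam.word ∘ d) = 0) {i : Fin r → Fin (m + n)}
    (hi : ∀ a b, a < b → mu.word a = mu.word b → i a ≤ i b) : coef f mu.word i = 0 := by
  obtain ⟨lam, d, hd, rfl⟩ := exists_doubleRep hi
  by_cases hs : d ∈ superReps lam mu
  · exact h0 lam d hs
  have hex : ∃ a b, a < b ∧ pairWord mu lam d a = pairWord mu lam d b ∧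
      ¬((mu.word a).1 < m ↔ (lam.word (d a)).1 < m) := by
    rw [mem_superReps, not_and] at hs
    have := hs hd
    push Not at this
    obtain ⟨a, b, hab, h1, h2⟩ := this
    have h3 : ¬((mu.word a).1 < m ↔ (lam.word (d a)).1 < m) := by
      rcases h2 with h2 | h2 <;> omega
    rcases lt_or_gt_of_ne hab with h | h
    · exact ⟨a, b, h, h1, h3⟩
    · have h4 := pairWord_eq_iff.1 h1
      exact ⟨b, a, h, h1.symm, by rwa [← h4.1, ← h4.2]⟩
  obtain ⟨a, b, hab, h1, h2⟩ := hex
  -- Fibres of the monotone pair word are intervals, so the place after `a` carries the same pair as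
  -- `a` and `b`.
  let k : Simple r := ⟨a.1, by have := b.2; rw [Fin.lt_def] at hab; omega⟩
  have hka : k.fst = a := rfl
  have hkb : k.snd ≤ b := Fin.le_def.2 (Fin.lt_def.1 hab)
  have h3 : pairWord mu lam d k.fst = pairWord mu lam d k.snd :=
    le_antisymm (pairWord_mono hd k.fst_lt_snd.le) (hka ▸ h1 ▸ pairWord_mono hd hkb)
  rw [pairWord_eq_iff] at h3
  have h4 := congrArg (fun g => coef g mu.word (lam.word ∘ d)) ((mem_schurAlgebra_iff q).1 hf k)
  rw [coef_genOp_mul, if_pos (show (lam.word ∘ d) k.fst = (lam.word ∘ d) k.snd from h3.2),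
    coef_mul_of_apply_eq_smul (genOp_apply_of_eq q h3.1), hka] at h4
  have h5 : ((q : R) + (↑q⁻¹ : R)) * coef f mu.word (lam.word ∘ d) = 0 := by
    simp only [diagFactor, Function.comp_apply] at h4
    split_ifs at h4 with h6 h7 h7
    · exact absurd ⟨fun _ => h6, fun _ => h7⟩ h2
    · linear_combination h4
    · linear_combination -h4
    · exact absurd ⟨fun h => absurd h h7, fun h => absurd h h6⟩ h2
  exact (mul_eq_zero.1 h5).resolve_left hq

/-- Induction on the target word in lexicographic order. A descent inside a block of `μ` can be
undone: `𝒯_{s_k}` acts on `v_{i_μ}` by a scalar, so the coefficient at the word is, up to sign, a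
multiple of the one at the smaller swapped word. -/
theorem coef_word_eq_zero [IsDomain R] (hq : (q : R) + (↑q⁻¹ : R) ≠ 0)
    {f : Module.End R (TensorSpace R m n r)} (hf : f ∈ schurAlgebra q m n r) {mu : Comp m n r}
    (h0 : ∀ (lam : Comp m n r) (d : W r), d ∈ superReps lam mu →
      coef f mu.word (lam.word ∘ d) = 0) (i : Fin r → Fin (m + n)) : coef f mu.word i = 0 := by
  suffices ∀ x : Lex (Fin r → Fin (m + n)), coef f mu.word (ofLex x) = 0 from this (toLex i)
  intro x
  induction x using WellFoundedLT.induction with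
  | ind x ih =>
    by_cases hi : ∀ a b, a < b → mu.word a = mu.word b → ofLex x a ≤ ofLex x b
    · exact coef_eq_zero_of_increasing hq hf h0 hi
    obtain ⟨k, hk1, hk2⟩ := exists_descent_of_not_increasing mu.word_mono hi
    have h1 : coef f mu.word (ofLex x ∘ simpleRefl k) = 0 := ih _ (comp_simpleRefl_lt hk2)
    have h2 := congrArg (fun g => coef g mu.word (ofLex x ∘ simpleRefl k))
      ((mem_schurAlgebra_iff q).1 hf k)
    rw [coef_genOp_mul, coef_mul_of_apply_eq_smul (genOp_apply_of_eq q hk1), h1] at h2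
    simp only [Function.comp_apply, simpleRefl_fst, simpleRefl_snd, comp_simpleRefl_twice,
      hk2.ne, hk2.not_gt, if_false, add_zero, mul_zero] at h2
    have h3 := paritySign_sq R (ofLex x k.snd) (ofLex x k.fst)
    rw [← one_mul (coef _ _ _), ← h3, mul_assoc, h2, mul_zero]

/-- An element of the `q`-Schur superalgebra vanishes if its coefficients at all pairs
`(i_μ, i_λ d)` with `d ∈ 𝒟°_{λμ}` do. -/
theorem eq_zero_of_coef_eq_zero [IsDomain R] (hq : (q : R) + (↑q⁻¹ : R) ≠ 0)
    {f : Module.End R (TensorSpace R m n r)} (hf : f ∈ schurAlgebra q m n r)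
    (h0 : ∀ (lam mu : Comp m n r) (d : W r), d ∈ superReps lam mu →
      coef f mu.word (lam.word ∘ d) = 0) : f = 0 := by
  have key : ∀ x : Lex (Fin r → Fin (m + n)), f (tensorBasis R m n r (ofLex x)) = 0 := by
    intro x
    induction x using WellFoundedLT.induction with
    | ind x ih =>
      by_cases hx : ∀ a b : Fin r, a < b → () = () → ofLex x a ≤ ofLex x b
      · have hmono : Monotone (ofLex x) := by
          intro a b hab
          rcases hab.lt_or_eq with h | rfl
          · exact hx a b h rfl
          · exact le_rfl
        obtain ⟨mu, hmu⟩ := exists_word_eq hmono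
        rw [← hmu, apply_tensorBasis]
        refine Finset.sum_eq_zero fun j _ => ?_
        rw [coef_word_eq_zero hq hf (fun lam d hd => h0 lam mu d hd), zero_smul]
      · obtain ⟨k, _, hk⟩ := exists_descent_of_not_increasing
          (c := fun _ : Fin r => ()) (fun _ _ _ => le_rfl) hx
        -- At a descent `v_i` is, up to sign, the image under `𝒯_{s_k}` of the lexicographically
        -- smaller `v_{i s_k}`, so linearity over the Hecke algebra reduces to sorted source words.
        have h1 : f (tensorBasis R m n r (ofLex x ∘ simpleRefl k)) = 0 :=
          ih _ (comp_simpleRefl_lt hk)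
        have h2 := LinearMap.congr_fun ((mem_schurAlgebra_iff q).1 hf k)
          (tensorBasis R m n r (ofLex x ∘ simpleRefl k))
        rw [Module.End.mul_apply, Module.End.mul_apply, h1, map_zero, genOp_apply_of_lt, map_smul,
          comp_simpleRefl_twice] at h2
        · have h3 := congrArg
            (paritySign R (ofLex x (simpleRefl k k.fst)) (ofLex x (simpleRefl k k.snd)) • ·) h2
          simp only [smul_zero, Function.comp_apply, smul_smul, paritySign_sq, one_smul] at h3
          exact h3.symm
        · simpa only [Function.comp_apply, simpleRefl_fst, simpleRefl_snd] using hk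
  exact (tensorBasis R m n r).ext fun i => key (toLex i)

end Schur

/-! ### Full traces -/

section Trace

variable (q : Rˣ)

/-- The sum `∑_{w ∈ W} 𝒯_{w⁻¹} b 𝒯_w`. -/
noncomputable def fullTrace (b : Module.End R (TensorSpace R m n r)) :
    Module.End R (TensorSpace R m n r) :=
  ∑ w : W r, opT q m n w * b * opT q m n w⁻¹

/-- In the commutator with `g` the terms of `w` and `w s_k` cancel by the quadratic relation; the
remaining hypotheses express one of them through the other. -/
theorem sum_conj_comm {A : Type*} [Ring A] [Algebra R A] {c : R} {g : A} (b : A) {x y : W r → A}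
    (hg : g * g = c • g + 1) {k : Simple r}
    (hx : ∀ w : W r, w k.fst < w k.snd → x (w * simpleRefl k) = g * x w)
    (hy : ∀ w : W r, w k.fst < w k.snd → y (w * simpleRefl k) = y w * g) :
    g * ∑ w, x w * b * y w = (∑ w, x w * b * y w) * g := by
  rw [← sub_eq_zero, Finset.mul_sum, Finset.sum_mul, ← Finset.sum_sub_distrib]
  have key : ∀ w : W r, w k.fst < w k.snd →
      (g * (x w * b * y w) - x w * b * y w * g) +
      (g * (x (w * simpleRefl k) * b * y (w * simpleRefl k)) -
        x (w * simpleRefl k) * b * y (w * simpleRefl k) * g) = 0 := by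
    intro w h
    have h1 : g * (g * x w * b * (y w * g)) = g * g * (x w * b * y w * g) := by
      simp only [mul_assoc]
    have h2 : g * x w * b * (y w * g) * g = g * (x w * b * y w) * (g * g) := by
      simp only [mul_assoc]
    rw [hx w h, hy w h, h1, h2, hg]
    simp only [add_mul, mul_add, one_mul, mul_one, smul_mul_assoc, mul_smul_comm, mul_assoc]
    abel
  refine Finset.sum_involution (fun w _ => w * simpleRefl k) ?_ ?_ (fun _ _ => Finset.mem_univ _)
    fun w _ => mul_simpleRefl_simpleRefl w k
  · intro w _
    rcases apply_fst_lt_or w k with h | h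
    · exact key w h
    · have := key (w * simpleRefl k) (by rwa [mul_simpleRefl_fst, mul_simpleRefl_snd])
      rwa [mul_simpleRefl_simpleRefl, add_comm] at this
  · intro w _ _ h
    have h1 := congrArg (fun u : W r => u k.fst) h
    simp only [mul_simpleRefl_fst] at h1
    exact k.fst_lt_snd.ne' (w.injective h1)

theorem fullTrace_mem_schurAlgebra (b : Module.End R (TensorSpace R m n r)) :
    fullTrace q b ∈ schurAlgebra q m n r :=
  (mem_schurAlgebra_iff q).2 fun k => sum_conj_comm b (genOp_quad q m n k)
    (fun _ h => opT_mul_simpleRefl q h) fun _ h => opT_inv_mul_simpleRefl q h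

theorem mul_fullTrace {f : Module.End R (TensorSpace R m n r)} (hf : f ∈ schurAlgebra q m n r)
    (b : Module.End R (TensorSpace R m n r)) : f * fullTrace q b = fullTrace q (f * b) := by
  rw [fullTrace, fullTrace, Finset.mul_sum]
  refine Finset.sum_congr rfl fun w _ => ?_
  rw [← mul_assoc, ← mul_assoc, ← mul_assoc, opT_mul_comm q hf]

theorem fullTrace_mul {f : Module.End R (TensorSpace R m n r)} (hf : f ∈ schurAlgebra q m n r)
    (b : Module.End R (TensorSpace R m n r)) : fullTrace q b * f = fullTrace q (b * f) := by
  rw [fullTrace, fullTrace, Finset.sum_mul]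
  refine Finset.sum_congr rfl fun w _ => ?_
  rw [mul_assoc _ _ f, opT_mul_comm q hf, ← mul_assoc, ← mul_assoc]

/-- The Poincaré polynomial `∑ χ_μ(w) χ_{λd}(w)` of the group `W_λ^d ∩ W_μ`. -/
noncomputable def poincare (mu lam : Comp m n r) (d : W r) : R :=
  ∑ g ∈ stabFinset (pairWord mu lam d), wordScalar q mu.word g * wordScalar q (lam.word ∘ d) g

theorem wordStab_pairWord_le {mu lam : Comp m n r} {d : W r} :
    wordStab (pairWord mu lam d) ≤ wordStab mu.word :=
  fun _ h k => (pairWord_eq_iff.1 (h k)).1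

theorem comp_of_mem_stab {mu lam : Comp m n r} {d g : W r} (h : g ∈ wordStab (pairWord mu lam d)) :
    mu.word ∘ g = mu.word ∧ (lam.word ∘ d) ∘ g = lam.word ∘ d :=
  ⟨funext fun k => (pairWord_eq_iff.1 (h k)).1, funext fun k => (pairWord_eq_iff.1 (h k)).2⟩

/-- Write `w = g x` with `g` in `W_λ^d ∩ W_μ` and `x` a shortest representative. Both `v_{i_μ}` and
`v_{i_λ d}` are eigenvectors of `𝒯_g`, so `g` contributes a product of two scalars independent of
`x`, and summing them gives `poincare`. -/
theorem fullTrace_matUnit {mu lam : Comp m n r} {d : W r} (hd : d ∈ doubleReps lam mu) :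
    fullTrace q (matUnit R mu.word (lam.word ∘ d)) =
      poincare q mu lam d • normElt q mu lam d := by
  have hc := pairWord_mono hd
  rw [fullTrace, sum_eq_sum_cosetReps hc, normElt_eq, Finset.smul_sum]
  refine Finset.sum_congr rfl fun x hx => ?_
  rw [Set.Finite.mem_toFinset] at hx
  rw [poincare, Finset.sum_smul]
  refine Finset.sum_congr rfl fun g hg => ?_
  rw [mem_stabFinset] at hg
  have hl := length_mul_of_mem_cosetReps hc hg hx
  refine coef_ext fun i j => ?_
  obtain ⟨h1, h2⟩ := comp_of_mem_stab hg
  rw [coef_smul, coef_mul_matUnit_mul, coef_mul_matUnit_mul, coef_opT_inv, coef_opT_inv,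
    opT_mul q hl, coef_mul_of_apply_eq_smul (opT_apply q (mu.le_of_mem_invSet g)),
    coef_mul_of_apply_eq_smul
      (opT_apply q (le_of_mem_invSet_of_mem_stab hd (wordStab_pairWord_le hg))), h1, h2]
  ring

/-- After the substitution of `w⁻¹` for `w`, write `w = g x`. The operator of `g` meets the source
word `i_μ` directly and that of `g⁻¹` meets the target word `i_λ d` by transposition. Both
contribute scalars, so for every `x` the sum over `g` factors as `poincare` times one coefficient.
-/
theorem poincare_dvd_coef_fullTrace {mu lam : Comp m n r} {d : W r} (hd : d ∈ doubleReps lam mu)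
    (b : Module.End R (TensorSpace R m n r)) :
    poincare q mu lam d ∣ coef (fullTrace q b) mu.word (lam.word ∘ d) := by
  have hc := pairWord_mono hd
  rw [fullTrace, ← Equiv.sum_comp (Equiv.inv (W r)), sum_eq_sum_cosetReps hc, coef_sum]
  refine Finset.dvd_sum fun x hx => ?_
  rw [Set.Finite.mem_toFinset] at hx
  rw [coef_sum, poincare]
  refine ⟨coef (opT q m n x⁻¹ * b * opT q m n x) mu.word (lam.word ∘ d), ?_⟩
  rw [Finset.sum_mul]
  refine Finset.sum_congr rfl fun g hg => ?_
  rw [mem_stabFinset] at hg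
  have hl := length_mul_of_mem_cosetReps hc hg hx
  have hl' : length (x⁻¹ * g⁻¹) = length x⁻¹ + length g⁻¹ := by
    rw [← mul_inv_rev, length_inv, length_inv, length_inv, hl, add_comm]
  obtain ⟨h1, h2⟩ := comp_of_mem_stab hg
  rw [Equiv.inv_apply, inv_inv, mul_inv_rev, opT_mul q hl', opT_mul q hl,
    show opT q m n g⁻¹ * opT q m n x⁻¹ * b * (opT q m n x * opT q m n g) =
      opT q m n g⁻¹ * (opT q m n x⁻¹ * b * opT q m n x) * opT q m n g by simp only [mul_assoc],
    coef_mul_of_apply_eq_smul (opT_apply q (mu.le_of_mem_invSet g)), h1, coef_mul]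
  simp only [coef_opT_inv,
    coef_opT_eq q (le_of_mem_invSet_of_mem_stab hd (wordStab_pairWord_le hg)), h2]
  simp only [mul_ite, mul_zero, Finset.sum_ite_eq', Finset.mem_univ, if_true]
  ring

end Trace

/-! ### Poincaré polynomials of Young subgroups -/

section Poincare

variable {R : Type*} [CommRing R]

/-- The number `1 + t + ⋯ + t ^ (n - 1)`. -/
def qNat (t : R) (n : ℕ) : R := ∑ k ∈ Finset.range n, t ^ k

/-- The factorial of `n` in terms of the numbers `1 + t + ⋯ + t ^ (j - 1)`. -/
def qFactorial (t : R) (n : ℕ) : R := ∏ j ∈ Finset.range n, qNat t (j + 1)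

theorem qFactorial_succ (t : R) (n : ℕ) :
    qFactorial t (n + 1) = qFactorial t n * qNat t (n + 1) :=
  Finset.prod_range_succ _ n

/-- The product of `t (c a)` over all places `a` and all inversions `a < b`, `σ b < σ a`. -/
def invProd {ι : Type*} {r : ℕ} (t : ι → R) (c : Fin r → ι) (σ : W r) : R :=
  ∏ b, ∏ a, if a < b ∧ σ b < σ a then t (c a) else 1

/-- The permutation that sends `p` to `0` and acts on the other places like `τ`. -/
def insertPerm {r : ℕ} (p : Fin (r + 1)) (τ : W r) : W (r + 1) :=
  ((finSuccEquiv' p).trans (Equiv.optionCongr τ)).trans (finSuccEquiv' 0).symm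

theorem insertPerm_self {r : ℕ} (p : Fin (r + 1)) (τ : W r) : insertPerm p τ p = 0 := by
  simp [insertPerm]

theorem insertPerm_succAbove {r : ℕ} (p : Fin (r + 1)) (τ : W r) (i : Fin r) :
    insertPerm p τ (p.succAbove i) = (τ i).succ := by
  simp [insertPerm]

theorem insertPerm_bijective (r : ℕ) :
    Function.Bijective fun x : Fin (r + 1) × W r => insertPerm x.1 x.2 := by
  rw [Fintype.bijective_iff_injective_and_card]
  constructor
  · rintro ⟨p, τ⟩ ⟨p', τ'⟩ h
    have h : insertPerm p τ = insertPerm p' τ' := h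
    have hp : p = p' := by
      apply (insertPerm p' τ').injective
      rw [insertPerm_self, ← h, insertPerm_self]
    subst hp
    refine Prod.ext rfl (Equiv.ext fun i => Fin.succ_injective _ ?_)
    rw [← insertPerm_succAbove p, ← insertPerm_succAbove p, h]
  · simp [Fintype.card_perm, Nat.factorial_succ]

/-- Deleting any place of the first block leaves the same word as deleting the place `0`. -/
theorem comp_succAbove_of_eq {ι : Type*} [LinearOrder ι] {r : ℕ} {c : Fin (r + 1) → ι}
    (hc : Monotone c) {p : Fin (r + 1)} (hp : c p = c 0) (i : Fin r) :
    c (p.succAbove i) = c i.succ := by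
  rcases lt_or_ge i.castSucc p with h | h
  · rw [Fin.succAbove_of_castSucc_lt _ _ h]
    have h1 : c i.succ ≤ c p := hc (Fin.le_def.2 (Fin.lt_def.1 h))
    refine le_antisymm (hc Fin.castSucc_lt_succ.le) (h1.trans ?_)
    rw [hp]
    exact hc (Fin.zero_le _)
  · rw [Fin.succAbove_of_le_castSucc _ _ h]

theorem insertPerm_mem_wordStab {ι : Type*} [LinearOrder ι] {r : ℕ} {c : Fin (r + 1) → ι}
    (hc : Monotone c) {p : Fin (r + 1)} {τ : W r} :
    insertPerm p τ ∈ wordStab c ↔ c p = c 0 ∧ τ ∈ wordStab fun i : Fin r => c i.succ := by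
  rw [mem_wordStab, Fin.forall_iff_succAbove p, insertPerm_self, eq_comm]
  refine and_congr_right fun hp => forall_congr' fun i => ?_
  rw [insertPerm_succAbove, comp_succAbove_of_eq hc hp]

/-- The place `p` receives the least value, so it forms an inversion with each of the `p` places
before it, all in the first block, and with none after it. -/
theorem invProd_insertPerm {ι : Type*} [LinearOrder ι] {r : ℕ} {c : Fin (r + 1) → ι}
    (hc : Monotone c) (t : ι → R) {p : Fin (r + 1)} (hp : c p = c 0) (τ : W r) :
    invProd t c (insertPerm p τ) = t (c 0) ^ (p : ℕ) * invProd t (fun i : Fin r => c i.succ) τ := by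
  rw [invProd, Fin.prod_univ_succAbove _ p, invProd]
  congr 1
  · have : ∀ a, (if a < p ∧ insertPerm p τ p < insertPerm p τ a then t (c a) else 1) =
        if a < p then t (c 0) else 1 := by
      intro a
      by_cases ha : a < p
      · have h1 : insertPerm p τ p < insertPerm p τ a := by
          rw [insertPerm_self, Fin.pos_iff_ne_zero, ← insertPerm_self p τ]
          exact fun h => ha.ne ((insertPerm p τ).injective h)
        rw [if_pos ⟨ha, h1⟩, if_pos ha, le_antisymm (hp ▸ hc ha.le) (hc (Fin.zero_le a))]
      · rw [if_neg fun h => ha h.1, if_neg ha]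
    rw [Finset.prod_congr rfl fun a _ => this a, Finset.prod_ite, Finset.prod_const,
      Finset.prod_const_one, mul_one]
    congr 1
    rw [← Fin.card_Iio p]
    congr 1
    ext a
    simp
  · refine Finset.prod_congr rfl fun b _ => ?_
    rw [Fin.prod_univ_succAbove _ p, if_neg, one_mul]
    · refine Finset.prod_congr rfl fun a _ => ?_
      simp only [insertPerm_succAbove, Fin.succAbove_lt_succAbove_iff, Fin.succ_lt_succ_iff,
        comp_succAbove_of_eq hc hp]
    · rw [insertPerm_self]
      exact fun h => Fin.not_lt_zero _ h.2

/-- The first block is an initial segment, so `p` runs through `0, 1, …` up to its size. -/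
theorem sum_range_card_fiber_zero {ι : Type*} [LinearOrder ι] {r : ℕ} {c : Fin (r + 1) → ι}
    (hc : Monotone c) (t : R) :
    ∑ p ∈ Finset.univ.filter (fun p => c p = c 0), t ^ (p : ℕ) =
      qNat t ((Finset.univ.filter fun p => c p = c 0).card) := by
  have h0 : ∀ a, c a = c 0 ↔ c a ≤ c 0 :=
    fun a => ⟨fun h => h.le, fun h => le_antisymm h (hc (Fin.zero_le a))⟩
  have h1 : ∀ p : Fin (r + 1), (p : ℕ) < (Finset.univ.filter fun p => c p = c 0).card ↔
      c p = c 0 := by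
    intro p
    have := Tuple.lt_card_le_iff_apply_le_of_monotone (j := p) (a := c 0) hc
    simp only [h0]
    exact this
  have h2 : (Finset.univ.filter fun p => c p = c 0).card ≤ r + 1 := by
    simpa using Finset.card_le_univ (Finset.univ.filter fun p => c p = c 0)
  rw [qNat]
  refine Finset.sum_bij (fun p _ => p.1) ?_ (fun _ _ _ _ h => Fin.ext h) ?_ fun _ _ => rfl
  · intro p hp
    rw [Finset.mem_range, h1]
    exact (Finset.mem_filter.1 hp).2
  · intro k hk
    rw [Finset.mem_range] at hk
    refine ⟨⟨k, by omega⟩, ?_, rfl⟩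
    rw [Finset.mem_filter, ← h1]
    exact ⟨Finset.mem_univ _, hk⟩

theorem card_fiber_succ {ι : Type*} [DecidableEq ι] {r : ℕ} (c : Fin (r + 1) → ι) (i : ι) :
    (Finset.univ.filter fun p => c p = i).card =
      (Finset.univ.filter fun p : Fin r => c p.succ = i).card + if c 0 = i then 1 else 0 := by
  simp only [Finset.card_filter, Fin.sum_univ_succ]
  exact add_comm _ _

/-- The generating function of the inversions in a Young subgroup is a product of factorials. -/
theorem sum_invProd {ι : Type*} [LinearOrder ι] [Fintype ι] (t : ι → R) {r : ℕ} {c : Fin r → ι}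
    (hc : Monotone c) :
    ∑ σ ∈ stabFinset c, invProd t c σ =
      ∏ i, qFactorial (t i) (Finset.univ.filter fun p => c p = i).card := by
  induction r with
  | zero =>
    have : stabFinset c = {1} := by
      ext w
      simp only [mem_stabFinset, Finset.mem_singleton]
      exact ⟨fun _ => Subsingleton.elim _ _, fun h => h ▸ one_mem _⟩
    simp [this, invProd, qFactorial]
  | succ r ih =>
    have hc' : Monotone fun i : Fin r => c i.succ := fun a b h => hc (Fin.succ_le_succ_iff.2 h)
    -- Permutations are sorted by the place `p` that they send to `0`; in the stabiliser `p` ranges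
    -- over the first block.
    have h1 : ∑ σ ∈ stabFinset c, invProd t c σ =
        ∑ x ∈ (Finset.univ.filter fun p => c p = c 0) ×ˢ stabFinset (fun i : Fin r => c i.succ),
          t (c 0) ^ (x.1 : ℕ) * invProd t (fun i : Fin r => c i.succ) x.2 := by
      symm
      refine Finset.sum_bij (fun x _ => insertPerm x.1 x.2) ?_
        (fun _ _ _ _ h => (insertPerm_bijective r).1 h) ?_ ?_
      · rintro ⟨p, τ⟩ hx
        rw [Finset.mem_product, Finset.mem_filter, mem_stabFinset] at hx
        exact mem_stabFinset.2 ((insertPerm_mem_wordStab hc).2 ⟨hx.1.2, hx.2⟩)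
      · intro σ hσ
        obtain ⟨⟨p, τ⟩, rfl⟩ := (insertPerm_bijective r).2 σ
        rw [mem_stabFinset, insertPerm_mem_wordStab hc] at hσ
        refine ⟨(p, τ), ?_, rfl⟩
        rw [Finset.mem_product, Finset.mem_filter, mem_stabFinset]
        exact ⟨⟨Finset.mem_univ _, hσ.1⟩, hσ.2⟩
      · rintro ⟨p, τ⟩ hx
        rw [Finset.mem_product, Finset.mem_filter] at hx
        exact (invProd_insertPerm hc t hx.1.2 τ).symm
    rw [h1, Finset.sum_product]
    dsimp only
    rw [← Finset.sum_mul_sum, ih hc', sum_range_card_fiber_zero hc,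
      ← Finset.mul_prod_erase _ _ (Finset.mem_univ (c 0)),
      ← Finset.mul_prod_erase _ (fun i => qFactorial (t i) _) (Finset.mem_univ (c 0)), ← mul_assoc]
    congr 1
    · rw [card_fiber_succ c, if_pos rfl, qFactorial_succ, mul_comm]
    · refine Finset.prod_congr rfl fun i hi => ?_
      rw [card_fiber_succ c, if_neg (Finset.ne_of_mem_erase hi).symm, add_zero]

/-! ### Poincaré polynomials as products of factorials -/

variable {m n r : ℕ} (q : Rˣ)

/-- Each inversion lies in one fibre of the pair word, where membership in `𝒟°` makes the two
letters of the pair equal in parity; the two eigenvalues then agree and give a square. The inverse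
appears because `invSet` uses `w⁻¹` whereas `invProd` uses `σ`. -/
theorem wordScalar_mul_wordScalar {mu lam : Comp m n r} {d : W r} (hd : d ∈ superReps lam mu)
    {g : W r} (hg : g ∈ wordStab (pairWord mu lam d)) :
    wordScalar q mu.word g⁻¹ * wordScalar q (lam.word ∘ d) g⁻¹ =
      invProd (fun x => diagFactor q (ofLex x).1 ^ 2) (pairWord mu lam d) g := by
  rw [mem_superReps] at hd
  have hinv : ∏ p ∈ invSet g⁻¹, diagFactor q (mu.word p.1) ^ 2 =
      invProd (fun x => diagFactor q (ofLex x).1 ^ 2) (pairWord mu lam d) g := by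
    rw [invProd, invSet, Finset.prod_filter, Fintype.prod_prod_type_right, inv_inv]
    rfl
  rw [← hinv, wordScalar, wordScalar, ← Finset.prod_mul_distrib]
  refine Finset.prod_congr rfl fun p hp => ?_
  have h1 := eq_of_mem_invSet (pairWord_mono hd.1) (inv_mem hg) hp
  have h2 := hd.2 p.1 p.2 (mem_invSet.1 hp).1.ne h1
  rw [pairWord_eq_iff] at h1
  rw [pairScalar, pairScalar, if_pos h1.1, if_pos
    (show (lam.word ∘ d) p.1 = (lam.word ∘ d) p.2 from h1.2), sq]
  congr 1
  simp only [diagFactor, Function.comp_apply, h2]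

theorem poincare_eq {mu lam : Comp m n r} {d : W r} (hd : d ∈ superReps lam mu) :
    poincare q mu lam d = ∏ i, ∏ j, qFactorial (diagFactor q i ^ 2)
      (Finset.univ.filter fun k : Fin r => mu.word k = i ∧ lam.word (d k) = j).card := by
  have h1 : poincare q mu lam d = ∑ g ∈ stabFinset (pairWord mu lam d),
      invProd (fun x => diagFactor q (ofLex x).1 ^ 2) (pairWord mu lam d) g := by
    rw [poincare]
    refine Finset.sum_bij' (fun g _ => g⁻¹) (fun g _ => g⁻¹) ?_ ?_ ?_ ?_ ?_
    · exact fun g hg => mem_stabFinset.2 (inv_mem (mem_stabFinset.1 hg))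
    · exact fun g hg => mem_stabFinset.2 (inv_mem (mem_stabFinset.1 hg))
    · exact fun g _ => inv_inv g
    · exact fun g _ => inv_inv g
    · intro g hg
      rw [← wordScalar_mul_wordScalar q hd (inv_mem (mem_stabFinset.1 hg)), inv_inv]
  rw [h1, sum_invProd _ (pairWord_mono hd.1), ← Equiv.prod_comp toLex, Fintype.prod_prod_type]
  refine Finset.prod_congr rfl fun i _ => Finset.prod_congr rfl fun j _ => ?_
  congr 2
  ext k
  simp only [Finset.mem_filter, pairWord, EmbeddingLike.apply_eq_iff_eq, Prod.mk.injEq]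

end Poincare

/-! ### Vanishing of Poincaré polynomials at roots of unity -/

section Vanishing

variable {D K : Type*} [CommRing D] [CommRing K] {ψ : D →+* K} {l : ℕ} {t : D}

/-- The number of parts `l` of the composition of the maximal `l`-parabolic subgroup of
`W_λ^d ∩ W_μ`. -/
def defectRank {m n r : ℕ} (l : ℕ) (lam : Comp m n r) (d : W r) (mu : Comp m n r) : ℕ :=
  ∑ i, ∑ j, (Finset.univ.filter fun k : Fin r => mu.word k = i ∧ lam.word (d k) = j).card / l

theorem qNat_mul (t : D) (a b : ℕ) : qNat t (a * b) = qNat t a * qNat (t ^ a) b := by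
  induction b with
  | zero => simp [qNat]
  | succ b ih =>
    have h1 : qNat t (a * b + a) = qNat t (a * b) + ∑ k ∈ Finset.range a, t ^ (a * b + k) :=
      Finset.sum_range_add _ _ _
    have h2 : qNat (t ^ a) (b + 1) = qNat (t ^ a) b + (t ^ a) ^ b := Finset.sum_range_succ _ _
    rw [Nat.mul_succ, h1, h2, ih, mul_add]
    congr 1
    rw [qNat, Finset.sum_mul]
    refine Finset.sum_congr rfl fun k _ => ?_
    rw [pow_add, pow_mul, mul_comm]

theorem map_qNat_ne_zero (ht : IsPrimitiveRoot (ψ t) l) {N : ℕ} (hN : ¬l ∣ N) :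
    ψ (qNat t N) ≠ 0 := by
  intro h
  have h1 := geom_sum_mul (ψ t) N
  rw [qNat, map_sum] at h
  simp only [map_pow] at h
  rw [h, zero_mul] at h1
  exact hN (ht.dvd_of_pow_eq_one N (sub_eq_zero.1 h1.symm))

/-- Reversing the order of summation gives the factor `x⁻¹ ^ (l - 1)`. It lets odd letters, for
which `q⁻²` replaces `q²`, be treated with the same `[l]`. -/
theorem exists_qNat_inv_eq (x : Dˣ) (l : ℕ) :
    ∃ u : Dˣ, qNat (↑x⁻¹ : D) l = qNat (x : D) l * u := by
  refine ⟨x⁻¹ ^ (l - 1), ?_⟩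
  rw [qNat, qNat, ← Finset.sum_range_reflect, Finset.sum_mul]
  refine Finset.sum_congr rfl fun k hk => ?_
  rw [Finset.mem_range] at hk
  have h : l - 1 = k + (l - 1 - k) := by omega
  rw [← Units.val_pow_eq_pow_val, ← Units.val_pow_eq_pow_val, ← Units.val_mul]
  conv_rhs => rw [h]
  rw [pow_add, ← mul_assoc, ← mul_pow, mul_inv_cancel, one_pow, one_mul]

theorem exists_prod_eq [IsDomain K] {ι : Type*} (s : Finset ι) {f : ι → D} {e : ι → ℕ} {π : D}
    (h : ∀ i, ∃ u : D, ψ u ≠ 0 ∧ f i = π ^ e i * u) :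
    ∃ u : D, ψ u ≠ 0 ∧ ∏ i ∈ s, f i = π ^ (∑ i ∈ s, e i) * u := by
  choose u hu hf using h
  refine ⟨∏ i ∈ s, u i, ?_, ?_⟩
  · rw [map_prod]
    exact Finset.prod_ne_zero_iff.2 fun i _ => hu i
  · rw [Finset.prod_congr rfl fun i _ => hf i, Finset.prod_mul_distrib, Finset.prod_pow_eq_pow_sum]

variable [CharZero K]

/-- If `N + 1 = l b`, then `qNat t (N + 1)` is `qNat t l` times `qNat (t ^ l) b`, and the second
factor maps to the integer `b`, nonzero in characteristic zero. -/
theorem exists_qNat_eq (ht : IsPrimitiveRoot (ψ t) l) (N : ℕ) :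
    ∃ u : D, ψ u ≠ 0 ∧ qNat t (N + 1) = qNat t l ^ (if l ∣ N + 1 then 1 else 0) * u := by
  split_ifs with h
  · obtain ⟨b, hb⟩ := h
    refine ⟨qNat (t ^ l) b, ?_, by rw [hb, qNat_mul, pow_one]⟩
    rw [qNat, map_sum]
    simp only [map_pow, ht.pow_eq_one, one_pow, Finset.sum_const, Finset.card_range, nsmul_eq_mul,
      mul_one, ne_eq, Nat.cast_eq_zero]
    rintro rfl
    omega
  · exact ⟨_, map_qNat_ne_zero ht h, by rw [pow_zero, one_mul]⟩

variable [IsDomain K]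

/-- Exactly `N / l` of the numbers `1, …, N` are multiples of `l`, and each contributes one factor
`qNat t l`. -/
theorem exists_qFactorial_eq (ht : IsPrimitiveRoot (ψ t) l) (N : ℕ) :
    ∃ u : D, ψ u ≠ 0 ∧ qFactorial t N = qNat t l ^ (N / l) * u := by
  induction N with
  | zero => exact ⟨1, by simp, by simp [qFactorial]⟩
  | succ N ih =>
    obtain ⟨u, hu, h1⟩ := ih
    obtain ⟨v, hv, h2⟩ := exists_qNat_eq ht N
    refine ⟨u * v, by rw [map_mul]; exact mul_ne_zero hu hv, ?_⟩
    rw [qFactorial_succ, h1, h2, Nat.succ_div, pow_add]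
    ring

variable {m n r : ℕ} {q : Dˣ}

theorem exists_qFactorial_diagFactor_eq (hq : IsPrimitiveRoot (ψ ((q : D) ^ 2)) l)
    (i : Fin (m + n)) (N : ℕ) :
    ∃ u : D, ψ u ≠ 0 ∧ qFactorial (diagFactor q i ^ 2) N = qNat ((q : D) ^ 2) l ^ (N / l) * u := by
  by_cases hi : i.1 < m
  · rw [diagFactor, if_pos hi]
    exact exists_qFactorial_eq hq N
  · have h1 : diagFactor q i ^ 2 = (↑(q ^ 2)⁻¹ : D) := by
      rw [diagFactor, if_neg hi, neg_sq, ← Units.val_pow_eq_pow_val, inv_pow]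
    have h2 : IsPrimitiveRoot (ψ (↑(q ^ 2)⁻¹ : D)) l := by
      have h3 : ψ (q ^ 2 : Dˣ) * ψ (↑(q ^ 2)⁻¹ : D) = 1 := by
        rw [← map_mul, Units.mul_inv, map_one]
      have h4 : IsPrimitiveRoot (Units.map ψ.toMonoidHom (q ^ 2)) l := by
        rw [← IsPrimitiveRoot.coe_units_iff]
        simpa using hq
      rw [← IsPrimitiveRoot.inv_iff, ← IsPrimitiveRoot.coe_units_iff, ← map_inv] at h4
      exact h4
    obtain ⟨u, hu, h3⟩ := exists_qFactorial_eq h2 N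
    obtain ⟨v, hv⟩ := exists_qNat_inv_eq (q ^ 2) l
    refine ⟨(v : D) ^ (N / l) * u, ?_, ?_⟩
    · rw [map_mul, map_pow]
      exact mul_ne_zero (pow_ne_zero _ (v.isUnit.map ψ).ne_zero) hu
    · rw [h1, h3, hv, mul_pow, mul_assoc, Units.val_pow_eq_pow_val]

theorem exists_poincare_eq (hq : IsPrimitiveRoot (ψ ((q : D) ^ 2)) l) {mu lam : Comp m n r}
    {d : W r} (hd : d ∈ superReps lam mu) :
    ∃ u : D, ψ u ≠ 0 ∧
      poincare q mu lam d = qNat ((q : D) ^ 2) l ^ defectRank l lam d mu * u := by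
  rw [poincare_eq q hd]
  exact exists_prod_eq _ fun i => exists_prod_eq _ fun j => exists_qFactorial_diagFactor_eq hq i _

end Vanishing

/-! ### Parabolic subgroups up to conjugation -/

section LeW

variable {r : ℕ}

/-- Numbering the letters that occur in increasing order turns `c` into the block function of the
composition of its multiplicities. -/
theorem isParabolic_wordStab {ι : Type*} [LinearOrder ι] {c : Fin r → ι} (hc : Monotone c) :
    IsParabolic (wordStab c) := by
  let s := Finset.univ.image c
  let e : Fin s.card ≃o s := s.orderIsoOfFin rfl
  let c' : Fin r → Fin s.card := fun k =>
    e.symm ⟨c k, Finset.mem_image_of_mem c (Finset.mem_univ k)⟩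
  have hc' : Monotone c' := fun a b h => e.symm.monotone (hc h)
  have heq : ∀ a b, c' a = c' b ↔ c a = c b := fun a b => by simp [c']
  refine ⟨List.ofFn fun j => (Finset.univ.filter fun a => c' a = j).card, ?_, ?_⟩
  · rw [List.sum_ofFn, sum_card_fiber]
  · ext w
    rw [young_eq_wordStab, mem_wordStab, mem_wordStab]
    simp only [blockIdx_ofFn_card hc', ← heq, Fin.val_inj]

theorem young_mono_of_blockIdx {α β : List ℕ}
    (h : ∀ x y, x < r → y < r → blockIdx α x = blockIdx α y → blockIdx β x = blockIdx β y) :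
    young r α ≤ young r β :=
  fun w hw k => h _ _ (w k).2 k.2 (hw k)

/-- If a conjugate of a Young subgroup is contained in a Young subgroup `H`, then some conjugate
of it is parabolic and contained in `H`. -/
theorem leW_of_conjBy_le {α β : List ℕ} {x : W r} (h : conjBy (young r α) x ≤ young r β) :
    LeW (young r α) (young r β) := by
  rw [young_eq_wordStab, conjBy_wordStab] at h
  let f : Fin r → ℕ := (fun k : Fin r => blockIdx α k) ∘ x
  let g : Fin r → ℕ := fun k => blockIdx β k
  have hg : Monotone g := fun a b hab => blockIdx_mono β hab
  let F : Fin r → ℕ ×ₗ ℕ := fun k => toLex (g k, f k)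
  -- The places are sorted by their block in `β` first and by their letter in `f` second.
  obtain ⟨z, hz⟩ : ∃ z : W r, Monotone (F ∘ z) := ⟨Tuple.sort F, Tuple.monotone_sort F⟩
  have hgz' : Monotone (g ∘ z) := by
    intro a b hab
    rcases Prod.Lex.toLex_le_toLex.1 (hz hab) with h1 | h1
    · exact h1.le
    · exact h1.1.le
  -- The blocks of `β` are already in order, so the sorting permutes places only within them: `z`
  -- lies in `young r β`, and conjugation by it preserves the inclusion.
  have hgz : g ∘ z = g := Tuple.unique_monotone (σ := z) (τ := 1) hgz' hg
  have h1 : conjBy (young r α) (x * z) = wordStab (f ∘ z) := by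
    rw [young_eq_wordStab, ← conjBy_mul, conjBy_wordStab, conjBy_wordStab]
  have h2 : wordStab (f ∘ z) ≤ wordStab g := by
    have h2 := conjBy_mono h z
    rw [young_eq_wordStab, conjBy_wordStab, conjBy_wordStab,
      show (fun k : Fin r => blockIdx β k) ∘ z = g from hgz] at h2
    exact h2
  -- By the inclusion, the stabiliser of `f ∘ z` respects the blocks of `β` as well, so it is the
  -- stabiliser of the monotone word `F ∘ z`.
  have h3 : wordStab (f ∘ z) = wordStab (F ∘ z) := by
    refine le_antisymm (fun w hw k => ?_) fun w hw k => congrArg (fun p => (ofLex p).2) (hw k)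
    have h4 : g (w k) = g k := h2 hw k
    have h5 : ∀ a, g (z a) = g a := congrFun hgz
    exact congrArg toLex (Prod.ext ((h5 _).trans (h4.trans (h5 _).symm)) (hw k))
  refine ⟨x * z, ?_, ?_⟩
  · rw [h1]
    exact h2
  · rw [h1, h3]
    exact isParabolic_wordStab hz

theorem leW_trans {α β γ : List ℕ} (h1 : LeW (young r α) (young r β))
    (h2 : LeW (young r β) (young r γ)) : LeW (young r α) (young r γ) := by
  obtain ⟨x, hx, _⟩ := h1
  obtain ⟨y, hy, _⟩ := h2
  refine leW_of_conjBy_le (x := x * y) ?_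
  rw [← conjBy_mul]
  exact (conjBy_mono hx y).trans hy

/-! ### Young subgroups of compositions with parts `1` and `l` -/

theorem card_getElem_eq (α : List ℕ) (a : ℕ) :
    (Finset.univ.filter fun i : Fin α.length => α[i] = a).card = α.count a := by
  induction α with
  | nil => simp
  | cons b α ih =>
    rw [List.count_cons, ← ih, Finset.card_filter, Finset.card_filter]
    refine (Fin.sum_univ_succ _).trans ?_
    rw [add_comm]
    by_cases h : b = a <;> simp [h]

/-- Equal parts are matched first, then the places of matched blocks; the resulting permutation of
the places carries blocks to blocks and conjugates one stabiliser into the other. -/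
theorem exists_conjBy_eq_of_perm {α β : List ℕ} (hα : α.sum = r) (hβ : β.sum = r)
    (h : α.Perm β) : ∃ x : W r, conjBy (young r β) x = young r α := by
  have h1 : ∀ a, Nonempty ({i : Fin α.length // α[i] = a} ≃ {i : Fin β.length // β[i] = a}) := by
    intro a
    refine ⟨Fintype.equivOfCardEq ?_⟩
    rw [Fintype.card_subtype, Fintype.card_subtype, card_getElem_eq, card_getElem_eq,
      h.count_eq]
  let s : Fin α.length ≃ Fin β.length := Equiv.ofFiberEquiv fun a => (h1 a).some
  have hs : ∀ i, β[s i] = α[i] := Equiv.ofFiberEquiv_map fun a => (h1 a).some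
  let f : Fin r → Fin α.length := fun k => ⟨blockIdx α k, blockIdx_lt α k (hα.symm ▸ k.2)⟩
  let g : Fin r → Fin β.length := fun k => ⟨blockIdx β k, blockIdx_lt β k (hβ.symm ▸ k.2)⟩
  have hf : ∀ i, (Finset.univ.filter fun k => f k = i).card = α[i] := by
    intro i
    refine Eq.trans ?_ (card_blockIdx_eq hα i.2)
    congr 1
    ext k
    rw [Finset.mem_filter, Finset.mem_filter]
    exact and_congr_right fun _ => Fin.ext_iff
  have hg : ∀ i, (Finset.univ.filter fun k => g k = i).card = β[i] := by
    intro i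
    refine Eq.trans ?_ (card_blockIdx_eq hβ i.2)
    congr 1
    ext k
    rw [Finset.mem_filter, Finset.mem_filter]
    exact and_congr_right fun _ => Fin.ext_iff
  have h2 : ∀ i, Nonempty ({k : Fin r // s (f k) = i} ≃ {k : Fin r // g k = i}) := by
    intro i
    refine ⟨Fintype.equivOfCardEq ?_⟩
    rw [Fintype.card_subtype, Fintype.card_subtype, hg]
    obtain ⟨i, rfl⟩ := s.surjective i
    simp only [EmbeddingLike.apply_eq_iff_eq]
    rw [hs, hf]
  let x : W r := Equiv.ofFiberEquiv fun i => (h2 i).some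
  have hx : ∀ k, g (x k) = s (f k) := Equiv.ofFiberEquiv_map fun i => (h2 i).some
  refine ⟨x, ?_⟩
  have h3 : young r β = wordStab g := by
    ext w
    exact forall_congr' fun k => (Fin.ext_iff (a := g (w k)) (b := g k)).symm
  have h4 : young r α = wordStab f := by
    ext w
    exact forall_congr' fun k => (Fin.ext_iff (a := f (w k)) (b := f k)).symm
  rw [h3, h4, conjBy_wordStab]
  ext w
  simp only [mem_wordStab, Function.comp_apply, hx, EmbeddingLike.apply_eq_iff_eq]

theorem sum_eq_count_add {l : ℕ} (hl : l ≠ 1) {α : List ℕ} (h : ∀ a ∈ α, a = 1 ∨ a = l) :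
    α.sum = α.count 1 + α.count l * l := by
  induction α with
  | nil => simp
  | cons a α ih =>
    rw [List.sum_cons, ih fun b hb => h b (List.mem_cons_of_mem _ hb), List.count_cons,
      List.count_cons]
    rcases h a List.mem_cons_self with rfl | rfl
    · rw [if_pos (by simp), if_neg (by simpa using hl.symm)]; ring
    · rw [if_neg (by simpa using hl), if_pos (by simp)]; ring

theorem perm_replicate_append {l : ℕ} (hl : l ≠ 1) {α : List ℕ} (h : ∀ a ∈ α, a = 1 ∨ a = l) :
    α.Perm (List.replicate (α.count 1) 1 ++ List.replicate (α.count l) l) := by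
  rw [List.perm_iff_count]
  intro a
  rw [List.count_append, List.count_replicate, List.count_replicate]
  by_cases h1 : a = 1
  · subst h1
    simp [hl]
  by_cases h2 : a = l
  · subst h2
    simp [hl.symm]
  · rw [List.count_eq_zero_of_not_mem fun ha => (h a ha).elim h1 h2]
    simp [Ne.symm h1, Ne.symm h2]

theorem blockIdx_replicate_append (a : ℕ) (α : List ℕ) (x : ℕ) :
    blockIdx (List.replicate a 1 ++ α) x = if x < a then x else a + blockIdx α (x - a) := by
  induction a generalizing x with
  | zero => simp
  | succ a ih =>
    rw [List.replicate_succ, List.cons_append, blockIdx, ih]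
    split_ifs with h1 h2 h3 h4 h5
    · omega
    · omega
    · omega
    · omega
    · omega
    · rw [Nat.sub_sub, add_comm 1 a]; omega

/-- The `l` singleton blocks at the places `a, …, a + l - 1` are merged into one block. -/
theorem young_replicate_le (a l k : ℕ) :
    young r (List.replicate (a + l) 1 ++ List.replicate k l) ≤
      young r (List.replicate a 1 ++ List.replicate (k + 1) l) := by
  refine young_mono_of_blockIdx fun x y _ _ h => ?_
  simp only [blockIdx_replicate_append, List.replicate_succ, blockIdx, Nat.sub_sub] at h ⊢
  split_ifs at h ⊢ <;> omega

theorem young_replicate_mono (l : ℕ) {k k' : ℕ} (h : k ≤ k') (hr : k' * l ≤ r) :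
    young r (List.replicate (r - k * l) 1 ++ List.replicate k l) ≤
      young r (List.replicate (r - k' * l) 1 ++ List.replicate k' l) := by
  induction k', h using Nat.le_induction with
  | base => exact le_rfl
  | succ k' _ ih =>
    rw [Nat.succ_mul] at hr
    refine (ih (by omega)).trans ?_
    rw [show r - k' * l = r - (k' + 1) * l + l by rw [Nat.succ_mul]; omega]
    exact young_replicate_le _ _ _

/-- Among the compositions with parts `1` and `l`, the relation `≤_W` compares the numbers of
parts `l`. -/
theorem leW_of_count_le {l : ℕ} {α β : List ℕ} (hα : α.sum = r) (hβ : β.sum = r)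
    (h1 : ∀ a ∈ α, a = 1 ∨ a = l) (h2 : ∀ a ∈ β, a = 1 ∨ a = l)
    (h : l ≠ 1 → α.count l ≤ β.count l) : LeW (young r α) (young r β) := by
  -- For `l = 1` both compositions consist of ones and the groups coincide, so no comparison of
  -- counts is needed.
  by_cases hl : l = 1
  · subst hl
    simp only [or_self] at h1 h2
    have e : ∀ γ : List ℕ, γ.sum = r → (∀ a ∈ γ, a = 1) → γ = List.replicate r 1 := by
      intro γ hγ hγ'
      rw [List.eq_replicate_of_mem hγ'] at hγ
      rw [← hγ, List.eq_replicate_of_mem hγ']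
      simp
    rw [e α hα h1, e β hβ h2]
    refine leW_of_conjBy_le (x := 1) ?_
    rw [young_eq_wordStab, conjBy_wordStab]
    exact le_rfl
  · have eα := sum_eq_count_add hl h1
    have eβ := sum_eq_count_add hl h2
    have pα := perm_replicate_append hl h1
    have pβ := perm_replicate_append hl h2
    rw [show α.count 1 = r - α.count l * l by omega] at pα
    rw [show β.count 1 = r - β.count l * l by omega] at pβ
    obtain ⟨x, hx⟩ := exists_conjBy_eq_of_perm (pα.sum_eq.symm.trans hα) hα pα.symm
    obtain ⟨y, hy⟩ := exists_conjBy_eq_of_perm hβ (pβ.sum_eq.symm.trans hβ) pβ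
    refine leW_of_conjBy_le (x := x * y) ?_
    rw [← conjBy_mul, hx, ← hy]
    exact conjBy_mono (young_replicate_mono l (h hl) (by omega)) y

end LeW

/-! ### Defect groups -/

section Defect

variable {m n r : ℕ}

theorem sum_map_interComp (lam : Comp m n r) (d : W r) (mu : Comp m n r) (g : ℕ → ℕ) :
    ((interComp lam d mu).map g).sum = ∑ i, ∑ j, g (Finset.univ.filter fun k : Fin r =>
      mu.word k = i ∧ lam.word (d k) = j).card := by
  simp only [interComp, List.flatMap, List.map_flatten, List.sum_flatten, List.map_map,
    Fin.sum_univ_def, Function.comp_def]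

theorem sum_card_pair (lam : Comp m n r) (d : W r) (mu : Comp m n r) :
    ∑ i, ∑ j, (Finset.univ.filter fun k : Fin r => mu.word k = i ∧ lam.word (d k) = j).card =
      r := by
  have h : ∀ i, ∑ j, (Finset.univ.filter fun k : Fin r =>
      mu.word k = i ∧ lam.word (d k) = j).card =
        (Finset.univ.filter fun k : Fin r => mu.word k = i).card := by
    intro i
    rw [Finset.card_eq_sum_card_fiberwise (f := fun k => lam.word (d k)) (t := Finset.univ)
      fun _ _ => Finset.mem_univ _]
    simp only [Finset.filter_filter]
  simp only [h, sum_card_fiber]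

theorem sum_maxLPart (l a : ℕ) : (maxLPart l a).sum = a := by
  rw [maxLPart, List.sum_append, List.sum_replicate, List.sum_replicate, smul_eq_mul, smul_eq_mul,
    mul_one, mul_comm, Nat.div_add_mod]

theorem sum_flatMap_maxLPart (l : ℕ) (α : List ℕ) : (α.flatMap (maxLPart l)).sum = α.sum := by
  induction α with
  | nil => rfl
  | cons a α ih => rw [List.flatMap_cons, List.sum_append, ih, sum_maxLPart, List.sum_cons]

theorem count_flatMap_maxLPart {l : ℕ} (hl : l ≠ 1) (α : List ℕ) :
    (α.flatMap (maxLPart l)).count l = (α.map (· / l)).sum := by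
  induction α with
  | nil => rfl
  | cons a α ih =>
    rw [List.flatMap_cons, List.count_append, ih, List.map_cons, List.sum_cons, maxLPart,
      List.count_append, List.count_replicate, List.count_replicate]
    simp [hl.symm]

theorem eq_one_or_eq_of_mem_flatMap {l : ℕ} {α : List ℕ} :
    ∀ a ∈ α.flatMap (maxLPart l), a = 1 ∨ a = l := by
  intro a ha
  obtain ⟨b, _, hb⟩ := List.mem_flatMap.1 ha
  rw [maxLPart, List.mem_append] at hb
  rcases hb with hb | hb
  · exact Or.inr (List.eq_of_mem_replicate hb)
  · exact Or.inl (List.eq_of_mem_replicate hb)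

theorem sum_defect (l : ℕ) (lam : Comp m n r) (d : W r) (mu : Comp m n r) :
    ((interComp lam d mu).flatMap (maxLPart l)).sum = r := by
  have := sum_map_interComp lam d mu id
  rw [List.map_id] at this
  rw [sum_flatMap_maxLPart, this]
  exact sum_card_pair lam d mu

theorem count_defect {l : ℕ} (hl : l ≠ 1) (lam : Comp m n r) (d : W r) (mu : Comp m n r) :
    ((interComp lam d mu).flatMap (maxLPart l)).count l = defectRank l lam d mu := by
  rw [count_flatMap_maxLPart hl, sum_map_interComp]
  rfl

theorem leW_defectGroup {l : ℕ} {lam lam' mu mu' : Comp m n r} {d d' : W r}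
    (h : l ≠ 1 → defectRank l lam d mu ≤ defectRank l lam' d' mu') :
    LeW (defectGroup l lam d mu) (defectGroup l lam' d' mu') :=
  leW_of_count_le (sum_defect l lam d mu) (sum_defect l lam' d' mu') eq_one_or_eq_of_mem_flatMap
    eq_one_or_eq_of_mem_flatMap fun hl => by
      rw [count_defect hl, count_defect hl]
      exact h hl

/-- No composition of `r` has more than `r / l` parts equal to `l`. -/
theorem leW_chainGroup {l : ℕ} (hl : 0 < l) (lam : Comp m n r) (d : W r) (mu : Comp m n r) :
    LeW (defectGroup l lam d mu) (chainGroup l r (r / l)) := by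
  refine leW_of_count_le (l := l) (sum_defect l lam d mu) ?_ eq_one_or_eq_of_mem_flatMap ?_ ?_
  · simp only [List.sum_append, List.sum_replicate, smul_eq_mul, mul_one, Nat.sub_self, zero_mul,
      add_zero]
    rw [mul_comm, Nat.mod_add_div]
  · intro a ha
    rcases List.mem_append.1 ha with ha | ha
    · exact Or.inl (List.eq_of_mem_replicate ha)
    · exact Or.inr (List.eq_of_mem_replicate ha)
  · intro hl1
    have h1 := sum_eq_count_add hl1 (α := (interComp lam d mu).flatMap (maxLPart l))
      eq_one_or_eq_of_mem_flatMap
    rw [sum_defect] at h1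
    rw [List.count_append, List.count_replicate, List.count_replicate]
    simp only [beq_self_eq_true, if_true]
    exact ((Nat.le_div_iff_mul_le hl).2 (by omega)).trans (Nat.le_add_left _ _)

theorem chainGroup_le {l k : ℕ} (hk : k + 1 ≤ r / l) :
    chainGroup l r k ≤ chainGroup l r (k + 1) := by
  rw [chainGroup, chainGroup,
    show r % l + (r / l - k) * l = r % l + (r / l - (k + 1)) * l + l by
      rw [show r / l - k = r / l - (k + 1) + 1 by omega, Nat.succ_mul, add_assoc]]
  exact young_replicate_le _ _ _

end Defect

/-! ### Change of the base ring -/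

section BaseChange

variable {D R : Type*} [CommRing D] [CommRing R] (φ : D →+* R) {m n r : ℕ}

/-- The matrix of `g` arises from the matrix of `f` by applying `φ`. -/
def IsBaseChange (f : Module.End D (TensorSpace D m n r))
    (g : Module.End R (TensorSpace R m n r)) : Prop :=
  ∀ i j, φ (coef f i j) = coef g i j

variable {φ}

theorem IsBaseChange.mul {f f' : Module.End D (TensorSpace D m n r)}
    {g g' : Module.End R (TensorSpace R m n r)} (h : IsBaseChange φ f g)
    (h' : IsBaseChange φ f' g') : IsBaseChange φ (f * f') (g * g') := by
  intro i j
  simp only [coef_mul, map_sum, map_mul, h _ _, h' _ _]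

theorem map_paritySign (a b : Fin (m + n)) : φ (paritySign D a b) = paritySign R a b := by
  unfold paritySign
  split_ifs <;> simp

theorem map_unit_inv (q : Dˣ) : φ (↑q⁻¹ : D) = (↑(Units.map φ.toMonoidHom q)⁻¹ : R) := by
  rw [← map_inv]; rfl

theorem map_diagFactor (q : Dˣ) (a : Fin (m + n)) :
    φ (diagFactor q a) = diagFactor (Units.map φ.toMonoidHom q) a := by
  unfold diagFactor
  split_ifs
  · rfl
  · rw [map_neg, map_unit_inv]

theorem isBaseChange_genOp (q : Dˣ) (k : Simple r) :
    IsBaseChange φ (genOp q m n k) (genOp (Units.map φ.toMonoidHom q) m n k) := by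
  intro i j
  rw [coef_genOp, coef_genOp]
  simp only [apply_ite φ, map_add, map_sub, map_zero, map_paritySign, map_diagFactor, map_unit_inv]
  rfl

theorem isBaseChange_opT (q : Dˣ) (w : W r) :
    IsBaseChange φ (opT q m n w) (opT (Units.map φ.toMonoidHom q) m n w) := by
  induction w using perm_induction with
  | one =>
    intro i j
    rw [opT_one, opT_one, coef_one, coef_one, apply_ite φ, map_one, map_zero]
  | step w k h ih =>
    rw [opT_mul_simpleRefl _ h, opT_mul_simpleRefl _ h]
    exact (isBaseChange_genOp q k).mul ih

theorem isBaseChange_normElt (q : Dˣ) (mu lam : Comp m n r) (d : W r) :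
    IsBaseChange φ (normElt q mu lam d) (normElt (Units.map φ.toMonoidHom q) mu lam d) := by
  intro i j
  simp only [coef_normElt, map_sum, map_mul, isBaseChange_opT q _ _ _]

theorem IsBaseChange.mem_schurAlgebra {q : Dˣ} {f : Module.End D (TensorSpace D m n r)}
    {g : Module.End R (TensorSpace R m n r)} (h : IsBaseChange φ f g)
    (hf : f ∈ schurAlgebra q m n r) : g ∈ schurAlgebra (Units.map φ.toMonoidHom q) m n r := by
  rw [mem_schurAlgebra_iff] at hf ⊢
  intro k
  refine coef_ext fun i j => ?_
  rw [← (isBaseChange_genOp q k).mul h, ← h.mul (isBaseChange_genOp q k), hf]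

end BaseChange

/-! ### Structure constants over a generic ring -/

section Generic

variable {D K : Type*} [CommRing D] [IsDomain D] [CommRing K] [IsDomain K] [CharZero K]
  {ψ : D →+* K} {l : ℕ} {m n r : ℕ} {q : Dˣ}

theorem poincare_ne_zero (hq : IsPrimitiveRoot (ψ ((q : D) ^ 2)) l)
    (hl : qNat ((q : D) ^ 2) l ≠ 0) {mu lam : Comp m n r} {d : W r} (hd : d ∈ superReps lam mu) :
    poincare q mu lam d ≠ 0 := by
  obtain ⟨u, hu, h⟩ := exists_poincare_eq hq hd
  rw [h]
  refine mul_ne_zero (pow_ne_zero _ hl) ?_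
  rintro rfl
  exact hu (map_zero ψ)

/-- `poincare` times the norm is a full trace, hence commutes with the generators; over a domain in
which `poincare` is nonzero, this factor can be cancelled. -/
theorem normElt_mem_schurAlgebra_of_generic (hq : IsPrimitiveRoot (ψ ((q : D) ^ 2)) l)
    (hl : qNat ((q : D) ^ 2) l ≠ 0) {mu lam : Comp m n r} {d : W r} (hd : d ∈ superReps lam mu) :
    normElt q mu lam d ∈ schurAlgebra q m n r := by
  have h1 := fullTrace_mem_schurAlgebra q (matUnit D mu.word (lam.word ∘ d))
  rw [fullTrace_matUnit q hd.1, mem_schurAlgebra_iff] at h1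
  rw [mem_schurAlgebra_iff]
  intro k
  refine coef_ext fun i j => mul_left_cancel₀ (poincare_ne_zero hq hl hd) ?_
  rw [← coef_smul, ← coef_smul, ← mul_smul_comm, h1 k, smul_mul_assoc]

/-- Both Poincaré polynomials are powers of `[l]` times elements that survive under `ψ`. If the
divisor had the larger exponent, cancelling the common power would leave a factor `[l]`, killed by
`ψ`, on one side and a survivor on the other. -/
theorem le_of_dvd_mul (hl1 : l ≠ 1) (hq : IsPrimitiveRoot (ψ ((q : D) ^ 2)) l)
    (hl : qNat ((q : D) ^ 2) l ≠ 0) {mu lam mu' lam' : Comp m n r} {d d' : W r}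
    (hd : d ∈ superReps lam mu) (hd' : d' ∈ superReps lam' mu') {x : D} (hx : ψ x ≠ 0)
    (h : poincare q mu' lam' d' ∣ poincare q mu lam d * x) :
    defectRank l lam' d' mu' ≤ defectRank l lam d mu := by
  by_contra hlt
  obtain ⟨u, hu, h1⟩ := exists_poincare_eq hq hd
  obtain ⟨v, hv, h2⟩ := exists_poincare_eq hq hd'
  obtain ⟨y, hy⟩ := h
  -- `[l]` vanishes at a primitive `l`-th root of unity only if that root is not `1`, which is where
  -- `l ≠ 1` enters.
  have h0 : ψ (qNat ((q : D) ^ 2) l) = 0 := by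
    have h3 := geom_sum_mul (ψ ((q : D) ^ 2)) l
    rw [hq.pow_eq_one, sub_self, mul_eq_zero] at h3
    rcases h3 with h3 | h3
    · simpa only [qNat, map_sum, map_pow] using h3
    · rw [sub_eq_zero] at h3
      rw [h3] at hq
      exact absurd (hq.unique IsPrimitiveRoot.one) hl1
  obtain ⟨e, he⟩ := Nat.exists_eq_add_of_lt (not_le.1 hlt)
  rw [h1, h2, he, add_assoc, pow_add, mul_assoc, mul_assoc, mul_assoc] at hy
  have h4 := congrArg ψ (mul_left_cancel₀ (pow_ne_zero _ hl) hy)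
  rw [map_mul, map_mul, map_pow, h0, zero_pow (Nat.succ_ne_zero e), zero_mul] at h4
  exact mul_ne_zero hu hx h4

/-- Multiplying either factor by its Poincaré polynomial makes it a full trace; the other factor is
absorbed into the argument of the trace, so the coefficient of the product acquires the divisibility
by the Poincaré polynomial of `y`. -/
theorem defectRank_le (hl1 : l ≠ 1) (hq : IsPrimitiveRoot (ψ ((q : D) ^ 2)) l)
    (hl : qNat ((q : D) ^ 2) l ≠ 0) {lam mu lam' mu' rho sig : Comp m n r} {d d' y : W r}
    (hd : d ∈ superReps lam mu) (hd' : d' ∈ superReps lam' mu') (hy : y ∈ superReps rho sig)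
    (h : ψ (coef (normElt q mu' lam' d' * normElt q mu lam d) sig.word (rho.word ∘ y)) ≠ 0) :
    defectRank l rho y sig ≤ defectRank l lam d mu ∧
      defectRank l rho y sig ≤ defectRank l lam' d' mu' := by
  constructor
  · refine le_of_dvd_mul hl1 hq hl hd hy h ?_
    rw [← coef_smul, ← mul_smul_comm, ← fullTrace_matUnit q hd.1,
      mul_fullTrace q (normElt_mem_schurAlgebra_of_generic hq hl hd')]
    exact poincare_dvd_coef_fullTrace q hy.1 _
  · refine le_of_dvd_mul hl1 hq hl hd' hy h ?_
    rw [← coef_smul, ← smul_mul_assoc, ← fullTrace_matUnit q hd'.1,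
      fullTrace_mul q (normElt_mem_schurAlgebra_of_generic hq hl hd)]
    exact poincare_dvd_coef_fullTrace q hy.1 _

end Generic

/-! ### Roots of unity as specialisations of an indeterminate -/

section Specialisation

open LaurentPolynomial

/-- The indeterminate `T` as a unit. -/
noncomputable def unitT : (ℤ[T;T⁻¹])ˣ :=
  ⟨T 1, T (-1), by rw [← T_add]; simp, by rw [← T_add]; simp⟩

theorem qNat_unitT_ne_zero {l : ℕ} (hl : l ≠ 0) : qNat ((unitT : ℤ[T;T⁻¹]) ^ 2) l ≠ 0 := by
  intro h
  -- At `T = 1` the sum takes the value `l`.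
  have h1 := congrArg (eval₂ (RingHom.id ℤ) 1) h
  simp only [qNat, map_sum, map_pow, unitT, eval₂_T, one_zpow, Units.val_one, one_pow,
    Finset.sum_const, Finset.card_range, nsmul_eq_mul, mul_one, map_zero, Nat.cast_eq_zero] at h1
  exact hl h1

/-- After multiplication by a power of `T`, `x` becomes a polynomial. The minimal polynomial of `z`
over `ℤ` is the cyclotomic polynomial, so the latter divides it, and `q` is a root of the cyclotomic
polynomial in any domain. This transfers nonvanishing from `R`, of any characteristic, to
characteristic zero. -/
theorem eval₂_eq_zero_of_isPrimitiveRoot {R K : Type*} [CommRing R] [IsDomain R] [Field K]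
    [CharZero K] {q : Rˣ} {z : Kˣ} {l : ℕ} (hl : 0 < l) (hq : IsPrimitiveRoot (q : R) l)
    (hz : IsPrimitiveRoot (z : K) l) {x : ℤ[T;T⁻¹]} (h : eval₂ (Int.castRingHom K) z x = 0) :
    eval₂ (Int.castRingHom R) q x = 0 := by
  obtain ⟨N, p, hp⟩ := x.exists_T_pow
  have h1 := congrArg (eval₂ (Int.castRingHom K) z) hp
  rw [map_mul, h, zero_mul, eval₂_toLaurent] at h1
  have h2 : Polynomial.cyclotomic l ℤ ∣ p := by
    rw [Polynomial.cyclotomic_eq_minpoly hz hl]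
    exact minpoly.isIntegrallyClosed_dvd (hz.isIntegral hl) h1
  have h3 : Polynomial.eval₂ (Int.castRingHom R) q p = 0 := by
    refine Polynomial.eval₂_eq_zero_of_dvd_of_eval₂_eq_zero _ _ h2 ?_
    rw [← Polynomial.eval_map, Polynomial.map_cyclotomic]
    exact hq.isRoot_cyclotomic hl
  have h4 := congrArg (eval₂ (Int.castRingHom R) q) hp
  rw [map_mul, eval₂_toLaurent, h3, eval₂_T] at h4
  exact (mul_eq_zero.1 h4.symm).resolve_right (Units.ne_zero _)

variable {R : Type*} [CommRing R] [IsDomain R] {q : Rˣ} {l : ℕ} {m n r : ℕ}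

theorem units_map_unitT {R : Type*} [CommRing R] (q : Rˣ) :
    Units.map (eval₂ (Int.castRingHom R) q).toMonoidHom unitT = q := by
  ext
  exact (eval₂_T _ _ 1).trans (by rw [zpow_one])

theorem exists_isPrimitiveRoot (hl : Odd l) :
    ∃ z : ℂˣ, IsPrimitiveRoot (z : ℂ) l ∧
      IsPrimitiveRoot (eval₂ (Int.castRingHom ℂ) z ((unitT : ℤ[T;T⁻¹]) ^ 2)) l := by
  have hz := Complex.isPrimitiveRoot_exp l hl.pos.ne'
  obtain ⟨z, hz'⟩ := hz.isUnit hl.pos.ne'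
  rw [← hz'] at hz
  refine ⟨z, hz, ?_⟩
  rw [map_pow]
  have h1 : eval₂ (Int.castRingHom ℂ) z (unitT : ℤ[T;T⁻¹]) = z :=
    congrArg Units.val (units_map_unitT z)
  rw [h1]
  exact hz.pow_of_coprime 2 (Nat.coprime_two_left.2 hl)

/-- Commutation with the generators is an identity of matrices; it holds over `ℤ[T, T⁻¹]` and is
specialised to `T = q`, even where `poincare` vanishes. -/
theorem normElt_mem_schurAlgebra {R : Type*} [CommRing R] {q : Rˣ} (hl : Odd l)
    {mu lam : Comp m n r} {d : W r}
    (hd : d ∈ superReps lam mu) : normElt q mu lam d ∈ schurAlgebra q m n r := by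
  obtain ⟨z, _, hz⟩ := exists_isPrimitiveRoot hl
  have h := (isBaseChange_normElt (φ := eval₂ (Int.castRingHom R) q) unitT mu lam
    d).mem_schurAlgebra (normElt_mem_schurAlgebra_of_generic hz (qNat_unitT_ne_zero hl.pos.ne') hd)
  rwa [units_map_unitT] at h

/-- A nonzero coefficient of a product of relative norms bounds the defect group. -/
theorem leW_of_coef_ne_zero (hl : Odd l) (hq : IsPrimitiveRoot (q : R) l)
    {lam mu lam' mu' rho sig : Comp m n r} {d d' y : W r} (hd : d ∈ superReps lam mu)
    (hd' : d' ∈ superReps lam' mu') (hy : y ∈ superReps rho sig)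
    (h : coef (normElt q mu' lam' d' * normElt q mu lam d) sig.word (rho.word ∘ y) ≠ 0) :
    LeW (defectGroup l rho y sig) (defectGroup l lam d mu) ∧
      LeW (defectGroup l rho y sig) (defectGroup l lam' d' mu') := by
  obtain ⟨z, hz, hz2⟩ := exists_isPrimitiveRoot hl
  have key : l ≠ 1 → _ := fun hl1 =>
    defectRank_le hl1 hz2 (qNat_unitT_ne_zero hl.pos.ne') hd hd' hy fun h0 => h ?_
  · exact ⟨leW_defectGroup fun hl1 => (key hl1).1, leW_defectGroup fun hl1 => (key hl1).2⟩
  · have h1 := eval₂_eq_zero_of_isPrimitiveRoot hl.pos hq hz h0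
    have h2 := (isBaseChange_normElt (φ := eval₂ (Int.castRingHom R) q) unitT mu' lam' d').mul
      (isBaseChange_normElt unitT mu lam d) sig.word (rho.word ∘ y)
    rw [units_map_unitT] at h2
    rw [← h2, h1]

end Specialisation

/-! ### The ideals attached to `l`-parabolic subgroups -/

section Ideals

variable {R : Type*} [CommRing R] [IsDomain R] {q : Rˣ} {l : ℕ} {m n r : ℕ}

/-- Otherwise `q² = -1` and `q⁴ = 1`, so the odd number `l` divides `4`. Then `l = 1`, `q = 1` and
`2 = 0`. -/
theorem add_inv_ne_zero (hR : ringChar R ≠ 2) (hl : Odd l) (hq : IsPrimitiveRoot (q : R) l) :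
    (q : R) + (↑q⁻¹ : R) ≠ 0 := by
  intro h
  have h1 : (q : R) ^ 2 = -1 := by
    have := q.mul_inv
    linear_combination (q : R) * h - this
  have h2 : (q : R) ^ (2 * 2) = 1 := by rw [pow_mul, h1]; ring
  have h3 : l = 1 := by
    have h4 : l.Coprime (2 * 2) :=
      (Nat.coprime_two_right.2 hl).mul_right (Nat.coprime_two_right.2 hl)
    exact Nat.eq_one_of_dvd_coprimes h4 dvd_rfl (hq.dvd_of_pow_eq_one _ h2)
  subst h3
  rw [IsPrimitiveRoot.one_right_iff] at hq
  rw [hq, one_pow] at h1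
  refine Ring.two_ne_zero hR ?_
  linear_combination h1

instance Comp.instFinite : Finite (Comp m n r) :=
  Finite.of_injective Comp.word fun _ _ h =>
    Comp.eq_of_word_comp_eq (x := 1) (y := 1) (congrArg (· ∘ ⇑(1 : W r)) h)

theorem coef_sum_normElt {R : Type*} [CommRing R] {q : Rˣ} (c : W r → R)
    {rho mu lam sig : Comp m n r} {d : W r}
    (hd : d ∈ superReps lam sig) :
    coef (∑ y ∈ (superReps rho mu).toFinite.toFinset, c y • normElt q mu rho y) sig.word
      (lam.word ∘ d) = if sig = mu ∧ lam = rho then c d else 0 := by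
  rw [coef_sum]
  simp only [coef_smul]
  by_cases h1 : sig = mu
  · subst h1
    by_cases h2 : lam = rho
    · subst h2
      rw [if_pos ⟨rfl, rfl⟩, Finset.sum_eq_single_of_mem d (by simpa using hd)]
      · rw [coef_normElt_doubleReps q hd.1 hd.1, if_pos ⟨rfl, rfl⟩, mul_one]
      · intro y hy hyd
        rw [Set.Finite.mem_toFinset] at hy
        rw [coef_normElt_doubleReps q hy.1 hd.1, if_neg fun h => hyd h.2.symm, mul_zero]
    · rw [if_neg fun h => h2 h.2]
      refine Finset.sum_eq_zero fun y hy => ?_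
      rw [Set.Finite.mem_toFinset] at hy
      rw [coef_normElt_doubleReps q hy.1 hd.1, if_neg fun h => h2 h.1, mul_zero]
  · rw [if_neg fun h => h1 h.1]
    exact Finset.sum_eq_zero fun y _ => by rw [coef_normElt_of_ne q h1, mul_zero]

theorem eq_of_coef_eq (hR : ringChar R ≠ 2) (hl : Odd l) (hq : IsPrimitiveRoot (q : R) l)
    {f g : Module.End R (TensorSpace R m n r)} (hf : f ∈ schurAlgebra q m n r)
    (hg : g ∈ schurAlgebra q m n r)
    (h : ∀ (lam mu : Comp m n r) (d : W r), d ∈ superReps lam mu →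
      coef f mu.word (lam.word ∘ d) = coef g mu.word (lam.word ∘ d)) : f = g := by
  have h1 := eq_zero_of_coef_eq_zero (add_inv_ne_zero hR hl hq)
    (Subalgebra.add_mem _ hf (Subalgebra.smul_mem _ hg (-1 : R))) fun lam mu d hd => by
      rw [coef_add, coef_smul, h lam mu d hd]; ring
  refine coef_ext fun i j => ?_
  have h2 := congrArg (fun f => coef f i j) h1
  simp only [coef_add, coef_smul, coef_zero] at h2
  linear_combination h2

theorem sum_normElt_mem_schurAlgebra {R : Type*} [CommRing R] {q : Rˣ} (hl : Odd l)
    (c : W r → R) (rho mu : Comp m n r) :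
    ∑ y ∈ (superReps rho mu).toFinite.toFinset, c y • normElt q mu rho y ∈
      schurAlgebra q m n r :=
  Subalgebra.sum_mem _ fun _ hy => Subalgebra.smul_mem _
    (normElt_mem_schurAlgebra hl ((Set.Finite.mem_toFinset _).1 hy)) _

/-- An element of the `q`-Schur superalgebra lies in a submodule if this contains all relative
norms that occur in the expansion of the element. -/
theorem mem_of_coef_ne_zero (hR : ringChar R ≠ 2) (hl : Odd l) (hq : IsPrimitiveRoot (q : R) l)
    {f : Module.End R (TensorSpace R m n r)} (hf : f ∈ schurAlgebra q m n r)
    {p : Submodule R (Module.End R (TensorSpace R m n r))}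
    (hp : ∀ (lam mu : Comp m n r) (d : W r), d ∈ superReps lam mu →
      coef f mu.word (lam.word ∘ d) ≠ 0 → normElt q mu lam d ∈ p) : f ∈ p := by
  classical
  have := Fintype.ofFinite (Comp m n r)
  have h1 : f = ∑ mu : Comp m n r, ∑ rho : Comp m n r,
      ∑ y ∈ (superReps rho mu).toFinite.toFinset,
        coef f mu.word (rho.word ∘ y) • normElt q mu rho y := by
    refine eq_of_coef_eq hR hl hq hf
      (Subalgebra.sum_mem _ fun mu _ => Subalgebra.sum_mem _ fun rho _ =>
        sum_normElt_mem_schurAlgebra hl _ rho mu) fun lam sig d hd => ?_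
    rw [coef_sum, Finset.sum_eq_single sig, coef_sum,
      Finset.sum_eq_single lam, coef_sum_normElt _ hd, if_pos ⟨rfl, rfl⟩]
    · intro rho _ h
      rw [coef_sum_normElt _ hd, if_neg fun h' => h h'.2.symm]
    · exact fun h => absurd (Finset.mem_univ _) h
    · intro mu _ h
      rw [coef_sum]
      refine Finset.sum_eq_zero fun rho _ => ?_
      rw [coef_sum_normElt _ hd, if_neg fun h' => h h'.1.symm]
    · exact fun h => absurd (Finset.mem_univ _) h
  rw [h1]
  refine Submodule.sum_mem _ fun mu _ => Submodule.sum_mem _ fun rho _ =>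
    Submodule.sum_mem _ fun y hy => ?_
  by_cases h : coef f mu.word (rho.word ∘ y) = 0
  · rw [h, zero_smul]
    exact Submodule.zero_mem _
  · exact Submodule.smul_mem _ _ (hp rho mu y ((Set.Finite.mem_toFinset _).1 hy) h)

theorem normElt_mul_normElt_eq (hR : ringChar R ≠ 2) (hl : Odd l)
    (hq : IsPrimitiveRoot (q : R) l) {lam mu rho : Comp m n r} {d d' : W r}
    (hd : d ∈ superReps lam mu) (hd' : d' ∈ superReps rho lam) :
    normElt q lam rho d' * normElt q mu lam d =
      ∑ y ∈ (superReps rho mu).toFinite.toFinset,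
        coef (normElt q lam rho d' * normElt q mu lam d) mu.word (rho.word ∘ y) •
          normElt q mu rho y := by
  refine eq_of_coef_eq hR hl hq
    (Subalgebra.mul_mem _ (normElt_mem_schurAlgebra hl hd') (normElt_mem_schurAlgebra hl hd))
    (sum_normElt_mem_schurAlgebra hl _ rho mu) fun lam' sig y hy => ?_
  rw [coef_sum_normElt _ hy]
  split_ifs with h
  · rw [h.1, h.2]
  -- The product kills `v_{i_σ}` for `σ ≠ μ`, and its image involves only rearrangements of `i_ρ`;
  -- all remaining coefficients vanish.
  · rw [coef_mul]
    refine Finset.sum_eq_zero fun k _ => ?_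
    by_cases h1 : sig = mu
    · by_contra h2
      obtain ⟨u, hu⟩ := exists_perm_of_coef_normElt_ne_zero q (right_ne_zero_of_mul h2)
      exact h ⟨h1, Comp.eq_of_word_comp_eq hu⟩
    · rw [coef_normElt_of_ne q h1, zero_mul]

theorem idealSpan_le_schurAlgebra {R : Type*} [CommRing R] {q : Rˣ} (hl : Odd l)
    (P : Subgroup (W r)) :
    idealSpan q l m n P ≤ Subalgebra.toSubmodule (schurAlgebra q m n r) := by
  refine Submodule.span_le.2 ?_
  rintro _ ⟨lam, mu, d, hd, _, rfl⟩
  exact normElt_mem_schurAlgebra hl hd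

theorem isSchurIdeal_idealSpan (hR : ringChar R ≠ 2) (hl : Odd l)
    (hq : IsPrimitiveRoot (q : R) l) {P : Subgroup (W r)} (hP : IsLParabolic l P) :
    IsSchurIdeal q (idealSpan q l m n P) := by
  obtain ⟨α, _, _, rfl⟩ := hP
  refine ⟨idealSpan_le_schurAlgebra hl _, fun f hf g hg => ?_⟩
  have hspan : f ∈ Submodule.span R {f | ∃ (lam mu : Comp m n r) (d : W r),
      d ∈ superReps lam mu ∧ f = normElt q mu lam d} :=
    mem_of_coef_ne_zero hR hl hq hf fun lam mu d hd _ =>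
      Submodule.subset_span ⟨lam, mu, d, hd, rfl⟩
  -- It is enough that one factor has a small defect group: every norm in the expansion of the
  -- product is bounded by both factors, and `≤_W` is transitive on Young subgroups.
  have key : ∀ (lam mu lam' mu' : Comp m n r) (d d' : W r), d ∈ superReps lam mu →
      d' ∈ superReps lam' mu' → (LeW (defectGroup l lam d mu) (young r α) ∨
        LeW (defectGroup l lam' d' mu') (young r α)) →
      normElt q mu' lam' d' * normElt q mu lam d ∈ idealSpan q l m n (young r α) := by
    intro lam mu lam' mu' d d' hd hd' h
    refine mem_of_coef_ne_zero hR hl hq (Subalgebra.mul_mem _ (normElt_mem_schurAlgebra hl hd')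
      (normElt_mem_schurAlgebra hl hd)) fun rho sig y hy hne => ?_
    obtain ⟨h1, h2⟩ := leW_of_coef_ne_zero hl hq hd hd' hy hne
    exact Submodule.subset_span ⟨rho, sig, y, hy,
      h.elim (fun h => leW_trans h1 h) fun h => leW_trans h2 h, rfl⟩
  clear hf
  change f * g ∈ _ ∧ g * f ∈ _
  induction hg using Submodule.span_induction with
  | mem g hg =>
    obtain ⟨lam, mu, d, hd, hle, rfl⟩ := hg
    induction hspan using Submodule.span_induction with
    | mem f hf' =>
      obtain ⟨lam', mu', d', hd', rfl⟩ := hf'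
      exact ⟨key _ _ _ _ _ _ hd hd' (Or.inl hle), key _ _ _ _ _ _ hd' hd (Or.inr hle)⟩
    | zero => simp
    | add a b _ _ ha hb =>
      rw [add_mul, mul_add]
      exact ⟨Submodule.add_mem _ ha.1 hb.1, Submodule.add_mem _ ha.2 hb.2⟩
    | smul c a _ ha =>
      rw [smul_mul_assoc, mul_smul_comm]
      exact ⟨Submodule.smul_mem _ _ ha.1, Submodule.smul_mem _ _ ha.2⟩
  | zero => simp
  | add a b _ _ ha hb =>
    rw [mul_add, add_mul]
    exact ⟨Submodule.add_mem _ ha.1 hb.1, Submodule.add_mem _ ha.2 hb.2⟩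
  | smul c a _ ha =>
    rw [smul_mul_assoc, mul_smul_comm]
    exact ⟨Submodule.smul_mem _ _ ha.1, Submodule.smul_mem _ _ ha.2⟩

theorem idealSpan_mono {R : Type*} [CommRing R] {q : Rˣ} {P Q : Subgroup (W r)} (h : P ≤ Q) :
    idealSpan q l m n P ≤ idealSpan q l m n Q := by
  refine Submodule.span_mono ?_
  rintro _ ⟨lam, mu, d, hd, ⟨x, hx, hx'⟩, rfl⟩
  exact ⟨lam, mu, d, hd, ⟨x, hx.trans h, hx'⟩, rfl⟩

theorem idealSpan_chainGroup (hR : ringChar R ≠ 2) (hl : Odd l)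
    (hq : IsPrimitiveRoot (q : R) l) :
    idealSpan q l m n (chainGroup l r (r / l)) =
      Subalgebra.toSubmodule (schurAlgebra q m n r) :=
  le_antisymm (idealSpan_le_schurAlgebra hl _) fun _ hf =>
    mem_of_coef_ne_zero hR hl hq hf fun lam mu d hd _ =>
      Submodule.subset_span ⟨lam, mu, d, hd, leW_chainGroup hl.pos lam d mu, rfl⟩

end Ideals

end QSchurSuper

open QSchurSuper in
/-- Endomorphisms are written on the right of their arguments in `N^d_{μλ} N^{d'}_{λρ}`, so its left
factor acts first: it is the composite `normElt q lam rho d' ∘ₗ normElt q mu lam d`. -/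
theorem theorem6p5 {R : Type*} [CommRing R] [IsDomain R] (hR : ringChar R ≠ 2)
    (q : Rˣ) (l : ℕ) (hl : Odd l) (hq : IsPrimitiveRoot (q : R) l) (m n r : ℕ) :
    (∀ (lam mu rho : Comp m n r) (d d' : W r), d ∈ superReps lam mu → d' ∈ superReps rho lam →
      (∃ a : W r → R, normElt q lam rho d' ∘ₗ normElt q mu lam d =
        ∑ y ∈ (superReps rho mu).toFinite.toFinset, a y • normElt q mu rho y) ∧
      ∀ a : W r → R, normElt q lam rho d' ∘ₗ normElt q mu lam d =
          ∑ y ∈ (superReps rho mu).toFinite.toFinset, a y • normElt q mu rho y →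
        ∀ y ∈ superReps rho mu, a y ≠ 0 →
          LeW (defectGroup l rho y mu) (defectGroup l lam d mu) ∧
          LeW (defectGroup l rho y mu) (defectGroup l rho d' lam)) ∧
    (∀ P : Subgroup (W r), IsLParabolic l P →
      IsSchurIdeal q (idealSpan q l m n P)) ∧
    (∀ k : ℕ, k + 1 ≤ r / l →
      idealSpan q l m n (chainGroup l r k) ≤ idealSpan q l m n (chainGroup l r (k + 1))) ∧
    idealSpan q l m n (chainGroup l r (r / l)) =
      Subalgebra.toSubmodule (schurAlgebra q m n r) := by
  refine ⟨fun lam mu rho d d' hd hd' => ⟨⟨_, normElt_mul_normElt_eq hR hl hq hd hd'⟩, ?_⟩,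
    fun P hP => isSchurIdeal_idealSpan hR hl hq hP,
    fun k hk => idealSpan_mono (chainGroup_le hk), idealSpan_chainGroup hR hl hq⟩
  intro a ha y hy hay
  refine leW_of_coef_ne_zero hl hq hd hd' hy ?_
  -- In any expansion `a y` is the coefficient of the product at `(i_μ, i_ρ y)`.
  have h1 := congrArg (fun f => coef f mu.word (rho.word ∘ y)) ha
  rw [coef_sum_normElt a hy, if_pos ⟨rfl, rfl⟩] at h1
  exact h1.trans_ne hay
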